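/- **Setting.** Let $\mathcal X=\mathbb R^2\times L^2((0,1);\mathbb R^2)$ with $\|(Z,w)\|_{\mathcal X}^2=\|Z\|_2^2+\|w\|_{L^2}^2$. Let $A_1,A_2,G_1,G_2,K_5\in\mathbf M_2(\mathbb R)$, $b\in\mathbb R^2$, let $\Lambda\in\mathbf M_2(\mathbb R)$ be symmetric positive definite, let $\Sigma\in C^0(\mathbb R^2;\mathbf M_2(\mathbb R))$, $h_1,h_2\in C^0(\mathbb R^2;\mathbb R^2)$ and $K_1,\dots,K_4\in C^0([0,1];\mathbf M_2(\mathbb R))$. Put $\mathscr K_i\zeta=\int_0^1K_i(\xi)\zeta(\xi)\,d\xi$ for $i=1,2,3$, $\mathscr K_4\zeta=\int_0^1K_4(\xi)\zeta(\xi)\,d\xi+K_5\zeta(1)$, and $\alpha(X,U)=A_2X+G_2U$. For $\epsilon>0$ consider the semilinear single-track vehicle model $$\dot X=A_1X+G_1\bigl[\mathscr K_1z+\Sigma(\alpha(X,U))\mathscr K_2z\bigr]+G_1h_1(\alpha(X,U))+b,$$ $$\epsilon\,\partial_tz+\Lambda\,\partial_\xi z=\Sigma(\alpha(X,U))\,[z+\mathscr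 K_3z]+\mathscr K_4z+h_2(\alpha(X,U)),\qquad z(0,t)=0,\qquad(1)$$ with state $(X(t),z(\cdot,t))\in\mathcal X$, input $U(t)\in\mathbb R^2$ and initial condition $(X_0,z_0)\in\mathcal X$. Let $\mathscr A\zeta=-\Lambda\zeta'+\mathscr K_4\zeta$ on $\mathscr D(\mathscr A)=\{\zeta\in H^1((0,1);\mathbb R^2):\zeta(0)=0\}$. A (global) *mild solution* of (1) is a pair $(X,z)\in C^0(\mathbb R_{\ge0};\mathcal X)$ such that $X$ satisfies the first equation in integrated form with $X(0)=X_0$ and, with $T$ the $C_0$-semigroup on $L^2((0,1);\mathbb R^2)$ generated by $\epsilon^{-1}\mathscr A$, for all $t\ge0$ $$z(t)=T(t)z_0+\int_0^tT(t-s)\,\epsilon^{-1}\bigl(\Sigma(\alpha(X(s),U(s)))\,[z(s)+\mathscr K_3z(s)]+h_2(\alpha(X(s),U(s)))\bigr)\,ds;$$ that this semigroup exists is part of the claim. **Assumptions.** 1. (Strict dissipativity) There are a continuous $\mathscr Q=\operatorname{diag}\{\mathscr Q_1,\mathscr Q_2\}$ on $[0,1]$ with $\mathscr Q(\xi)\succ0$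 and $\omega>0$ such that $\langle\mathscr A\zeta,\mathscr Q\zeta\rangle_{L^2}\le-\omega\|\zeta\|_{L^2}^2$ for all $\zeta\in\mathscr D(\mathscr A)$. 2. (Dissipativity and Lipschitz continuity of the source) With the same $\mathscr Q$, $\int_0^1\zeta^{\mathrm T}(\xi)\mathscr Q(\xi)\Sigma(y)[\zeta(\xi)+\mathscr K_3\zeta]\,d\xi\le0$ for all $y\in\mathbb R^2$ and $\zeta\in L^2((0,1);\mathbb R^2)$; and there is $L_\Sigma\ge0$ with $\|\Sigma(y_1)-\Sigma(y_2)\|\le L_\Sigma\|y_1-y_2\|_2$ for all $y_1,y_2$. 3. (Regularity of the steady state) Under 1 and 2, for each $y\in\mathbb R^2$ there is a unique $\varphi(\cdot,y)\in C^1([0,1];\mathbb R^2)$ with $\Lambda\,\partial_\xi\varphi=\Sigma(y)[\varphi+\mathscr K_3\varphi]+\mathscr K_4\varphi+h_2(y)$ on $(0,1)$ and $\varphi(0,y)=0$. Put $\Phi(y)=\mathscr K_1\varphi(\cdot,y)+\Sigma(y)\mathscr K_2\varphi(\cdot,y)+h_1(y)$. Assume that $\varphi\in C^1([0,1]\times\mathbb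 R^2;\mathbb R^2)$, that $\Phi\in C^1(\mathbb R^2;\mathbb R^2)$, and that $\|\partial_y\varphi(\xi,y)\|\le M_\varphi$ for all $(\xi,y)\in[0,1]\times\mathbb R^2$, for some $M_\varphi\ge0$. Let $(X^\star,U^\star)\in\mathbb R^2\times\mathbb R^2$ be an equilibrium: with $\alpha^\star=\alpha(X^\star,U^\star)$, $A_1X^\star+G_1\Phi(\alpha^\star)+b=0$ (the distributed component being $z^\star=\varphi(\cdot,\alpha^\star)$). Let $\tilde C=\frac{d\Phi}{dy}(\alpha^\star)$, $\tilde A_1=A_1+G_1\tilde CA_2$ and $\tilde G_1=G_1\tilde CG_2$. 4. (Stabilizability) The pair $(\tilde A_1,\tilde G_1)$ is stabilizable. **Theorem.** Let Assumptions 1–4 hold, let $F\in\mathbf M_2(\mathbb R)$ be such that $\tilde A_1^*=\tilde A_1+\tilde G_1F$ is Hurwitz, and apply the feedback $U(t)=U^\star+F(X(t)-X^\star)$. Write $\zeta(\cdot,t)=z(\cdot,t)-\varphi(\cdot,\alpha(X(t),U(t)))$ and $\zeta_0=z_0-\varphi\bigl(\cdot,\alpha(X_0,U^\star+F(X_0-X^\star))\bigr)$.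 Then there exist $\epsilon^{**},r^*,\beta^*,\sigma^*>0$ such that for all $\epsilon\in(0,\epsilon^{**})$ and all $(X_0,z_0)\in\mathcal X$ with $\|(X_0-X^\star,\zeta_0)\|_{\mathcal X}<r^*$, the closed-loop system (1) has a unique mild solution $(X,z)\in C^0(\mathbb R_{\ge0};\mathcal X)$, and $$\|(X(t)-X^\star,\zeta(\cdot,t))\|_{\mathcal X}\le\beta^*e^{-\sigma^*t}\,\|(X_0-X^\star,\zeta_0)\|_{\mathcal X}\qquad\text{for all }t\ge0.$$ -/

import Mathlib

open MeasureTheory Set Filter Topology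
open scoped ContDiff

noncomputable section

namespace SingleTrack

/-- The Euclidean plane. -/
abbrev E2 : Type := EuclideanSpace ℝ (Fin 2)

/-- Real two-by-two matrices. -/
abbrev M2 : Type := Matrix (Fin 2) (Fin 2) ℝ

/-- Lebesgue measure on the interval `(0,1)`. -/
abbrev mu01 : Measure ℝ := volume.restrict (Ioo (0 : ℝ) 1)

/-- The Hilbert space `L²((0,1); ℝ²)`. -/
abbrev L2 : Type := Lp E2 2 mu01

/-- A matrix as an operator on the Euclidean plane (with the spectral norm). -/
abbrev act (M : M2) : E2 →L[ℝ] E2 := Matrix.toEuclideanCLM (n := Fin 2) (𝕜 := ℝ) M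

/-- `∫₀¹ K(ξ) u(ξ) dξ`. -/
def kernelInt (K : ℝ → M2) (u : ℝ → E2) : E2 := ∫ ξ, act (K ξ) (u ξ) ∂mu01

/-- The norm of `ℝ² × L²((0,1); ℝ²)`. -/
def stateNorm (Z : E2) (w : L2) : ℝ := Real.sqrt (‖Z‖ ^ 2 + ‖w‖ ^ 2)

/-- `u` is (the representative, continuous on `[0,1]`, of) an element of `H¹((0,1); ℝ²)`, and
`g` is its weak derivative, which lies in `L²`. -/
structure IsH1 (u g : ℝ → E2) : Prop where
  continuousOn : ContinuousOn u (Icc 0 1)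
  memLp : MemLp g 2 mu01
  weak_deriv : ∀ ϕ : ℝ → ℝ, ContDiff ℝ ∞ ϕ → HasCompactSupport ϕ → tsupport ϕ ⊆ Ioo 0 1 →
    ∫ ξ, deriv ϕ ξ • u ξ ∂mu01 = - ∫ ξ, ϕ ξ • g ξ ∂mu01

/-- The data of the ODE-PDE interconnection
`X' = A₁ X + G₁ [𝒦₁ z + Σ(α) 𝒦₂ z] + G₁ h₁(α) + b`,
`ε z_t + Λ z_ξ = Σ(α) [z + 𝒦₃ z] + 𝒦₄ z + h₂(α)`, `z(0,t) = 0`,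
with `α = A₂ X + G₂ U`. -/
structure System where
  A₁ : M2
  A₂ : M2
  G₁ : M2
  G₂ : M2
  b : E2
  /-- The matrix of transport velocities. -/
  Lam : M2
  /-- The nonlinear source matrix. -/
  Sig : E2 → M2
  h₁ : E2 → E2
  h₂ : E2 → E2
  K₁ : ℝ → M2
  K₂ : ℝ → M2
  K₃ : ℝ → M2
  K₄ : ℝ → M2
  K₅ : M2
  /-- `Λ` is symmetric and positive definite. -/
  Lam_posDef : Lam.PosDef
  Sig_cont : Continuous Sig
  h₁_cont : Continuous h₁
  h₂_cont : Continuous h₂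
  K₁_cont : ContinuousOn K₁ (Icc 0 1)
  K₂_cont : ContinuousOn K₂ (Icc 0 1)
  K₃_cont : ContinuousOn K₃ (Icc 0 1)
  K₄_cont : ContinuousOn K₄ (Icc 0 1)

namespace System

variable (S : System)

/-- The apparent slip angles `α(X,U) = A₂ X + G₂ U`. -/
def slip (X U : E2) : E2 := act S.A₂ X + act S.G₂ U

/-- `𝒦₄ u = ∫₀¹ K₄(ξ) u(ξ) dξ + K₅ u(1)`. -/
def calK₄ (u : ℝ → E2) : E2 := kernelInt S.K₄ u + act S.K₅ (u 1)

/-- `f` is a `C¹([0,1])` solution of the nonlocal problem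
`Λ f' = Σ(y) [f + 𝒦₃ f] + 𝒦₄ f + h₂(y)` on `(0,1)`, `f(0) = 0`. -/
structure IsSteadyProfile (y : E2) (f : ℝ → E2) : Prop where
  contDiffOn : ContDiffOn ℝ 1 f (Icc 0 1)
  left : f 0 = 0
  eqn : ∀ ξ ∈ Ioo (0 : ℝ) 1,
    act S.Lam (deriv f ξ) = act (S.Sig y) (f ξ + kernelInt S.K₃ f) + S.calK₄ f + S.h₂ y

open Classical in
/-- The steady profile `φ(ξ,y)` of the distributed state for the frozen slip angles `y`. -/
def phi (ξ : ℝ) (y : E2) : E2 :=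
  if h : ∃ f, S.IsSteadyProfile y f then h.choose ξ else 0

theorem continuousOn_phi (y : E2) : ContinuousOn (fun ξ => S.phi ξ y) (Icc 0 1) := by
  by_cases h : ∃ f, S.IsSteadyProfile y f
  · simpa only [phi, h, dite_true] using h.choose_spec.contDiffOn.continuousOn
  · simpa only [phi, h, dite_false] using continuousOn_const

theorem memLp_phi (y : E2) : MemLp (fun ξ => S.phi ξ y) 2 mu01 := by
  have hc := S.continuousOn_phi y
  obtain ⟨C, hC⟩ := isCompact_Icc.exists_bound_of_continuousOn hc
  refine MemLp.of_bound ((hc.mono Ioo_subset_Icc_self).aestronglyMeasurable measurableSet_Ioo) C ?_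
  exact (ae_restrict_mem measurableSet_Ioo).mono fun ξ hξ => hC ξ (Ioo_subset_Icc_self hξ)

/-- `φ(·,y)` as an element of `L²((0,1); ℝ²)`. -/
def phiL2 (y : E2) : L2 := (S.memLp_phi y).toLp _

/-- The steady-state tire forces `Φ(y) = 𝒦₁ φ(·,y) + Σ(y) 𝒦₂ φ(·,y) + h₁(y)`. -/
def Phi (y : E2) : E2 :=
  kernelInt S.K₁ (fun ξ => S.phi ξ y) + act (S.Sig y) (kernelInt S.K₂ (fun ξ => S.phi ξ y))
    + S.h₁ y

/-- The matrix of generalized cornering stiffnesses: the Jacobian matrix of `Φ` at `y`. -/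
def Ctilde (y : E2) : M2 :=
  Matrix.of fun i j => (fderiv ℝ S.Phi y (EuclideanSpace.single j 1)) i

/-- `Ã₁ = A₁ + G₁ C̃ A₂`. -/
def A₁tilde (y : E2) : M2 := S.A₁ + S.G₁ * S.Ctilde y * S.A₂

/-- `G̃₁ = G₁ C̃ G₂`. -/
def G₁tilde (y : E2) : M2 := S.G₁ * S.Ctilde y * S.G₂

/-- Strict dissipativity, with weight `Q = diag(Q₁,Q₂)`, of the operator `𝒜 u = -Λ u' + 𝒦₄ u`
with domain `{u ∈ H¹ : u(0) = 0}`. -/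
def StrictlyDissipative (Q : ℝ → M2) : Prop :=
  ContinuousOn Q (Icc 0 1) ∧ (∀ ξ ∈ Icc (0 : ℝ) 1, (Q ξ).IsDiag ∧ (Q ξ).PosDef) ∧
  ∃ om : ℝ, 0 < om ∧ ∀ u g : ℝ → E2, IsH1 u g → u 0 = 0 →
    ∫ ξ, inner ℝ (-(act S.Lam (g ξ)) + S.calK₄ u) (act (Q ξ) (u ξ)) ∂mu01
      ≤ -om * ∫ ξ, ‖u ξ‖ ^ 2 ∂mu01

/-- Dissipativity of the source term with weight `Q`, and global Lipschitz continuity of the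
source matrix. -/
def SourceDissipative (Q : ℝ → M2) : Prop :=
  (∀ (y : E2) (w : L2),
    ∫ ξ, inner ℝ (w ξ) (act (Q ξ) (act (S.Sig y) (w ξ + kernelInt S.K₃ w))) ∂mu01 ≤ 0) ∧
  ∃ L : ℝ, 0 ≤ L ∧ ∀ y₁ y₂ : E2, ‖act (S.Sig y₁ - S.Sig y₂)‖ ≤ L * ‖y₁ - y₂‖

/-- `φ ∈ C¹([0,1] × ℝ²)`, `Φ ∈ C¹(ℝ²)`, and `∂φ/∂y` is uniformly bounded. -/
def SmoothSteadyState : Prop :=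
  ContDiffOn ℝ 1 (fun p : ℝ × E2 => S.phi p.1 p.2) (Icc 0 1 ×ˢ univ) ∧
  ContDiff ℝ 1 S.Phi ∧
  ∃ M : ℝ, 0 ≤ M ∧ ∀ y : E2, ∀ ξ ∈ Icc (0 : ℝ) 1, ‖fderiv ℝ (S.phi ξ) y‖ ≤ M

/-- `X` is the lumped component of an equilibrium for the constant input `U`; the distributed
component is then `φ(·, A₂ X + G₂ U)`. -/
def IsEquilibrium (X U : E2) : Prop :=
  act S.A₁ X + act S.G₁ (S.Phi (S.slip X U)) + S.b = 0

/-- The graph of the unbounded operator `𝒜 u = -Λ u' + 𝒦₄ u`, `u ∈ H¹`, `u(0) = 0`, on `L²`: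
`x` is in the domain and `𝒜 x = y`. -/
def GraphA (x y : L2) : Prop :=
  ∃ u g : ℝ → E2, IsH1 u g ∧ u 0 = 0 ∧ x =ᵐ[mu01] u ∧
    y =ᵐ[mu01] fun ξ => -(act S.Lam (g ξ)) + S.calK₄ u

/-- Right-hand side of the lumped dynamics. -/
def odeRhs (X U : E2) (z : L2) : E2 :=
  act S.A₁ X
    + act S.G₁ (kernelInt S.K₁ z + act (S.Sig (S.slip X U)) (kernelInt S.K₂ z))
    + act S.G₁ (S.h₁ (S.slip X U)) + S.b

/-- The part `Σ(α) [z + 𝒦₃ z] + h₂(α)` of the distributed dynamics, as an element of `L²`. -/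
def pdeSource (X U : E2) (z : L2) : L2 :=
  (act (S.Sig (S.slip X U))).compLpL 2 mu01 (z + Lp.const 2 mu01 (kernelInt S.K₃ z))
    + Lp.const 2 mu01 (S.h₂ (S.slip X U))

end System

/-- `T`, restricted to nonnegative times, is a strongly continuous semigroup on `H`. -/
structure IsC0Semigroup {H : Type*} [NormedAddCommGroup H] [NormedSpace ℝ H]
    (T : ℝ → H →L[ℝ] H) : Prop where
  zero : T 0 = ContinuousLinearMap.id ℝ H
  add : ∀ s t : ℝ, 0 ≤ s → 0 ≤ t → T (s + t) = (T s).comp (T t)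
  tendsto : ∀ x : H, Tendsto (fun t => T t x) (𝓝[>] 0) (𝓝 x)

/-- The operator with graph `B` is the infinitesimal generator of `T`. -/
def IsGenerator {H : Type*} [NormedAddCommGroup H] [NormedSpace ℝ H]
    (T : ℝ → H →L[ℝ] H) (B : H → H → Prop) : Prop :=
  ∀ x y : H, B x y ↔ Tendsto (fun t : ℝ => t⁻¹ • (T t x - x)) (𝓝[>] 0) (𝓝 y)

/-- `(X,z) ∈ C⁰([0,∞); ℝ² × L²)` is a global mild solution, with input `U` and initial condition
`(X₀,z₀)`: `X` solves the integrated lumped equation, and `z` satisfies the variation of constants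
formula for the semigroup generated by `ε⁻¹ 𝒜`. -/
structure IsMildSolution (S : System) (ε : ℝ) (U : ℝ → E2) (X₀ : E2) (z₀ : L2)
    (X : ℝ → E2) (z : ℝ → L2) : Prop where
  continuousOn_X : ContinuousOn X (Ici 0)
  continuousOn_z : ContinuousOn z (Ici 0)
  lumped : ∀ t : ℝ, 0 ≤ t → X t = X₀ + ∫ s in (0 : ℝ)..t, S.odeRhs (X s) (U s) (z s)
  distributed : ∃ T : ℝ → L2 →L[ℝ] L2, IsC0Semigroup T ∧
    IsGenerator T (fun x y => S.GraphA x (ε • y)) ∧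
    ∀ t : ℝ, 0 ≤ t →
      z t = T t z₀ + ∫ s in (0 : ℝ)..t, T (t - s) (ε⁻¹ • S.pdeSource (X s) (U s) (z s))

/-- All eigenvalues have negative real part. -/
def IsHurwitz (M : M2) : Prop :=
  ∀ c ∈ spectrum ℂ (M.map (algebraMap ℝ ℂ)), c.re < 0

/-- The pair `(A,B)` is stabilizable. -/
def IsStabilizable (A B : M2) : Prop := ∃ K : M2, IsHurwitz (A + B * K)

/-- The state feedback `U = U⋆ + F (X - X⋆)`. -/
def feedback (F : M2) (Xs Us X : E2) : E2 := Us + act F (X - Xs)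

/-- The boundary-layer variable `ζ = z - φ(·, α(X,U))`, as an element of `L²`. -/
def zeta (S : System) (X U : E2) (z : L2) : L2 := z - S.phiL2 (S.slip X U)

end SingleTrack

end

/-!
The closed loop is treated by singular perturbation, with a composite Lyapunov functional
`W = ⟨X - X⋆, P (X - X⋆)⟩ + ⟨ζ, 𝒬 ζ⟩`: `P` solves the Lyapunov equation of the linearized reduced
system, and `ζ = z - φ(·, α)` is the boundary-layer variable, measured with the dissipativity
weight.

*Semigroup.* Strict dissipativity makes `-𝒜` invertible with a bounded inverse `R`: since `𝒦₄ u`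
is a constant vector, `-𝒜 u = f` is solved by integration up to a linear equation in the plane
(`System.exists_inverse`). All that is used about `𝒜` afterwards is that `R` is injective and
accretive in the weighted inner product (`DissipativeInverse`). The operators `-(R + δ)⁻¹`, which
exist by the Lax-Milgram theorem, generate contraction semigroups in the weighted norm; as `δ → 0`
these converge to a semigroup with generator `-R⁻¹` (`DissipativeInverse.exists_isSemigroupOf`,
`IsSemigroupOf.isGenerator`), the only one (`DissipativeInverse.semigroup_unique`). Its weighted
norm decays at a rate proportional to `om / ε`.

*Well-posedness.* Only continuity of `h₁` and `h₂` is assumed, but integrating the equation of the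
steady profile over `(0,1)` expresses `h₂` through `φ`, and `h₁` is expressed through `Φ` and `φ`;
so both are Lipschitz on bounded sets, and so is the vector field (`System.lipBdd_closedLoop`). This
gives uniqueness by Gronwall's inequality, and global existence once the vector field is composed
with the retraction onto a large ball. The composition is invisible along trajectories that stay
small. That the steady profile exists for every `y` is `System.exists_isSteadyProfile`.

*Decay.* For a mild solution `z(t+h) = T(h) z(t) + h g(t) + o(h)`. As `φ(·, α)` lies in the domain of
`𝒜` and is Lipschitz in `α`, this bounds the forward Dini derivative of `⟨ζ, 𝒬 ζ⟩` with no
regularity of `z` (`System.energy_dini`). The source contributes a nonpositive term, and for small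
`ε` the fast decay of `ζ` absorbs every cross term, so that `W' ≤ -2σ W` while the error is small;
Gronwall's inequality and the first exit time then give the estimate for all times
(`decay_of_dini`).
-/

namespace SingleTrack

/-! ### Yosida approximations -/

section Semigroup

variable {H : Type*} [NormedAddCommGroup H] [InnerProductSpace ℝ H]

/-- `R` is the inverse of `-A` for an operator `A` that is strictly dissipative, with rate `om`, in
the inner product with weight `Q`; every property of `A` that is needed is expressed through the
bounded operator `R`, and the graph of `A` is `{(x, y) | x = -R y}`. -/
structure DissipativeInverse (Q R : H →L[ℝ] H) (c om : ℝ) : Prop where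
  c_pos : 0 < c
  om_pos : 0 < om
  symm : ∀ x y, inner ℝ (Q x) y = inner ℝ x (Q y)
  coercive : ∀ x, c * ‖x‖ ^ 2 ≤ inner ℝ x (Q x)
  accretive : ∀ f, om * ‖R f‖ ^ 2 ≤ inner ℝ f (Q (R f))
  injective : ∀ f, R f = 0 → f = 0

/-- The inverse of `R + δ`; if `R = (-A)⁻¹`, its negative is a Yosida approximation of `A`. -/
noncomputable def shiftInv (R : H →L[ℝ] H) (δ : ℝ) : H →L[ℝ] H :=
  Ring.inverse (R + δ • (1 : H →L[ℝ] H))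

namespace DissipativeInverse

variable {Q R : H →L[ℝ] H} {c om : ℝ}

theorem weight_nonneg (h : DissipativeInverse Q R c om) (x : H) : 0 ≤ inner ℝ x (Q x) :=
  le_trans (mul_nonneg h.c_pos.le (sq_nonneg _)) (h.coercive x)

theorem accretive' (h : DissipativeInverse Q R c om) (x : H) : 0 ≤ inner ℝ x (Q (R x)) :=
  le_trans (mul_nonneg h.om_pos.le (sq_nonneg _)) (h.accretive x)

theorem weight_le (Q : H →L[ℝ] H) (x : H) : inner ℝ x (Q x) ≤ ‖Q‖ * ‖x‖ ^ 2 := by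
  calc inner ℝ x (Q x) ≤ ‖x‖ * ‖Q x‖ := real_inner_le_norm _ _
    _ ≤ ‖x‖ * (‖Q‖ * ‖x‖) := by gcongr; exact Q.le_opNorm x
    _ = _ := by ring

theorem norm_le_of_weight_le (h : DissipativeInverse Q R c om) {x y : H}
    (hxy : inner ℝ x (Q x) ≤ inner ℝ y (Q y)) : ‖x‖ ≤ √(‖Q‖ / c) * ‖y‖ := by
  have h1 : ‖x‖ ^ 2 ≤ ‖Q‖ / c * ‖y‖ ^ 2 := by
    rw [div_mul_eq_mul_div, le_div_iff₀ h.c_pos, mul_comm]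
    exact (h.coercive x).trans (hxy.trans (weight_le Q y))
  rw [← Real.sqrt_sq (norm_nonneg x), ← Real.sqrt_sq (norm_nonneg y), ← Real.sqrt_mul]
  · exact Real.sqrt_le_sqrt h1
  · exact div_nonneg (norm_nonneg _) h.c_pos.le

theorem weight_add (h : DissipativeInverse Q R c om) (x y : H) :
    inner ℝ (x + y) (Q (x + y)) = inner ℝ x (Q x) + 2 * inner ℝ x (Q y) + inner ℝ y (Q y) := by
  have : inner ℝ y (Q x) = inner ℝ x (Q y) := by rw [← h.symm, real_inner_comm]
  simp only [map_add, inner_add_left, inner_add_right, this]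
  ring

/-- The semigroup generated by the bounded operator `-(R + δ)⁻¹`. -/
noncomputable def approx (R : H →L[ℝ] H) (δ t : ℝ) : H →L[ℝ] H :=
  NormedSpace.exp (t • (-shiftInv R δ))

theorem approx_zero (R : H →L[ℝ] H) (δ : ℝ) (x : H) : approx R δ 0 x = x := by
  simp [approx]

theorem commute_ringInverse_right {M₀ : Type*} [MonoidWithZero M₀] {a b : M₀} (h : Commute a b) :
    Commute a (Ring.inverse b) := by
  by_cases hb : IsUnit b
  · obtain ⟨u, rfl⟩ := hb
    rw [Ring.inverse_unit]
    exact h.units_inv_right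
  · rw [Ring.inverse_non_unit _ hb]
    exact Commute.zero_right a

theorem commute_shiftInv (R : H →L[ℝ] H) (δ : ℝ) : Commute R (shiftInv R δ) := by
  have h1 : Commute R (R + δ • (1 : H →L[ℝ] H)) :=
    (Commute.refl R).add_right ((Commute.one_right R).smul_right δ)
  exact commute_ringInverse_right h1

theorem commute_shiftInv_shiftInv (R : H →L[ℝ] H) (δ η : ℝ) :
    Commute (shiftInv R δ) (shiftInv R η) := by
  have h1 : Commute (shiftInv R δ) (R + η • (1 : H →L[ℝ] H)) :=
    (commute_shiftInv R δ).symm.add_right ((Commute.one_right _).smul_right η)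
  exact commute_ringInverse_right h1

theorem shiftInv_comm (x : H) (δ : ℝ) : shiftInv R δ (R x) = R (shiftInv R δ x) :=
  congrArg (fun L : H →L[ℝ] H => L x) (commute_shiftInv R δ).eq.symm

theorem approx_comm {R L : H →L[ℝ] H} {δ : ℝ} (hL : Commute L (shiftInv R δ)) (t : ℝ) (x : H) :
    approx R δ t (L x) = L (approx R δ t x) := by
  have : Commute L (approx R δ t) := (hL.neg_right.smul_right t).exp_right
  exact congrArg (fun L : H →L[ℝ] H => L x) this.eq.symm

variable [CompleteSpace H]

theorem bijective_of_coercive {B : H →L[ℝ] H} {a : ℝ} (ha : 0 < a)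
    (hB : ∀ x, a * ‖x‖ ^ 2 ≤ inner ℝ (B x) x) : Function.Bijective B := by
  have hco : IsCoercive ((innerSL ℝ).comp B) :=
    ⟨a, ha, fun u => by simpa [sq, mul_assoc] using hB u⟩
  have : ∀ x, hco.continuousLinearEquivOfBilin x = B x := fun x =>
    ext_inner_right ℝ fun w => by simp
  rw [← funext this]
  exact hco.continuousLinearEquivOfBilin.bijective

theorem isUnit_shift (h : DissipativeInverse Q R c om) {δ : ℝ} (hδ : 0 < δ) :
    IsUnit (R + δ • (1 : H →L[ℝ] H)) := by
  rw [ContinuousLinearMap.isUnit_iff_bijective]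
  have hQ : Function.Bijective Q := bijective_of_coercive h.c_pos fun x => by
    rw [h.symm]; exact h.coercive x
  have hQR : Function.Bijective (Q.comp (R + δ • (1 : H →L[ℝ] H))) := by
    refine bijective_of_coercive (mul_pos hδ h.c_pos) fun x => ?_
    have h1 := h.accretive' x
    have h2 := mul_le_mul_of_nonneg_left (h.coercive x) hδ.le
    simp only [ContinuousLinearMap.comp_apply, add_apply,
      smul_apply, one_apply_eq_self, map_add, map_smul,
      inner_add_left, inner_smul_left]
    rw [real_inner_comm, real_inner_comm x (Q x)]
    simp only [conj_trivial]
    linarith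
  exact (Function.Bijective.of_comp_iff' hQ _).1 hQR

theorem shift_shiftInv (h : DissipativeInverse Q R c om) {δ : ℝ} (hδ : 0 < δ) (x : H) :
    R (shiftInv R δ x) + δ • shiftInv R δ x = x := by
  exact congrArg (fun L : H →L[ℝ] H => L x) (Ring.mul_inverse_cancel _ (h.isUnit_shift hδ))

theorem inner_shiftInv_nonneg (h : DissipativeInverse Q R c om) {δ : ℝ} (hδ : 0 < δ) (x : H) :
    0 ≤ inner ℝ (shiftInv R δ x) (Q x) := by
  have hx : Q x = Q (R (shiftInv R δ x)) + δ • Q (shiftInv R δ x) := by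
    rw [← map_smul, ← map_add, h.shift_shiftInv hδ]
  rw [hx, inner_add_right, inner_smul_right]
  exact add_nonneg (h.accretive' _) (mul_nonneg hδ.le (h.weight_nonneg _))

/-- `R (R + δ)⁻¹ = (1 - δ A)⁻¹` is a contraction in the weighted norm. -/
theorem weight_R_shiftInv_le (h : DissipativeInverse Q R c om) {δ : ℝ} (hδ : 0 < δ) (x : H) :
    inner ℝ (R (shiftInv R δ x)) (Q (R (shiftInv R δ x))) ≤ inner ℝ x (Q x) := by
  conv_rhs => rw [← h.shift_shiftInv hδ x, h.weight_add]
  have h1 := h.accretive' (shiftInv R δ x)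
  have h2 := h.weight_nonneg (δ • shiftInv R δ x)
  have h3 : inner ℝ (R (shiftInv R δ x)) (Q (δ • shiftInv R δ x))
      = δ * inner ℝ (shiftInv R δ x) (Q (R (shiftInv R δ x))) := by
    rw [map_smul, inner_smul_right, ← h.symm, real_inner_comm]
  rw [h3]
  nlinarith [mul_nonneg hδ.le h1]

theorem norm_R_shiftInv_le (h : DissipativeInverse Q R c om) {δ : ℝ} (hδ : 0 < δ) (x : H) :
    ‖R (shiftInv R δ x)‖ ≤ √(‖Q‖ / c) * ‖x‖ :=
  h.norm_le_of_weight_le (h.weight_R_shiftInv_le hδ x)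

/-- An element that is orthogonal to the range, in the weighted inner product, is killed by `R`
because of accretivity. -/
theorem exists_R_near (h : DissipativeInverse Q R c om) (x : H) {η : ℝ} (hη : 0 < η) :
    ∃ f, ‖x - R f‖ < η := by
  have hd : (R.range).topologicalClosure = ⊤ := by
    rw [Submodule.topologicalClosure_eq_top_iff, Submodule.eq_bot_iff]
    intro z hz
    have hQ : Function.Bijective Q := bijective_of_coercive h.c_pos fun x => by
      rw [h.symm]; exact h.coercive x
    obtain ⟨w, rfl⟩ := hQ.2 z
    have h0 : inner ℝ (R w) (Q w) = 0 :=
      (Submodule.mem_orthogonal _ _).1 hz (R w) ⟨w, rfl⟩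
    have h1 := h.accretive w
    rw [← h.symm, real_inner_comm, h0] at h1
    have h2 : ‖R w‖ ^ 2 ≤ 0 := by
      by_contra hc
      push Not at hc
      nlinarith [mul_pos h.om_pos hc]
    have h3 : R w = 0 := by
      rw [← norm_eq_zero]; nlinarith [norm_nonneg (R w)]
    rw [h.injective w h3, map_zero]
  have hx : x ∈ closure (R.range : Set H) := by
    rw [← Submodule.topologicalClosure_coe, hd]; trivial
  obtain ⟨y, ⟨f, rfl⟩, hy⟩ := Metric.mem_closure_iff.1 hx η hη
  exact ⟨f, by simpa [dist_eq_norm] using hy⟩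

/-- Convergence of uniformly bounded operators need only be checked on the range of `R`. -/
theorem tendsto_of_tendsto_range (h : DissipativeInverse Q R c om) {ι : Type*} {l : Filter ι}
    {L : ι → H →L[ℝ] H} {C : ℝ} (hL : ∀ᶠ i in l, ∀ x, ‖L i x‖ ≤ C * ‖x‖) {L₀ : H →L[ℝ] H}
    (hC : ∀ x, ‖L₀ x‖ ≤ C * ‖x‖)
    (hR : ∀ f, Tendsto (fun i => L i (R f)) l (𝓝 (L₀ (R f)))) (x : H) :
    Tendsto (fun i => L i x) l (𝓝 (L₀ x)) := by
  rw [Metric.tendsto_nhds]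
  intro η hη
  have hC' : 0 < |C| + 1 := by positivity
  obtain ⟨f, hf⟩ := h.exists_R_near x (η := η / (3 * (|C| + 1))) (by positivity)
  rw [lt_div_iff₀ (by positivity)] at hf
  have hb : ∀ K : H →L[ℝ] H, (∀ x, ‖K x‖ ≤ C * ‖x‖) → ‖K (x - R f)‖ < η / 3 := fun K hK => by
    have := hK (x - R f)
    nlinarith [norm_nonneg (x - R f), le_abs_self C,
      mul_le_mul_of_nonneg_right (le_abs_self C) (norm_nonneg (x - R f))]
  filter_upwards [hL, Metric.tendsto_nhds.1 (hR f) (η / 3) (by positivity)] with i hi h2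
  have h1 := hb (L i) hi
  have h3 := hb L₀ hC
  rw [dist_eq_norm] at h2 ⊢
  have : L i x - L₀ x = L i (x - R f) + (L i (R f) - L₀ (R f)) - L₀ (x - R f) := by
    simp only [map_sub]; abel
  rw [this]
  calc _ ≤ ‖L i (x - R f)‖ + ‖L i (R f) - L₀ (R f)‖ + ‖L₀ (x - R f)‖ :=
        (norm_sub_le _ _).trans (by gcongr; exact norm_add_le _ _)
    _ < η := by linarith

theorem hasDerivAt_approx (R : H →L[ℝ] H) (δ t : ℝ) (x : H) :
    HasDerivAt (fun s => approx R δ s x) (-(approx R δ t (shiftInv R δ x))) t := by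
  have := (hasDerivAt_exp_smul_const (-shiftInv R δ) t).clm_apply (hasDerivAt_const t x)
  simpa [approx] using this

theorem hasDerivAt_approx' (R : H →L[ℝ] H) (δ t : ℝ) (x : H) :
    HasDerivAt (fun s => approx R δ s x) (-(shiftInv R δ (approx R δ t x))) t := by
  have := (hasDerivAt_exp_smul_const' (-shiftInv R δ) t).clm_apply (hasDerivAt_const t x)
  simpa [approx] using this

theorem approx_add (R : H →L[ℝ] H) (δ s t : ℝ) (x : H) :
    approx R δ (s + t) x = approx R δ s (approx R δ t x) := by
  let +nondep : NormedAlgebra ℚ (H →L[ℝ] H) := .restrictScalars ℚ ℝ _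
  simp only [approx, add_smul]
  rw [NormedSpace.exp_add_of_commute (((Commute.refl _).smul_left _).smul_right _)]
  rfl

theorem weight_approx_le (h : DissipativeInverse Q R c om) {δ : ℝ} (hδ : 0 < δ) {t : ℝ}
    (ht : 0 ≤ t) (x : H) :
    inner ℝ (approx R δ t x) (Q (approx R δ t x)) ≤ inner ℝ x (Q x) := by
  have hd : ∀ s, HasDerivAt (fun s => inner ℝ (approx R δ s x) (Q (approx R δ s x)))
      (inner ℝ (approx R δ s x) (Q (-(shiftInv R δ (approx R δ s x))))
        + inner ℝ (-(shiftInv R δ (approx R δ s x))) (Q (approx R δ s x))) s := fun s =>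
    (hasDerivAt_approx' R δ s x).inner ℝ (Q.hasFDerivAt.comp_hasDerivAt s (hasDerivAt_approx' R δ s x))
  have hanti : Antitone fun s => inner ℝ (approx R δ s x) (Q (approx R δ s x)) := by
    refine antitone_of_deriv_nonpos (fun s => (hd s).differentiableAt) fun s => ?_
    rw [(hd s).deriv]
    have := h.inner_shiftInv_nonneg hδ (approx R δ s x)
    rw [map_neg, inner_neg_right, inner_neg_left, ← h.symm, real_inner_comm]
    linarith
  simpa [approx_zero] using hanti ht

theorem norm_approx_le (h : DissipativeInverse Q R c om) {δ : ℝ} (hδ : 0 < δ) {t : ℝ}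
    (ht : 0 ≤ t) (x : H) : ‖approx R δ t x‖ ≤ √(‖Q‖ / c) * ‖x‖ :=
  h.norm_le_of_weight_le (h.weight_approx_le hδ ht x)

theorem tendsto_R_shiftInv (h : DissipativeInverse Q R c om) (x : H) :
    Tendsto (fun δ => R (shiftInv R δ x)) (𝓝[>] 0) (𝓝 x) := by
  have hpos : ∀ᶠ δ : ℝ in 𝓝[>] 0, 0 < δ := self_mem_nhdsWithin
  set M := √(‖Q‖ / c)
  refine h.tendsto_of_tendsto_range (L := fun δ => R.comp (shiftInv R δ)) (C := M + 1)
    (L₀ := ContinuousLinearMap.id ℝ H) ?_ ?_ ?_ x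
  · filter_upwards [hpos] with δ hδ x
    have := h.norm_R_shiftInv_le hδ x
    simp only [ContinuousLinearMap.comp_apply]
    nlinarith [norm_nonneg x]
  · intro x
    have : 0 ≤ M := Real.sqrt_nonneg _
    simp only [ContinuousLinearMap.id_apply]
    nlinarith [norm_nonneg x]
  · intro f
    rw [tendsto_iff_norm_sub_tendsto_zero]
    have hlim : Tendsto (fun δ : ℝ => δ * (M * ‖f‖)) (𝓝[>] 0) (𝓝 0) := by
      have : Tendsto (fun δ : ℝ => δ * (M * ‖f‖)) (𝓝 0) (𝓝 (0 * (M * ‖f‖))) :=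
        tendsto_id.mul_const _
      rw [zero_mul] at this
      exact this.mono_left nhdsWithin_le_nhds
    refine squeeze_zero' (Eventually.of_forall fun _ => norm_nonneg _) ?_ hlim
    filter_upwards [hpos] with δ hδ
    have h1 : R (shiftInv R δ (R f)) - R f = -(δ • R (shiftInv R δ f)) := by
      have := h.shift_shiftInv hδ (R f)
      rw [shiftInv_comm] at this ⊢
      rw [sub_eq_iff_eq_add, neg_add_eq_sub, eq_sub_iff_add_eq, this]
    simp only [ContinuousLinearMap.comp_apply, ContinuousLinearMap.id_apply]
    rw [h1, norm_neg, norm_smul, Real.norm_of_nonneg hδ.le]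
    gcongr
    exact h.norm_R_shiftInv_le hδ f

/-- Mean value inequality for `s ↦ exp(s A_δ) exp((t - s) A_η) x`, where `A_δ = -(R + δ)⁻¹` and
`A_η` commute. -/
theorem norm_approx_sub_le (h : DissipativeInverse Q R c om) {δ η : ℝ} (hδ : 0 < δ) (hη : 0 < η)
    {t : ℝ} (ht : 0 ≤ t) (x : H) :
    ‖approx R δ t x - approx R η t x‖
      ≤ √(‖Q‖ / c) * (√(‖Q‖ / c) * ‖shiftInv R δ x - shiftInv R η x‖) * t := by
  have hder : ∀ s : ℝ, HasDerivAt (fun s => approx R δ s (approx R η (t - s) x))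
      (approx R δ s (approx R η (t - s) (shiftInv R η x - shiftInv R δ x))) s := by
    intro s
    have h1 : HasDerivAt (fun s => approx R δ s) (-(approx R δ s * shiftInv R δ)) s := by
      have := hasDerivAt_exp_smul_const (𝕂 := ℝ) (-shiftInv R δ) s
      simpa [approx] using this
    have h2 : HasDerivAt (fun s => approx R η (t - s) x) (approx R η (t - s) (shiftInv R η x)) s := by
      have := (hasDerivAt_approx R η (t - s) x).scomp s ((hasDerivAt_id s).const_sub t)
      simpa [Function.comp_def] using this
    refine (h1.clm_apply h2).congr_deriv ?_
    rw [map_sub, map_sub]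
    rw [neg_apply, mul_apply_eq_comp,
      ← approx_comm (commute_shiftInv_shiftInv R δ η) (t - s)]
    abel
  have := norm_image_sub_le_of_norm_deriv_le_segment' (f := fun s => approx R δ s
      (approx R η (t - s) x)) (a := 0) (b := t)
      (C := √(‖Q‖ / c) * (√(‖Q‖ / c) * ‖shiftInv R δ x - shiftInv R η x‖))
      (fun s _ => (hder s).hasDerivWithinAt) (fun s hs => by
        refine (h.norm_approx_le hδ hs.1 _).trans ?_
        gcongr
        rw [norm_sub_rev (shiftInv R δ x)]
        exact h.norm_approx_le hη (by linarith [hs.2]) _) t (right_mem_Icc.2 ht)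
  simpa [approx_zero] using this

/-- The parameters of the Yosida approximations. -/
noncomputable def seq (n : ℕ) : ℝ := 1 / ((n : ℝ) + 1)

theorem seq_pos (n : ℕ) : 0 < seq n := Nat.one_div_pos_of_nat

theorem tendsto_seq : Tendsto seq atTop (𝓝[>] 0) :=
  tendsto_nhdsWithin_iff.2 ⟨tendsto_one_div_add_atTop_nhds_zero_nat, Eventually.of_forall seq_pos⟩

/-- On the range of `R` the Yosida approximations converge, since
`(R + δ)⁻¹ R f = R (R + δ)⁻¹ f → f`; uniform boundedness and density give the rest. -/
theorem cauchySeq_approx (h : DissipativeInverse Q R c om) {t : ℝ} (ht : 0 ≤ t) (x : H) :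
    CauchySeq fun n => approx R (seq n) t x := by
  set M := √(‖Q‖ / c) with hM
  have hM0 : 0 ≤ M := Real.sqrt_nonneg _
  have hR : ∀ f, CauchySeq fun n => approx R (seq n) t (R f) := by
    intro f
    have hS : CauchySeq fun n => shiftInv R (seq n) (R f) := by
      have := ((h.tendsto_R_shiftInv f).comp tendsto_seq).cauchySeq
      simpa [Function.comp_def, shiftInv_comm] using this
    rw [Metric.cauchySeq_iff] at hS ⊢
    intro η hη
    obtain ⟨N, hN⟩ := hS (η / (M * M * t + 1)) (by positivity)
    refine ⟨N, fun m hm n hn => ?_⟩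
    have h1 := h.norm_approx_sub_le (seq_pos m) (seq_pos n) ht (R f)
    have h2 := hN m hm n hn
    rw [dist_eq_norm] at h2 ⊢
    rw [lt_div_iff₀ (by positivity)] at h2
    rw [← hM] at h1
    nlinarith [norm_nonneg (shiftInv R (seq m) (R f) - shiftInv R (seq n) (R f))]
  rw [Metric.cauchySeq_iff]
  intro η hη
  obtain ⟨f, hf⟩ := h.exists_R_near x (η := η / (3 * (M + 1))) (by positivity)
  rw [lt_div_iff₀ (by positivity)] at hf
  obtain ⟨N, hN⟩ := Metric.cauchySeq_iff.1 (hR f) (η / 3) (by positivity)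
  have hb : ∀ n, ‖approx R (seq n) t (x - R f)‖ < η / 3 := fun n => by
    have := h.norm_approx_le (seq_pos n) ht (x - R f)
    rw [← hM] at this
    nlinarith [norm_nonneg (x - R f)]
  refine ⟨N, fun m hm n hn => ?_⟩
  have h1 := hb m
  have h2 := hN m hm n hn
  have h3 := hb n
  rw [dist_eq_norm] at h2 ⊢
  have : approx R (seq m) t x - approx R (seq n) t x = approx R (seq m) t (x - R f)
      + (approx R (seq m) t (R f) - approx R (seq n) t (R f)) - approx R (seq n) t (x - R f) := by
    simp only [map_sub]; abel
  rw [this]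
  calc _ ≤ ‖approx R (seq m) t (x - R f)‖
          + ‖approx R (seq m) t (R f) - approx R (seq n) t (R f)‖
          + ‖approx R (seq n) t (x - R f)‖ :=
        (norm_sub_le _ _).trans (by gcongr; exact norm_add_le _ _)
    _ < η := by linarith

end DissipativeInverse
end Semigroup
end SingleTrack

namespace SingleTrack

/-! ### The semigroup of a dissipative operator -/

section SemigroupLimit

variable {H : Type*} [NormedAddCommGroup H] [InnerProductSpace ℝ H]

/-- `T`, at nonnegative times, is the semigroup generated by `-R⁻¹`; the generator enters through
the integrated equation `T(t) R f - R f = -∫₀ᵗ T(s) f ds`. At negative times `T` is only required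
to stay bounded and strongly continuous, so that `s ↦ T(t - s)` is harmless on the whole line. -/
structure IsSemigroupOf (R : H →L[ℝ] H) (M : ℝ) (T : ℝ → H →L[ℝ] H) : Prop where
  zero : ∀ x, T 0 x = x
  add : ∀ s t, 0 ≤ s → 0 ≤ t → ∀ x, T (s + t) x = T s (T t x)
  bound : ∀ t x, ‖T t x‖ ≤ M * ‖x‖
  cont : ∀ x, Continuous fun t => T t x
  comm : ∀ t f, T t (R f) = R (T t f)
  integrated : ∀ t, 0 ≤ t → ∀ f, T t (R f) - R f = -∫ s in (0 : ℝ)..t, T s f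

namespace DissipativeInverse

variable {Q R : H →L[ℝ] H} {c om : ℝ} [CompleteSpace H]

/-- The semigroup is the strong limit of those generated by the Yosida approximations; negative
times are sent to `0`. -/
theorem exists_isSemigroupOf (h : DissipativeInverse Q R c om) :
    ∃ T : ℝ → H →L[ℝ] H, IsSemigroupOf R (√(‖Q‖ / c)) T := by
  set M := √(‖Q‖ / c) with hM
  have hM0 : 0 ≤ M := Real.sqrt_nonneg _
  choose L hL using fun (t : ℝ) (x : H) =>
    cauchySeq_tendsto_of_complete (h.cauchySeq_approx (le_max_right t 0) x)
  have hLb : ∀ t x, ‖L t x‖ ≤ M * ‖x‖ := fun t x =>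
    le_of_tendsto (hL t x).norm
      (Eventually.of_forall fun n => h.norm_approx_le (seq_pos n) (le_max_right t 0) x)
  let T : ℝ → H →L[ℝ] H := fun t =>
    LinearMap.mkContinuous
      { toFun := L t
        map_add' := fun x y => tendsto_nhds_unique (hL t (x + y))
          (by simpa using (hL t x).add (hL t y))
        map_smul' := fun a x => tendsto_nhds_unique (hL t (a • x))
          (by simpa using (hL t x).const_smul a) } M (hLb t)
  have hT : ∀ t x, Tendsto (fun n => approx R (seq n) (max t 0) x) atTop (𝓝 (T t x)) := hL
  have hT0 : ∀ t, 0 ≤ t → ∀ x, Tendsto (fun n => approx R (seq n) t x) atTop (𝓝 (T t x)) :=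
    fun t ht x => by simpa [max_eq_left ht] using hT t x
  have hTb : ∀ t x, ‖T t x‖ ≤ M * ‖x‖ := hLb
  have hcR : ∀ f, Continuous fun t => T t (R f) := by
    intro f
    have hlip : ∀ n, ∀ s t : ℝ, 0 ≤ s → 0 ≤ t →
        ‖approx R (seq n) t (R f) - approx R (seq n) s (R f)‖ ≤ M * (M * ‖f‖) * ‖t - s‖ := by
      intro n s t hs ht
      refine (convex_Ici (0 : ℝ)).norm_image_sub_le_of_norm_hasDerivWithin_le
        (f := fun r => approx R (seq n) r (R f))
        (fun r _ => (hasDerivAt_approx R (seq n) r (R f)).hasDerivWithinAt) (fun r hr => ?_) hs ht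
      rw [norm_neg, shiftInv_comm]
      refine (h.norm_approx_le (seq_pos n) hr _).trans ?_
      gcongr
      exact h.norm_R_shiftInv_le (seq_pos n) f
    have hlipT : ∀ s t : ℝ, ‖T t (R f) - T s (R f)‖ ≤ M * (M * ‖f‖) * ‖t - s‖ := by
      intro s t
      refine le_of_tendsto ((hT t (R f)).sub (hT s (R f))).norm (Eventually.of_forall fun n => ?_)
      refine (hlip n _ _ (le_max_right s 0) (le_max_right t 0)).trans ?_
      gcongr
      exact abs_max_sub_max_le_abs t s 0
    refine (LipschitzWith.of_dist_le_mul (K := (M * (M * ‖f‖)).toNNReal) fun t s => ?_).continuous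
    rw [dist_eq_norm, dist_eq_norm, Real.coe_toNNReal _ (by positivity)]
    exact hlipT s t
  have hcont : ∀ x, Continuous fun t => T t x := fun x =>
    continuous_iff_continuousAt.2 fun t₀ =>
      h.tendsto_of_tendsto_range (L := T) (L₀ := T t₀) (C := M)
        (Eventually.of_forall fun t => hTb t) (hTb t₀) (fun f => (hcR f).continuousAt) x
  refine ⟨T, ⟨fun x => ?_, fun s t hs ht x => ?_, hTb, hcont, fun t f => ?_,
    fun t ht f => ?_⟩⟩
  · refine tendsto_nhds_unique (hT 0 x) ?_
    simp [approx_zero]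
  · have h1 := hT0 (s + t) (add_nonneg hs ht) x
    refine tendsto_nhds_unique h1 ?_
    have h2 : Tendsto (fun n => approx R (seq n) s (approx R (seq n) t x - T t x)
        + approx R (seq n) s (T t x)) atTop (𝓝 (0 + T s (T t x))) := by
      refine Tendsto.add ?_ (hT0 s hs _)
      rw [tendsto_zero_iff_norm_tendsto_zero]
      have h3 := ((tendsto_iff_norm_sub_tendsto_zero.1 (hT0 t ht x)).const_mul M)
      rw [mul_zero] at h3
      exact squeeze_zero (fun _ => norm_nonneg _) (fun n => h.norm_approx_le (seq_pos n) hs _) h3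
    rw [zero_add] at h2
    refine h2.congr fun n => ?_
    rw [approx_add, map_sub]; abel
  · refine tendsto_nhds_unique (hT t (R f)) ?_
    refine ((R.continuous.tendsto _).comp (hT t f)).congr fun n => ?_
    exact (approx_comm (commute_shiftInv R (seq n)) _ f).symm
  · have hn : ∀ n, approx R (seq n) t (R f) + seq n • approx R (seq n) t f - (R f + seq n • f)
        = -∫ s in (0 : ℝ)..t, approx R (seq n) s f := by
      intro n
      have hd : ∀ s ∈ uIcc 0 t, HasDerivAt (fun s => approx R (seq n) s (R f + seq n • f))
          (-(approx R (seq n) s f)) s := fun s _ => by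
        have := hasDerivAt_approx R (seq n) s (R f + seq n • f)
        rwa [map_add, map_smul, shiftInv_comm, h.shift_shiftInv (seq_pos n)] at this
      have hc : Continuous fun s => -(approx R (seq n) s f) :=
        (continuous_iff_continuousAt.2 fun s => (hasDerivAt_approx R (seq n) s f).continuousAt).neg
      have := intervalIntegral.integral_eq_sub_of_hasDerivAt hd (hc.intervalIntegrable _ _)
      rw [intervalIntegral.integral_neg, approx_zero] at this
      rw [this, map_add, map_smul]
    have hs0 : Tendsto seq atTop (𝓝 0) := tendsto_seq.mono_right nhdsWithin_le_nhds
    have hl : Tendsto (fun n => approx R (seq n) t (R f) + seq n • approx R (seq n) t f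
        - (R f + seq n • f)) atTop (𝓝 (T t (R f) + (0 : ℝ) • T t f - (R f + (0 : ℝ) • f))) :=
      ((hT0 t ht _).add (hs0.smul (hT0 t ht f))).sub
        (tendsto_const_nhds.add (hs0.smul tendsto_const_nhds))
    have hr : Tendsto (fun n => ∫ s in (0 : ℝ)..t, approx R (seq n) s f) atTop
        (𝓝 (∫ s in (0 : ℝ)..t, T s f)) := by
      refine intervalIntegral.tendsto_integral_filter_of_dominated_convergence
        (fun _ => M * ‖f‖) (Eventually.of_forall fun n => ?_) (Eventually.of_forall fun n => ?_)
        intervalIntegrable_const ?_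
      · exact (continuous_iff_continuousAt.2 fun s =>
          (hasDerivAt_approx R (seq n) s f).continuousAt).aestronglyMeasurable
      · refine Eventually.of_forall fun s hs => ?_
        rw [uIoc_of_le ht] at hs
        exact h.norm_approx_le (seq_pos n) hs.1.le f
      · refine Eventually.of_forall fun s hs => ?_
        rw [uIoc_of_le ht] at hs
        exact hT0 s hs.1.le f
    have := tendsto_nhds_unique hl (by simpa only [hn] using hr.neg)
    simpa using this

end DissipativeInverse

namespace IsSemigroupOf

variable {R : H →L[ℝ] H} {M : ℝ} {T : ℝ → H →L[ℝ] H}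

theorem isC0Semigroup (hT : IsSemigroupOf R M T) : IsC0Semigroup T where
  zero := by ext1 x; exact hT.zero x
  add s t hs ht := by ext1 x; exact hT.add s t hs ht x
  tendsto x := by
    have := (hT.cont x).tendsto 0
    rw [hT.zero] at this
    exact this.mono_left nhdsWithin_le_nhds

variable [CompleteSpace H]

theorem tendsto_average {g : ℝ → H} (hg : Continuous g) :
    Tendsto (fun t : ℝ => t⁻¹ • ∫ s in (0 : ℝ)..t, g s) (𝓝[>] 0) (𝓝 (g 0)) := by
  have h1 := (hg.integral_hasStrictDerivAt 0 0).hasDerivAt.tendsto_slope_zero_right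
  simpa using h1

theorem hasDerivWithinAt_R (hT : IsSemigroupOf R M T) (f : H) {t : ℝ} (ht : 0 ≤ t) :
    HasDerivWithinAt (fun s => T s (R f)) (-(T t f)) (Ici t) t := by
  have h1 : HasDerivAt (fun t => R f - ∫ s in (0 : ℝ)..t, T s f) (-(T t f)) t := by
    simpa using ((hT.cont f).integral_hasStrictDerivAt 0 t).hasDerivAt.const_sub (R f)
  refine h1.hasDerivWithinAt.congr (fun s hs => ?_) ?_
  · rw [sub_eq_add_neg, ← hT.integrated s (ht.trans hs)]; abel
  · rw [sub_eq_add_neg, ← hT.integrated t ht]; abel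

theorem tendsto_quotient (hT : IsSemigroupOf R M T) (f : H) :
    Tendsto (fun t : ℝ => t⁻¹ • (T t (R f) - R f)) (𝓝[>] 0) (𝓝 (-f)) := by
  have h1 := (tendsto_average (hT.cont f)).neg
  rw [hT.zero] at h1
  refine h1.congr' ?_
  filter_upwards [self_mem_nhdsWithin] with t ht
  rw [hT.integrated t (le_of_lt ht), smul_neg]

/-- Applying `R` to the difference quotient identifies every limit of it. -/
theorem isGenerator (hT : IsSemigroupOf R M T) :
    IsGenerator T (fun x y => x = -(R y)) := by
  intro x y
  constructor
  · rintro rfl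
    simpa using hT.tendsto_quotient (-y)
  · intro hy
    have h1 : Tendsto (fun t : ℝ => t⁻¹ • (T t (R x) - R x)) (𝓝[>] 0) (𝓝 (R y)) := by
      refine ((R.continuous.tendsto y).comp hy).congr fun t => ?_
      simp [hT.comm]
    have := tendsto_nhds_unique h1 (hT.tendsto_quotient x)
    change x = -(R y)
    rw [this, neg_neg]

end IsSemigroupOf

/-- A strongly continuous semigroup is bounded near time zero, by the uniform boundedness
principle. -/
theorem IsC0Semigroup.exists_bound [CompleteSpace H] {T : ℝ → H →L[ℝ] H} (hT : IsC0Semigroup T) :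
    ∃ δ > 0, ∃ C, ∀ t, 0 ≤ t → t ≤ δ → ‖T t‖ ≤ C := by
  by_contra! hcon
  choose t ht0 ht1 htC using fun n : ℕ => hcon (1 / ((n : ℝ) + 1)) Nat.one_div_pos_of_nat n
  have ht : Tendsto t atTop (𝓝 0) :=
    squeeze_zero ht0 ht1 tendsto_one_div_add_atTop_nhds_zero_nat
  have hpos : ∀ n, 1 ≤ n → 0 < t n := fun n hn => by
    refine lt_of_le_of_ne (ht0 n) fun h0 => ?_
    have := htC n
    rw [← h0, hT.zero] at this
    have h1 : (1 : ℝ) ≤ n := by exact_mod_cast hn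
    linarith [ContinuousLinearMap.norm_id_le (𝕜 := ℝ) (E := H)]
  have ht' : Tendsto t atTop (𝓝[>] 0) :=
    tendsto_nhdsWithin_iff.2 ⟨ht, (eventually_ge_atTop 1).mono hpos⟩
  obtain ⟨C, hC⟩ := banach_steinhaus (g := fun n => T (t n)) fun x => by
    obtain ⟨C, hC⟩ := ((hT.tendsto x).comp ht').norm.bddAbove_range
    exact ⟨C, fun n => hC ⟨n, rfl⟩⟩
  obtain ⟨n, hn⟩ := exists_nat_gt C
  linarith [hC n, htC n]

/-- Continuity from the left needs local boundedness, because it transfers the right continuity at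
zero to a varying base point. -/
theorem IsC0Semigroup.continuousOn [CompleteSpace H] {T : ℝ → H →L[ℝ] H} (hT : IsC0Semigroup T)
    (x : H) : ContinuousOn (fun t => T t x) (Ici 0) := by
  obtain ⟨δ, hδ, C, hC⟩ := hT.exists_bound
  have hz : Tendsto (fun h => T h x - x) (𝓝[≥] 0) (𝓝 0) := by
    have h1 : Tendsto (fun h => T h x - x) (𝓝[>] 0) (𝓝 0) := by
      simpa using (hT.tendsto x).sub_const x
    rw [← Ioi_union_left (a := (0 : ℝ)), nhdsWithin_union, tendsto_sup]
    refine ⟨h1, ?_⟩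
    rw [nhdsWithin_singleton, tendsto_pure_left]
    intro s hs
    simpa [hT.zero] using mem_of_mem_nhds hs
  -- boundedness on compact intervals of times
  have hb : ∀ n : ℕ, ∃ B, ∀ t, 0 ≤ t → t ≤ n * δ → ‖T t‖ ≤ B := by
    intro n
    induction n with
    | zero => exact ⟨C, fun t h0 h1 => hC t h0 (h1.trans (by simpa using hδ.le))⟩
    | succ n ih =>
      obtain ⟨B, hB⟩ := ih
      refine ⟨max B (B * C), fun t h0 h1 => ?_⟩
      rcases le_total t (n * δ) with h2 | h2
      · exact (hB t h0 h2).trans (le_max_left _ _)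
      · refine le_trans ?_ (le_max_right _ _)
        have hn : 0 ≤ n * δ := by positivity
        have h3 := hB (n * δ) hn le_rfl
        have h4 := hC (t - n * δ) (by linarith) (by push_cast at h1; linarith)
        have h5 := hT.add (n * δ) (t - n * δ) hn (by linarith)
        rw [add_sub_cancel] at h5
        rw [h5]
        exact (ContinuousLinearMap.opNorm_comp_le _ _).trans
          (mul_le_mul h3 h4 (norm_nonneg _) ((norm_nonneg _).trans h3))
  intro t₀ ht₀
  obtain ⟨n, hn⟩ := exists_nat_gt ((t₀ + 1) / δ)
  rw [div_lt_iff₀ hδ] at hn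
  obtain ⟨B, hB⟩ := hb n
  rw [ContinuousWithinAt, tendsto_iff_norm_sub_tendsto_zero]
  have habs : Tendsto (fun t => |t - t₀|) (𝓝[Ici 0] t₀) (𝓝[≥] 0) := by
    refine tendsto_nhdsWithin_iff.2 ⟨?_, Eventually.of_forall fun t => mem_Ici.2 (abs_nonneg _)⟩
    have : Continuous fun t => |t - t₀| := by fun_prop
    simpa using (this.tendsto t₀).mono_left nhdsWithin_le_nhds
  have hlim := ((hz.comp habs).norm).const_mul B
  rw [norm_zero, mul_zero] at hlim
  refine squeeze_zero' (Eventually.of_forall fun _ => norm_nonneg _) ?_ hlim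
  have hlt : ∀ᶠ t in 𝓝[Ici 0] t₀, t < t₀ + 1 :=
    nhdsWithin_le_nhds (Iio_mem_nhds (by linarith))
  filter_upwards [hlt, self_mem_nhdsWithin] with t ht1 ht2
  have ht2' : (0 : ℝ) ≤ t := ht2
  have ht₀' : (0 : ℝ) ≤ t₀ := ht₀
  have key : ∀ a b : ℝ, 0 ≤ a → a ≤ b → a ≤ t₀ + 1 → ‖T b x - T a x‖ ≤ B * ‖T (b - a) x - x‖ := by
    intro a b ha hab ha1
    have := hT.add a (b - a) ha (by linarith)
    rw [add_sub_cancel] at this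
    rw [this, ContinuousLinearMap.comp_apply, ← map_sub]
    exact (T a).le_of_opNorm_le (hB a ha (by linarith)) _
  simp only [Function.comp_def]
  rcases le_total t₀ t with h1 | h1
  · rw [abs_of_nonneg (by linarith)]
    exact key t₀ t ht₀' h1 (by linarith)
  · rw [abs_of_nonpos (by linarith), neg_sub, norm_sub_rev]
    exact key t t₀ ht2' h1 (by linarith)

variable {Q R : H →L[ℝ] H} {c om M : ℝ} [CompleteSpace H]

/-- Integration of the difference of two solutions gives `w` with `w' = -R⁻¹ w` and `w(0) = 0`,
whose weighted norm cannot increase. -/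
theorem DissipativeInverse.semigroup_unique (h : DissipativeInverse Q R c om)
    {T T' : ℝ → H →L[ℝ] H} (hT : IsSemigroupOf R M T) (hT' : IsC0Semigroup T')
    (hg : IsGenerator T' (fun x y => x = -(R y))) {t : ℝ} (ht : 0 ≤ t) (f : H) :
    T' t f = T t f := by
  have hc' := hT'.continuousOn
  have hR : ∀ s, 0 ≤ s → T' s (R f) = R (T' s f) ∧
      HasDerivWithinAt (fun s => T' s (R f)) (-(T' s f)) (Ici s) s := by
    intro s hs
    have h0 := (hg (R f) (-f)).1 (by simp)
    have h1 : Tendsto (fun r : ℝ => r⁻¹ • (T' r (T' s (R f)) - T' s (R f))) (𝓝[>] 0)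
        (𝓝 (-(T' s f))) := by
      have h2 := ((T' s).continuous.tendsto _).comp h0
      rw [map_neg] at h2
      refine h2.congr' ?_
      filter_upwards [self_mem_nhdsWithin] with r hr
      have h3 : T' r (T' s (R f)) = T' s (T' r (R f)) := by
        have h4 := (hT'.add r s (le_of_lt hr) hs).symm.trans
          ((congrArg T' (add_comm r s)).trans (hT'.add s r hs (le_of_lt hr)))
        exact congrArg (fun L : H →L[ℝ] H => L (R f)) h4
      simp [h3]
    refine ⟨by simpa using (hg _ _).2 h1, ?_⟩
    rw [← hasDerivWithinAt_Ioi_iff_Ici, hasDerivWithinAt_iff_tendsto_slope' (by simp)]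
    have hsub : Tendsto (fun r : ℝ => r - s) (𝓝[>] s) (𝓝[>] 0) := by
      refine tendsto_nhdsWithin_iff.2 ⟨?_, ?_⟩
      · have : Continuous fun r : ℝ => r - s := by fun_prop
        simpa using (this.tendsto s).mono_left nhdsWithin_le_nhds
      · filter_upwards [self_mem_nhdsWithin] with r hr using sub_pos.2 (mem_Ioi.1 hr)
    refine (h1.comp hsub).congr' ?_
    filter_upwards [self_mem_nhdsWithin] with r hr
    have hr' : s < r := hr
    have := hT'.add (r - s) s (by linarith) hs
    rw [sub_add_cancel] at this
    simp [slope, this]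
  set u : ℝ → H := fun s => T' s f - T s f with hu
  have hder : ∀ s, 0 ≤ s → HasDerivWithinAt (fun s => R (u s)) (-(u s)) (Ici s) s := by
    intro s hs
    have h1 := (hR s hs).2.sub (hT.hasDerivWithinAt_R f hs)
    rw [← neg_sub'] at h1
    refine h1.congr (fun r hr => ?_) ?_
    · simp [hu, (hR r (hs.trans hr)).1, hT.comm]
    · simp [hu, (hR s hs).1, hT.comm]
  have huc : ContinuousOn u (Icc 0 t) :=
    ((hc' f).mono Icc_subset_Ici_self).sub (hT.cont f).continuousOn
  have hRuc : ContinuousOn (fun s => R (u s)) (Icc 0 t) := R.continuous.comp_continuousOn huc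
  have hV := image_le_of_deriv_right_le_deriv_boundary
    (f := fun s => inner ℝ (R (u s)) (Q (R (u s)))) (B := fun _ => 0) (B' := fun _ => 0)
    (f' := fun s => inner ℝ (R (u s)) (Q (-(u s))) + inner ℝ (-(u s)) (Q (R (u s))))
    (a := 0) (b := t) (hRuc.inner (Q.continuous.comp_continuousOn hRuc))
    (fun s hs => (hder s hs.1).inner ℝ (Q.hasFDerivAt.comp_hasDerivWithinAt s (hder s hs.1)))
    (by simp [hu, hT.zero, hT'.zero]) continuousOn_const
    (fun s _ => hasDerivWithinAt_const _ _ _)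
    (fun s _ => by
      have := h.accretive' (u s)
      rw [map_neg, inner_neg_right, inner_neg_left, ← h.symm, real_inner_comm]
      linarith) (right_mem_Icc.2 ht)
  have h2 := (h.coercive (R (u t))).trans hV
  have h3 : R (u t) = 0 := by
    have h4 : ‖R (u t)‖ ^ 2 ≤ 0 := by
      by_contra hc
      push Not at hc
      nlinarith [mul_pos h.c_pos hc]
    rw [← norm_eq_zero]; nlinarith [norm_nonneg (R (u t))]
  exact sub_eq_zero.1 (h.injective _ h3)

/-- Strict dissipativity makes the weighted norm decay exponentially along the semigroup. -/
theorem DissipativeInverse.weight_semigroup_le (h : DissipativeInverse Q R c om)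
    {T : ℝ → H →L[ℝ] H} (hT : IsSemigroupOf R M T) {k : ℝ} (hk : k * ‖Q‖ ≤ 2 * om) (hk0 : 0 ≤ k)
    {t : ℝ} (ht : 0 ≤ t) (x : H) :
    inner ℝ (T t x) (Q (T t x)) ≤ Real.exp (-k * t) * inner ℝ x (Q x) := by
  have hR : ∀ f, inner ℝ (T t (R f)) (Q (T t (R f))) ≤ Real.exp (-k * t) * inner ℝ (R f) (Q (R f)) := by
    intro f
    have hd : ∀ s, 0 ≤ s → HasDerivWithinAt (fun s => inner ℝ (T s (R f)) (Q (T s (R f))))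
        (inner ℝ (T s (R f)) (Q (-(T s f))) + inner ℝ (-(T s f)) (Q (T s (R f)))) (Ici s) s :=
      fun s hs => (hT.hasDerivWithinAt_R f hs).inner ℝ
        (Q.hasFDerivAt.comp_hasDerivWithinAt s (hT.hasDerivWithinAt_R f hs))
    have := le_gronwallBound_of_liminf_deriv_right_le
      (f := fun s => inner ℝ (T s (R f)) (Q (T s (R f)))) (δ := inner ℝ (R f) (Q (R f)))
      (K := -k) (ε := 0) (a := 0) (b := t)
      (((hT.cont (R f)).inner (Q.continuous.comp (hT.cont (R f)))).continuousOn)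
      (fun s hs r hr => (hd s hs.1).liminf_right_slope_le hr) (by simp [hT.zero])
      (fun s _ => by
        have h1 := h.accretive (T s f)
        have h2 := DissipativeInverse.weight_le Q (R (T s f))
        rw [hT.comm, map_neg, inner_neg_right, inner_neg_left, ← h.symm, real_inner_comm]
        nlinarith [sq_nonneg ‖R (T s f)‖, mul_le_mul_of_nonneg_left h2 hk0,
          mul_le_mul_of_nonneg_right hk (sq_nonneg ‖R (T s f)‖)]) t (right_mem_Icc.2 ht)
    rw [gronwallBound_ε0, sub_zero] at this
    linarith
  have hcl : IsClosed {x : H | inner ℝ (T t x) (Q (T t x)) ≤ Real.exp (-k * t) * inner ℝ x (Q x)} :=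
    isClosed_le (by fun_prop) (by fun_prop)
  have hx : x ∈ closure (range R) := Metric.mem_closure_iff.2 fun η hη => by
    obtain ⟨f, hf⟩ := h.exists_R_near x hη
    exact ⟨R f, ⟨f, rfl⟩, by simpa [dist_eq_norm] using hf⟩
  exact closure_minimal (by rintro _ ⟨f, rfl⟩; exact hR f) hcl hx

end SemigroupLimit
end SingleTrack

namespace SingleTrack

/-! ### Mild solutions of semilinear equations -/

section Mild

variable {E : Type*} [NormedAddCommGroup E] [NormedSpace ℝ E]

/-- `G` is Lipschitz continuous on bounded sets. -/
def LipBdd {F : Type*} [NormedAddCommGroup F] (G : E → F) : Prop :=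
  ∀ ρ : ℝ, ∃ K : ℝ, 0 ≤ K ∧ ∀ x y, ‖x‖ ≤ ρ → ‖y‖ ≤ ρ → ‖G x - G y‖ ≤ K * ‖x - y‖

/-- The radial retraction onto the closed ball of radius `ρ`, for `ρ > 0`. -/
noncomputable def retr (ρ : ℝ) (x : E) : E := (ρ / max ρ ‖x‖) • x

theorem retr_of_le {ρ : ℝ} (hρ : 0 < ρ) {x : E} (hx : ‖x‖ ≤ ρ) : retr ρ x = x := by
  rw [retr, max_eq_left hx, div_self hρ.ne', one_smul]

theorem norm_retr_le {ρ : ℝ} (hρ : 0 < ρ) (x : E) : ‖retr ρ x‖ ≤ ρ := by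
  have hm : 0 < max ρ ‖x‖ := lt_max_of_lt_left hρ
  rw [retr, norm_smul, Real.norm_of_nonneg (by positivity), div_mul_eq_mul_div, div_le_iff₀ hm]
  gcongr
  exact le_max_right _ _

theorem norm_retr_sub_le {ρ : ℝ} (hρ : 0 < ρ) (x y : E) :
    ‖retr ρ x - retr ρ y‖ ≤ 2 * ‖x - y‖ := by
  have hx : 0 < max ρ ‖x‖ := lt_max_of_lt_left hρ
  have hy : 0 < max ρ ‖y‖ := lt_max_of_lt_left hρ
  have h1 : retr ρ x - retr ρ y = (ρ / max ρ ‖x‖) • (x - y)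
      + (ρ / max ρ ‖x‖ - ρ / max ρ ‖y‖) • y := by
    simp only [retr, smul_sub, sub_smul]; abel
  have h2 : |max ρ ‖y‖ - max ρ ‖x‖| ≤ ‖x - y‖ := by
    refine (abs_max_sub_max_le_max _ _ _ _).trans ?_
    rw [sub_self, abs_zero, max_eq_right (abs_nonneg _), norm_sub_rev]
    exact abs_norm_sub_norm_le y x
  have h3 : ρ / max ρ ‖x‖ ≤ 1 := (div_le_one hx).2 (le_max_left _ _)
  have h4 : ρ / max ρ ‖x‖ - ρ / max ρ ‖y‖
      = ρ / max ρ ‖x‖ * ((max ρ ‖y‖ - max ρ ‖x‖) / max ρ ‖y‖) := by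
    field_simp
  have h5 : |(max ρ ‖y‖ - max ρ ‖x‖) / max ρ ‖y‖| * ‖y‖ ≤ ‖x - y‖ := by
    rw [abs_div, abs_of_pos hy, div_mul_eq_mul_div, div_le_iff₀ hy]
    exact mul_le_mul h2 (le_max_right _ _) (norm_nonneg _) (norm_nonneg _)
  rw [h1, two_mul]
  refine (norm_add_le _ _).trans (add_le_add ?_ ?_)
  · rw [norm_smul, Real.norm_of_nonneg (by positivity)]
    exact mul_le_of_le_one_left (norm_nonneg _) h3
  · rw [h4, norm_smul, norm_mul, Real.norm_of_nonneg (by positivity : 0 ≤ ρ / max ρ ‖x‖), mul_assoc]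
    exact (mul_le_of_le_one_left (by positivity) h3).trans h5

/-- A uniformly bounded, strongly continuous family of operators. -/
structure IsStrongFamily (T : ℝ → E →L[ℝ] E) (M : ℝ) : Prop where
  bound : ∀ t x, ‖T t x‖ ≤ M * ‖x‖
  cont : ∀ x, Continuous fun t => T t x

namespace IsStrongFamily

variable {T : ℝ → E →L[ℝ] E} {M : ℝ}

theorem continuous_comp (hT : IsStrongFamily T M) {X : Type*} [TopologicalSpace X] {a : X → ℝ}
    {b : X → E} (ha : Continuous a) (hb : Continuous b) : Continuous fun p => T (a p) (b p) := by
  rw [continuous_iff_continuousAt]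
  intro p
  have h1 : Tendsto (fun q => T (a q) (b q - b p) + T (a q) (b p)) (𝓝 p)
      (𝓝 (0 + T (a p) (b p))) := by
    refine Tendsto.add ?_ (((hT.cont (b p)).comp ha).tendsto p)
    have h2 : Tendsto (fun q => M * ‖b q - b p‖) (𝓝 p) (𝓝 (M * ‖b p - b p‖)) :=
      (by fun_prop : Continuous fun q => M * ‖b q - b p‖).tendsto p
    rw [sub_self, norm_zero, mul_zero] at h2
    exact squeeze_zero_norm (fun q => hT.bound _ _) h2
  rw [zero_add] at h1
  exact h1.congr fun q => by rw [map_sub]; abel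

theorem continuous_convolution (hT : IsStrongFamily T M) {g : ℝ → E}
    (hg : Continuous g) {X : Type*} [TopologicalSpace X] [FirstCountableTopology X]
    [LocallyCompactSpace X] {a : X → ℝ} (ha : Continuous a) :
    Continuous fun t => ∫ s in (0 : ℝ)..(a t), T (a t - s) (g s) :=
  intervalIntegral.continuous_parametric_intervalIntegral_of_continuous
    (f := fun t s => T (a t - s) (g s))
    (hT.continuous_comp (by fun_prop) (by fun_prop)) ha

theorem norm_convolution_le (hT : IsStrongFamily T M) (hM : 0 ≤ M) {g : ℝ → E}
    {C lam : ℝ} (hlam : 0 < lam) (hC : 0 ≤ C) (t : ℝ) (ht : 0 ≤ t)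
    (hb : ∀ s, 0 ≤ s → ‖g s‖ ≤ C * Real.exp (lam * s)) :
    ‖∫ s in (0 : ℝ)..t, T (t - s) (g s)‖ ≤ M * C / lam * Real.exp (lam * t) := by
  have hd : ∀ s ∈ uIcc 0 t, HasDerivAt (fun s => M * C / lam * Real.exp (lam * s))
      (M * (C * Real.exp (lam * s))) s := fun s _ => by
    have := (((hasDerivAt_id s).const_mul lam).exp).const_mul (M * C / lam)
    refine this.congr_deriv ?_
    simp only [id]
    field_simp
  have hi : ∫ s in (0 : ℝ)..t, M * (C * Real.exp (lam * s)) ≤ M * C / lam * Real.exp (lam * t) := by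
    rw [intervalIntegral.integral_eq_sub_of_hasDerivAt hd
      ((by fun_prop : Continuous fun s => M * (C * Real.exp (lam * s))).intervalIntegrable _ _)]
    have : 0 ≤ M * C / lam * Real.exp (lam * 0) := by positivity
    linarith
  refine le_trans ?_ hi
  refine intervalIntegral.norm_integral_le_of_norm_le ht (Eventually.of_forall fun s hs => ?_)
    ((by fun_prop : Continuous fun s => M * (C * Real.exp (lam * s))).intervalIntegrable _ _)
  exact (hT.bound _ _).trans (by gcongr; exact hb s hs.1.le)

/-- The Picard map is a contraction for a supremum norm with a decaying exponential weight. -/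
theorem exists_mild [CompleteSpace E] (hT : IsStrongFamily T M) {G : E → E} {K : ℝ}
    (hK : 0 ≤ K) (hG : ∀ x y, ‖G x - G y‖ ≤ K * ‖x - y‖) (u₀ : E) :
    ∃ u : ℝ → E, Continuous u ∧
      ∀ t, 0 ≤ t → u t = T t u₀ + ∫ s in (0 : ℝ)..t, T (t - s) (G (u s)) := by
  wlog hM : 0 ≤ M generalizing M
  · refine this (M := |M|) ⟨fun t x => (hT.bound t x).trans ?_, hT.cont⟩ (abs_nonneg _)
    gcongr
    exact le_abs_self M
  have hGc : Continuous G := by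
    refine (LipschitzWith.of_dist_le_mul (K := K.toNNReal) fun x y => ?_).continuous
    rw [dist_eq_norm, dist_eq_norm, Real.coe_toNNReal _ hK]
    exact hG x y
  -- with the weight `exp(-lam t)` the Lipschitz constant is `M K / lam ≤ 1 / 2`
  set lam : ℝ := 2 * (M * K) + 1 with hlam
  have hlam0 : 0 < lam := by positivity
  have hexp : ∀ t : ℝ, Real.exp (-(lam * t)) * Real.exp (lam * t) = 1 := fun t => by
    rw [← Real.exp_add]; simp
  let W : BoundedContinuousFunction ℝ E → ℝ → E := fun v s => G (Real.exp (lam * s) • v s)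
  have hWc : ∀ v, Continuous (W v) := fun v => hGc.comp (by fun_prop)
  have hWb : ∀ v s, 0 ≤ s → ‖W v s‖ ≤ (‖G 0‖ + K * ‖v‖) * Real.exp (lam * s) := by
    intro v s hs
    have h1 := hG (Real.exp (lam * s) • v s) 0
    rw [sub_zero, norm_smul, Real.norm_of_nonneg (Real.exp_pos _).le] at h1
    have h2 : ‖W v s‖ ≤ ‖W v s - G 0‖ + ‖G 0‖ := by
      simpa using norm_add_le (W v s - G 0) (G 0)
    have h3 : 1 ≤ Real.exp (lam * s) := Real.one_le_exp (by positivity)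
    have h4 : K * (Real.exp (lam * s) * ‖v s‖) ≤ K * (Real.exp (lam * s) * ‖v‖) := by
      gcongr; exact v.norm_coe_le_norm s
    have h5 : ‖G 0‖ * 1 ≤ ‖G 0‖ * Real.exp (lam * s) := by gcongr
    calc ‖W v s‖ ≤ K * (Real.exp (lam * s) * ‖v‖) + ‖G 0‖ * Real.exp (lam * s) := by
          linarith [h1.trans h4]
      _ = _ := by ring
  let Γ : BoundedContinuousFunction ℝ E → BoundedContinuousFunction ℝ E := fun v =>
    BoundedContinuousFunction.ofNormedAddCommGroup
      (fun t => Real.exp (-(lam * max t 0)) •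
        (T (max t 0) u₀ + ∫ s in (0 : ℝ)..(max t 0), T (max t 0 - s) (W v s)))
      (by
        refine Continuous.smul (by fun_prop) (Continuous.add ?_ ?_)
        · exact hT.continuous_comp (by fun_prop) continuous_const
        · exact hT.continuous_convolution (hWc v) (by fun_prop))
      (M * ‖u₀‖ + M * (‖G 0‖ + K * ‖v‖) / lam)
      (fun t => by
        have h0 : 0 ≤ max t 0 := le_max_right _ _
        have h1 := hT.norm_convolution_le hM hlam0 (by positivity) (max t 0) h0 (hWb v)
        have h2 := hT.bound (max t 0) u₀
        rw [norm_smul, Real.norm_of_nonneg (Real.exp_pos _).le]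
        have h3 : Real.exp (-(lam * max t 0)) ≤ 1 :=
          Real.exp_le_one_iff.2 (by have := mul_nonneg hlam0.le h0; linarith)
        calc _ ≤ Real.exp (-(lam * max t 0)) * (M * ‖u₀‖
              + M * (‖G 0‖ + K * ‖v‖) / lam * Real.exp (lam * max t 0)) := by
              gcongr
              exact (norm_add_le _ _).trans (add_le_add h2 h1)
          _ = Real.exp (-(lam * max t 0)) * (M * ‖u₀‖) + M * (‖G 0‖ + K * ‖v‖) / lam
              * (Real.exp (-(lam * max t 0)) * Real.exp (lam * max t 0)) := by ring
          _ ≤ _ := by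
              rw [hexp, mul_one]
              exact add_le_add (mul_le_of_le_one_left (by positivity) h3) le_rfl)
  have hΓt : ∀ v t, Γ v t = Real.exp (-(lam * max t 0)) •
      (T (max t 0) u₀ + ∫ s in (0 : ℝ)..(max t 0), T (max t 0 - s) (W v s)) := fun _ _ => rfl
  have hΓ : ContractingWith (1 / 2) Γ := by
    refine ⟨by rw [← NNReal.coe_lt_coe]; norm_num, LipschitzWith.of_dist_le_mul fun v w => ?_⟩
    refine (BoundedContinuousFunction.dist_le (by positivity)).2 fun t => ?_
    have h0 : 0 ≤ max t 0 := le_max_right _ _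
    have hi : ∀ v, IntervalIntegrable (fun s => T (max t 0 - s) (W v s)) volume 0 (max t 0) :=
      fun v => (hT.continuous_comp (by fun_prop) (hWc v)).intervalIntegrable _ _
    have h1 : ‖∫ s in (0 : ℝ)..(max t 0), T (max t 0 - s) (W v s - W w s)‖
        ≤ M * (K * ‖v - w‖) / lam * Real.exp (lam * max t 0) := by
      refine hT.norm_convolution_le hM hlam0 (by positivity) (max t 0) h0 fun s hs => ?_
      refine (hG _ _).trans ?_
      rw [← smul_sub, norm_smul, Real.norm_of_nonneg (Real.exp_pos _).le, mul_assoc,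
        mul_comm ‖v - w‖]
      gcongr
      exact (v - w).norm_coe_le_norm s
    simp only [map_sub] at h1
    rw [intervalIntegral.integral_sub (hi v) (hi w)] at h1
    have h2 : Γ v t - Γ w t = Real.exp (-(lam * max t 0)) •
        ((∫ s in (0 : ℝ)..(max t 0), T (max t 0 - s) (W v s))
          - ∫ s in (0 : ℝ)..(max t 0), T (max t 0 - s) (W w s)) := by
      rw [hΓt, hΓt, ← smul_sub, add_sub_add_left_eq_sub]
    rw [dist_eq_norm, h2, norm_smul, Real.norm_of_nonneg (Real.exp_pos _).le, dist_eq_norm]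
    calc _ ≤ Real.exp (-(lam * max t 0)) *
          (M * (K * ‖v - w‖) / lam * Real.exp (lam * max t 0)) := by gcongr
      _ = (M * K) / lam * ‖v - w‖ *
          (Real.exp (-(lam * max t 0)) * Real.exp (lam * max t 0)) := by ring
      _ ≤ _ := by
          rw [hexp, mul_one]
          gcongr
          rw [div_le_iff₀ hlam0, hlam]
          push_cast
          linarith
  obtain ⟨v, hv⟩ : ∃ v, Γ v = v := ⟨_, hΓ.fixedPoint_isFixedPt⟩
  refine ⟨fun t => Real.exp (lam * t) • v t, by fun_prop, fun t ht => ?_⟩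
  have h1 : v t = Real.exp (-(lam * max t 0)) •
        (T (max t 0) u₀ + ∫ s in (0 : ℝ)..(max t 0), T (max t 0 - s) (W v s)) :=
    (congrArg (fun w : BoundedContinuousFunction ℝ E => w t) hv).symm.trans (hΓt v t)
  rw [max_eq_left ht] at h1
  simp only [h1, smul_smul]
  rw [mul_comm, hexp, one_smul]

theorem exists_mild_retr [CompleteSpace E] (hT : IsStrongFamily T M) {G : E → E}
    (hG : LipBdd G) {ρ : ℝ} (hρ : 0 < ρ) (u₀ : E) :
    ∃ u : ℝ → E, Continuous u ∧
      ∀ t, 0 ≤ t → u t = T t u₀ + ∫ s in (0 : ℝ)..t, T (t - s) (G (retr ρ (u s))) := by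
  obtain ⟨K, hK, hGK⟩ := hG ρ
  refine hT.exists_mild (G := fun x => G (retr ρ x)) (K := K * 2) (by positivity)
    (fun x y => ?_) u₀
  refine (hGK _ _ (norm_retr_le hρ x) (norm_retr_le hρ y)).trans ?_
  rw [mul_assoc]
  gcongr
  exact norm_retr_sub_le hρ x y

theorem mild_unique [CompleteSpace E] (hT : IsStrongFamily T M) {G : E → E}
    (hG : LipBdd G) (hGc : Continuous G) {u₀ : E} {u v : ℝ → E} (huc : Continuous u)
    (hvc : Continuous v)
    (hu : ∀ t, 0 ≤ t → u t = T t u₀ + ∫ s in (0 : ℝ)..t, T (t - s) (G (u s)))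
    (hv : ∀ t, 0 ≤ t → v t = T t u₀ + ∫ s in (0 : ℝ)..t, T (t - s) (G (v s)))
    {t : ℝ} (ht : 0 ≤ t) : u t = v t := by
  wlog hM : 0 ≤ M generalizing M
  · refine this (M := |M|) ⟨fun t x => (hT.bound t x).trans ?_, hT.cont⟩ (abs_nonneg _)
    gcongr
    exact le_abs_self M
  obtain ⟨ρ₁, h1⟩ := isCompact_Icc.exists_bound_of_continuousOn (huc.continuousOn (s := Icc 0 t))
  obtain ⟨ρ₂, h2⟩ := isCompact_Icc.exists_bound_of_continuousOn (hvc.continuousOn (s := Icc 0 t))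
  obtain ⟨K, hK, hGK⟩ := hG (max ρ₁ ρ₂)
  have hdc : Continuous fun s => ‖u s - v s‖ := by fun_prop
  have hd : ∀ s ∈ Icc 0 t, ‖u s - v s‖ ≤ M * K * ∫ r in (0 : ℝ)..s, ‖u r - v r‖ := by
    intro s hs
    have hi : ∀ {w : ℝ → E}, Continuous w →
        IntervalIntegrable (fun r => T (s - r) (G (w r))) volume 0 s := fun hw =>
      (hT.continuous_comp (by fun_prop) (hGc.comp hw)).intervalIntegrable _ _
    rw [hu s hs.1, hv s hs.1, add_sub_add_left_eq_sub, ← intervalIntegral.integral_sub (hi huc)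
      (hi hvc), ← intervalIntegral.integral_const_mul]
    refine intervalIntegral.norm_integral_le_of_norm_le hs.1 (Eventually.of_forall fun r hr => ?_)
      ((hdc.const_mul _).intervalIntegrable _ _)
    have hr' : r ∈ Icc 0 t := ⟨hr.1.le, hr.2.trans hs.2⟩
    rw [← map_sub, mul_assoc]
    exact (hT.bound _ _).trans (by
      gcongr
      exact hGK _ _ ((h1 r hr').trans (le_max_left _ _)) ((h2 r hr').trans (le_max_right _ _)))
  have hy := le_gronwallBound_of_liminf_deriv_right_le
    (f := fun s => ∫ r in (0 : ℝ)..s, ‖u r - v r‖) (f' := fun s => ‖u s - v s‖) (δ := 0)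
    (K := M * K) (ε := 0) (a := 0) (b := t)
    (continuous_iff_continuousAt.2 fun s =>
      (hdc.integral_hasStrictDerivAt 0 s).hasDerivAt.continuousAt).continuousOn
    (fun s _ r hr => (hdc.integral_hasStrictDerivAt 0 s).hasDerivAt.hasDerivWithinAt
      |>.liminf_right_slope_le hr) (by simp) (fun s hs => by
        rw [add_zero]; exact hd s ⟨hs.1, hs.2.le⟩) t (right_mem_Icc.2 ht)
  rw [gronwallBound_ε0, zero_mul] at hy
  have h3 := hd t (right_mem_Icc.2 ht)
  have h4 : ‖u t - v t‖ ≤ 0 := h3.trans (mul_nonpos_of_nonneg_of_nonpos (by positivity) hy)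
  exact sub_eq_zero.1 (norm_le_zero_iff.1 h4)

end IsStrongFamily

theorem tendsto_average_prod [CompleteSpace E] {F : ℝ → ℝ → E}
    (hF : Continuous (Function.uncurry F)) :
    Tendsto (fun h : ℝ => h⁻¹ • ∫ r in (0 : ℝ)..h, F h r) (𝓝[>] 0) (𝓝 (F 0 0)) := by
  rw [Metric.tendsto_nhds]
  intro η hη
  obtain ⟨δ, hδ, hFδ⟩ := Metric.continuousAt_iff.1 (hF.continuousAt (x := ((0 : ℝ), (0 : ℝ))))
    (η / 2) (by positivity)
  filter_upwards [Ioo_mem_nhdsGT hδ] with h hh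
  have hc : ∫ r in (0 : ℝ)..h, F 0 0 = h • F 0 0 := by simp
  have h1 : h⁻¹ • (∫ r in (0 : ℝ)..h, F h r) - F 0 0 = h⁻¹ • ∫ r in (0 : ℝ)..h, (F h r - F 0 0) := by
    rw [intervalIntegral.integral_sub _ (by simp), hc, smul_sub, smul_smul,
      inv_mul_cancel₀ hh.1.ne', one_smul]
    exact (hF.comp (by fun_prop : Continuous fun r : ℝ => (h, r))).intervalIntegrable _ _
  have h2 : ‖∫ r in (0 : ℝ)..h, (F h r - F 0 0)‖ ≤ η / 2 * |h - 0| := by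
    refine intervalIntegral.norm_integral_le_of_norm_le_const fun r hr => ?_
    rw [uIoc_of_le hh.1.le] at hr
    have := @hFδ (h, r) (by
      rw [Prod.dist_eq, max_lt_iff, Real.dist_eq, Real.dist_eq]
      simp only [sub_zero, abs_of_pos hh.1, abs_of_pos hr.1]
      exact ⟨hh.2, hr.2.trans_lt hh.2⟩)
    rw [dist_eq_norm] at this
    exact this.le
  rw [dist_eq_norm, h1, norm_smul, norm_inv, Real.norm_of_nonneg hh.1.le]
  rw [sub_zero, abs_of_pos hh.1] at h2
  calc _ ≤ h⁻¹ * (η / 2 * h) := by have := hh.1; gcongr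
    _ = η / 2 := by have := hh.1.ne'; field_simp
    _ < η := by linarith

end Mild

/-! ### Growth of the weighted norm along mild solutions -/

section Energy

variable {H : Type*} [NormedAddCommGroup H] [InnerProductSpace ℝ H]
  {Q R : H →L[ℝ] H} {c om M : ℝ} {T : ℝ → H →L[ℝ] H}

theorem IsSemigroupOf.isStrongFamily (hT : IsSemigroupOf R M T) : IsStrongFamily T M :=
  ⟨hT.bound, hT.cont⟩

/-- A mild solution satisfies `z(t+h) = T(h) z(t) + h g(t) + o(h)`. -/
theorem IsSemigroupOf.tendsto_mild_quotient [CompleteSpace H] (hT : IsSemigroupOf R M T)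
    {g z : ℝ → H} (hg : Continuous g) {z₀ : H}
    (hz : ∀ t, 0 ≤ t → z t = T t z₀ + ∫ s in (0 : ℝ)..t, T (t - s) (g s)) {t : ℝ} (ht : 0 ≤ t) :
    Tendsto (fun h : ℝ => h⁻¹ • (z (t + h) - T h (z t))) (𝓝[>] 0) (𝓝 (g t)) := by
  have h1 := tendsto_average_prod (F := fun h r => T (h - r) (g (t + r)))
    (hT.isStrongFamily.continuous_comp (by fun_prop) (by fun_prop))
  simp only [sub_zero, hT.zero, add_zero] at h1
  refine h1.congr' ?_
  filter_upwards [self_mem_nhdsWithin] with h hh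
  have hh' : 0 < h := hh
  congr 1
  have hi : ∀ a b r : ℝ, IntervalIntegrable (fun s => T (r - s) (g s)) volume a b := fun a b r =>
    (hT.isStrongFamily.continuous_comp (by fun_prop) hg).intervalIntegrable _ _
  have h2 : T h (∫ s in (0 : ℝ)..t, T (t - s) (g s)) = ∫ s in (0 : ℝ)..t, T (t + h - s) (g s) := by
    rw [← ContinuousLinearMap.intervalIntegral_comp_comm _ (hi 0 t t)]
    refine intervalIntegral.integral_congr fun s hs => ?_
    rw [uIcc_of_le ht] at hs
    have := hT.add h (t - s) hh'.le (by linarith [hs.2]) (g s)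
    simp only [← this]
    congr 2
    ring
  have h3 : ∫ r in (0 : ℝ)..h, T (h - r) (g (t + r)) = ∫ s in t..(t + h), T (t + h - s) (g s) := by
    have := intervalIntegral.integral_comp_add_left (a := 0) (b := h)
      (fun s => T (t + h - s) (g s)) t
    rw [add_zero] at this
    rw [← this]
    refine intervalIntegral.integral_congr fun s _ => ?_
    simp only [add_sub_add_left_eq_sub]
  rw [h3, hz (t + h) (by linarith), hz t ht, map_add, h2, add_comm t h,
    hT.add h t hh'.le ht, ← intervalIntegral.integral_add_adjacent_intervals (hi 0 t _) (hi t _ _)]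
  abel

/-- Upper bound for the forward difference quotients of the weighted norm along a trajectory that
moves from `x` to `y s = T(s) x + s k(s) - e(s)` in time `s`, where the source `k` converges and the
perturbation `e` is only known to be Lipschitz. -/
theorem DissipativeInverse.exists_dini_bound [CompleteSpace H] (h : DissipativeInverse Q R c om)
    (hT : IsSemigroupOf R M T) {κ : ℝ} (hκ : κ * ‖Q‖ ≤ 2 * om) (hκ0 : 0 ≤ κ) {x k₀ : H}
    {y k e : ℝ → H} {b : ℝ → ℝ} {b₀ : ℝ} (hy : ∀ᶠ s in 𝓝[>] 0, y s = T s x + s • k s - e s)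
    (hk : Tendsto k (𝓝[>] 0) (𝓝 k₀)) (he : ∀ᶠ s in 𝓝[>] 0, ‖e s‖ ≤ s * b s)
    (hb : Tendsto b (𝓝[>] 0) (𝓝 b₀)) :
    ∃ U : ℝ → ℝ,
      Tendsto U (𝓝[>] 0) (𝓝 (-κ * inner ℝ x (Q x) + 2 * inner ℝ x (Q k₀) + 2 * (‖x‖ * ‖Q‖ * b₀))) ∧
      ∀ᶠ s in 𝓝[>] 0, s⁻¹ * (inner ℝ (y s) (Q (y s)) - inner ℝ x (Q x)) ≤ U s := by
  have hTx : Tendsto (fun s => T s x) (𝓝[>] 0) (𝓝 x) := by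
    have := (hT.cont x).tendsto 0
    rw [hT.zero] at this
    exact this.mono_left nhdsWithin_le_nhds
  refine ⟨fun s => s⁻¹ * (Real.exp (-κ * s) - 1) * inner ℝ x (Q x) + 2 * inner ℝ (T s x) (Q (k s))
    + 2 * (‖T s x‖ * ‖Q‖ * b s) + s * (‖Q‖ * (‖k s‖ + b s) ^ 2), ?_, ?_⟩
  · have h1 : Tendsto (fun s : ℝ => s⁻¹ * (Real.exp (-κ * s) - 1)) (𝓝[>] 0) (𝓝 (-κ)) := by
      have hd : HasDerivAt (fun s : ℝ => Real.exp (-κ * s)) (-κ) 0 := by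
        simpa using ((hasDerivAt_id (0 : ℝ)).const_mul (-κ)).exp
      simpa using hd.tendsto_slope_zero_right
    have h2 : Tendsto (fun s => inner ℝ (T s x) (Q (k s))) (𝓝[>] 0) (𝓝 (inner ℝ x (Q k₀))) :=
      hTx.inner ((Q.continuous.tendsto _).comp hk)
    have h3 : Tendsto (fun s => s * (‖Q‖ * (‖k s‖ + b s) ^ 2)) (𝓝[>] 0)
        (𝓝 (0 * (‖Q‖ * (‖k₀‖ + b₀) ^ 2))) :=
      (tendsto_id.mono_left nhdsWithin_le_nhds).mul (((hk.norm.add hb).pow 2).const_mul _)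
    rw [zero_mul] at h3
    simpa using (((h1.mul_const (inner ℝ x (Q x))).add (h2.const_mul 2)).add
      (((hTx.norm.mul_const ‖Q‖).mul hb).const_mul 2)).add h3
  · filter_upwards [hy, he, self_mem_nhdsWithin] with s hys hes hs
    have hs' : 0 < s := hs
    have hV := h.weight_semigroup_le hT hκ hκ0 hs'.le x
    have hw : ‖s • k s - e s‖ ≤ s * (‖k s‖ + b s) := by
      refine (norm_sub_le _ _).trans ?_
      rw [norm_smul, Real.norm_of_nonneg hs'.le]
      linarith
    have h1 : inner ℝ (s • k s - e s) (Q (s • k s - e s)) ≤ ‖Q‖ * (s * (‖k s‖ + b s)) ^ 2 :=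
      (weight_le Q _).trans (by gcongr)
    have h2 : -inner ℝ (T s x) (Q (e s)) ≤ ‖T s x‖ * ‖Q‖ * (s * b s) := by
      refine (neg_le_abs _).trans ((abs_real_inner_le_norm _ _).trans ?_)
      rw [mul_assoc]
      gcongr
      exact (Q.le_opNorm _).trans (by gcongr)
    rw [hys, add_sub_assoc, h.weight_add, map_sub, inner_sub_right, map_smul, inner_smul_right,
      inv_mul_le_iff₀ hs']
    rw [map_sub, map_smul] at h1
    have h3 : s * (s⁻¹ * (Real.exp (-κ * s) - 1) * inner ℝ x (Q x)
        + 2 * inner ℝ (T s x) (Q (k s)) + 2 * (‖T s x‖ * ‖Q‖ * b s)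
        + s * (‖Q‖ * (‖k s‖ + b s) ^ 2))
        = (Real.exp (-κ * s) - 1) * inner ℝ x (Q x) + 2 * (s * inner ℝ (T s x) (Q (k s)))
          + 2 * (‖T s x‖ * ‖Q‖ * (s * b s)) + ‖Q‖ * (s * (‖k s‖ + b s)) ^ 2 := by
      field_simp
    rw [h3]
    linarith

end Energy
end SingleTrack

namespace SingleTrack

/-! ### Operators on `L²((0,1); ℝ²)` -/

instance : IsProbabilityMeasure mu01 := ⟨by simp⟩

theorem act_mul (A B : M2) (x : E2) : act (A * B) x = act A (act B x) := by
  simp [act, map_mul]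

theorem continuous_act : Continuous act :=
  (Matrix.toEuclideanCLM (n := Fin 2) (𝕜 := ℝ)).toAlgEquiv.toLinearMap.continuous_of_finiteDimensional

theorem L2.integrable (f : L2) : Integrable f mu01 := (Lp.memLp f).integrable one_le_two

theorem L2.integral_norm_le (f : L2) : ∫ ξ, ‖f ξ‖ ∂mu01 ≤ ‖f‖ := by
  have h := Lp.memLp f
  rw [integral_norm_eq_lintegral_enorm h.1, ← eLpNorm_one_eq_lintegral_enorm, Lp.norm_def]
  exact ENNReal.toReal_mono h.2.ne (eLpNorm_le_eLpNorm_of_exponent_le one_le_two h.1)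

theorem L2.norm_sq_eq (f : L2) : ‖f‖ ^ 2 = ∫ ξ, ‖f ξ‖ ^ 2 ∂mu01 := by
  rw [← real_inner_self_eq_norm_sq, MeasureTheory.L2.inner_def]
  simp

theorem memLp_of_continuousOn {F : Type*} [NormedAddCommGroup F] {f : ℝ → F}
    (hf : ContinuousOn f (Icc 0 1)) : MemLp f 2 mu01 := by
  obtain ⟨C, hC⟩ := isCompact_Icc.exists_bound_of_continuousOn hf
  refine MemLp.of_bound ((hf.mono Ioo_subset_Icc_self).aestronglyMeasurable measurableSet_Ioo) C ?_
  exact (ae_restrict_mem measurableSet_Ioo).mono fun ξ hξ => hC ξ (Ioo_subset_Icc_self hξ)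

theorem memLp_clm_apply {k : ℝ → E2 →L[ℝ] E2} (hk : ContinuousOn k (Icc 0 1)) {f : ℝ → E2}
    (hf : MemLp f 2 mu01) : MemLp (fun ξ => k ξ (f ξ)) 2 mu01 := by
  obtain ⟨C, hC⟩ := isCompact_Icc.exists_bound_of_continuousOn hk
  have hkm : AEStronglyMeasurable k mu01 :=
    (hk.mono Ioo_subset_Icc_self).aestronglyMeasurable measurableSet_Ioo
  refine MemLp.of_le_mul (c := C) hf
    ((ContinuousLinearMap.id ℝ (E2 →L[ℝ] E2)).aestronglyMeasurable_comp₂ hkm hf.1) ?_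
  refine (ae_restrict_mem measurableSet_Ioo).mono fun ξ hξ => ?_
  exact (k ξ).le_of_opNorm_le (hC ξ (Ioo_subset_Icc_self hξ)) _

theorem exists_mulOp {k : ℝ → E2 →L[ℝ] E2} (hk : ContinuousOn k (Icc 0 1)) :
    ∃ L : L2 →L[ℝ] L2, ∀ f : L2, L f =ᵐ[mu01] fun ξ => k ξ (f ξ) := by
  obtain ⟨C, hC⟩ := isCompact_Icc.exists_bound_of_continuousOn hk
  have hm := fun f : L2 => memLp_clm_apply hk (Lp.memLp f)
  refine ⟨LinearMap.mkContinuous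
    { toFun := fun f => (hm f).toLp _
      map_add' := fun f g => ?_
      map_smul' := fun a f => ?_ } C fun f => ?_, fun f => (hm f).coeFn_toLp⟩
  · rw [← MemLp.toLp_add]
    refine MemLp.toLp_congr _ _ ?_
    filter_upwards [Lp.coeFn_add f g] with ξ h
    change k ξ ((f + g : L2) ξ) = k ξ (f ξ) + k ξ (g ξ)
    rw [h, Pi.add_apply, map_add]
  · rw [RingHom.id_apply, ← MemLp.toLp_const_smul]
    refine MemLp.toLp_congr _ _ ?_
    filter_upwards [Lp.coeFn_smul a f] with ξ h
    change k ξ ((a • f : L2) ξ) = a • k ξ (f ξ)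
    rw [h, Pi.smul_apply, map_smul]
  · refine Lp.norm_le_mul_norm_of_ae_le_mul ?_
    filter_upwards [(hm f).coeFn_toLp, ae_restrict_mem measurableSet_Ioo] with ξ h hξ
    simp only [LinearMap.coe_mk, AddHom.coe_mk, h]
    exact (k ξ).le_of_opNorm_le (hC ξ (Ioo_subset_Icc_self hξ)) _

/-- Multiplication by a continuous operator-valued function, on `L²`. -/
noncomputable def mulOp {k : ℝ → E2 →L[ℝ] E2} (hk : ContinuousOn k (Icc 0 1)) : L2 →L[ℝ] L2 :=
  (exists_mulOp hk).choose

theorem coeFn_mulOp {k : ℝ → E2 →L[ℝ] E2} (hk : ContinuousOn k (Icc 0 1)) (f : L2) :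
    mulOp hk f =ᵐ[mu01] fun ξ => k ξ (f ξ) :=
  (exists_mulOp hk).choose_spec f

/-- Integration over `(0,1)` as an operator on `L²`. -/
noncomputable def intCLM : L2 →L[ℝ] E2 :=
  LinearMap.mkContinuous
    { toFun := fun f => ∫ ξ, f ξ ∂mu01
      map_add' := fun f g => by
        rw [← integral_add f.integrable g.integrable]
        exact integral_congr_ae (Lp.coeFn_add f g)
      map_smul' := fun a f => by
        rw [RingHom.id_apply, ← integral_smul]
        exact integral_congr_ae (Lp.coeFn_smul a f) } 1
    fun f => by
      rw [one_mul]
      exact (norm_integral_le_integral_norm _).trans f.integral_norm_le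

theorem intCLM_apply (f : L2) : intCLM f = ∫ ξ, f ξ ∂mu01 := rfl

theorem continuousOn_act {K : ℝ → M2} (hK : ContinuousOn K (Icc 0 1)) :
    ContinuousOn (fun ξ => act (K ξ)) (Icc 0 1) :=
  continuous_act.comp_continuousOn hK

/-- The functional `f ↦ ∫₀¹ K(ξ) f(ξ) dξ` on `L²`. -/
noncomputable def kernelCLM {K : ℝ → M2} (hK : ContinuousOn K (Icc 0 1)) : L2 →L[ℝ] E2 :=
  intCLM.comp (mulOp (continuousOn_act hK))

theorem kernelCLM_apply {K : ℝ → M2} (hK : ContinuousOn K (Icc 0 1)) (f : L2) :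
    kernelCLM hK f = kernelInt K f :=
  integral_congr_ae (coeFn_mulOp (continuousOn_act hK) f)

theorem kernelInt_congr {K : ℝ → M2} {u v : ℝ → E2} (h : u =ᵐ[mu01] v) :
    kernelInt K u = kernelInt K v :=
  integral_congr_ae (h.mono fun ξ hξ => by simp only [hξ])

/-! ### Primitives -/

/-- The primitive of `g` that vanishes at `0`. -/
noncomputable def prim (g : ℝ → E2) (ξ : ℝ) : E2 := ∫ s in (0 : ℝ)..ξ, g s

theorem prim_eq_integral_indicator (g : ℝ → E2) {ξ : ℝ} (hξ : ξ ∈ Icc (0 : ℝ) 1) :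
    prim g ξ = ∫ s, (Iio ξ).indicator g s ∂mu01 := by
  rw [prim, intervalIntegral.integral_of_le hξ.1, integral_Ioc_eq_integral_Ioo,
    setIntegral_indicator measurableSet_Iio]
  congr 2
  ext s
  simp only [mem_Ioo, mem_inter_iff, mem_Iio]
  constructor
  · rintro ⟨h1, h2⟩; exact ⟨⟨h1, h2.trans_le hξ.2⟩, h2⟩
  · rintro ⟨⟨h1, _⟩, h2⟩; exact ⟨h1, h2⟩

theorem prim_congr {g g' : ℝ → E2} (h : g =ᵐ[mu01] g') {ξ : ℝ} (hξ : ξ ∈ Icc (0 : ℝ) 1) :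
    prim g ξ = prim g' ξ := by
  rw [prim_eq_integral_indicator g hξ, prim_eq_integral_indicator g' hξ]
  refine integral_congr_ae (h.mono fun s hs => ?_)
  by_cases h : s ∈ Iio ξ <;> simp [h, hs]

theorem norm_prim_le {g : ℝ → E2} (hg : Integrable g mu01) {ξ : ℝ} (hξ : ξ ∈ Icc (0 : ℝ) 1) :
    ‖prim g ξ‖ ≤ ∫ s, ‖g s‖ ∂mu01 := by
  rw [prim_eq_integral_indicator g hξ]
  refine (norm_integral_le_integral_norm _).trans (integral_mono
    (hg.indicator measurableSet_Iio).norm hg.norm fun s => ?_)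
  exact norm_indicator_le_norm_self g s

theorem continuousOn_prim {g : ℝ → E2} (hg : Integrable g mu01) :
    ContinuousOn (prim g) (Icc 0 1) := by
  have h1 : IntegrableOn g (Icc 0 1) volume :=
    (integrableOn_Icc_iff_integrableOn_Ioo (by simp) (by simp)).2 hg
  have := intervalIntegral.continuousOn_primitive_interval (μ := volume) (f := g) (a := 0) (b := 1)
    (by rwa [uIcc_of_le zero_le_one])
  rwa [uIcc_of_le zero_le_one] at this

theorem prim_one (g : ℝ → E2) : prim g 1 = ∫ s, g s ∂mu01 := by
  rw [prim, intervalIntegral.integral_of_le zero_le_one, integral_Ioc_eq_integral_Ioo]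

/-- Fubini's theorem on the triangle `s < ξ`. -/
theorem isH1_prim {g : ℝ → E2} (hg : MemLp g 2 mu01) : IsH1 (prim g) g := by
  have hgi := hg.integrable one_le_two
  refine ⟨continuousOn_prim hgi, hg, fun ϕ hϕ _ hs => ?_⟩
  have hdc : Continuous (deriv ϕ) := hϕ.continuous_deriv (by simp)
  have hdi : Integrable (deriv ϕ) mu01 :=
    (hdc.integrableOn_Icc (a := 0) (b := 1)).mono_set Ioo_subset_Icc_self
  have hprod : Integrable (fun p : ℝ × ℝ => {p : ℝ × ℝ | p.2 < p.1}.indicator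
      (fun p => deriv ϕ p.1 • g p.2) p) (mu01.prod mu01) :=
    (hdi.smul_prod hgi).indicator (measurableSet_lt measurable_snd measurable_fst)
  have hswap := integral_integral_swap (f := fun ξ s => {p : ℝ × ℝ | p.2 < p.1}.indicator
      (fun p => deriv ϕ p.1 • g p.2) (ξ, s)) hprod
  have h1 : ∀ ξ ∈ Ioo (0 : ℝ) 1, (∫ s, {p : ℝ × ℝ | p.2 < p.1}.indicator
      (fun p => deriv ϕ p.1 • g p.2) (ξ, s) ∂mu01) = deriv ϕ ξ • prim g ξ := by
    intro ξ hξ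
    rw [prim_eq_integral_indicator g (Ioo_subset_Icc_self hξ), ← integral_smul]
    congr 1
    ext1 s
    by_cases h : s < ξ <;> simp [indicator, h]
  have h2 : ∀ s ∈ Ioo (0 : ℝ) 1, (∫ ξ, {p : ℝ × ℝ | p.2 < p.1}.indicator
      (fun p => deriv ϕ p.1 • g p.2) (ξ, s) ∂mu01) = -(ϕ s • g s) := by
    intro s hs'
    have h3 : (fun ξ => {p : ℝ × ℝ | p.2 < p.1}.indicator (fun p => deriv ϕ p.1 • g p.2) (ξ, s))
        = fun ξ => (Ioi s).indicator (deriv ϕ) ξ • g s := by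
      ext1 ξ
      by_cases h : s < ξ <;> simp [indicator, h]
    have h4 : Ioo (0 : ℝ) 1 ∩ Ioi s = Ioo s 1 := by
      ext ξ
      simp only [mem_Ioo, mem_inter_iff, mem_Ioi]
      constructor
      · rintro ⟨⟨_, h1⟩, h2⟩; exact ⟨h2, h1⟩
      · rintro ⟨h1, h2⟩; exact ⟨⟨hs'.1.trans h1, h2⟩, h1⟩
    have h5 : ϕ 1 = 0 := by
      by_contra hne
      exact absurd (hs (subset_tsupport ϕ hne)).2 (lt_irrefl _)
    rw [h3, integral_smul_const, setIntegral_indicator measurableSet_Ioi, h4,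
      ← integral_Ioc_eq_integral_Ioo, ← intervalIntegral.integral_of_le hs'.2.le,
      intervalIntegral.integral_deriv_eq_sub (fun x _ => (hϕ.differentiable (by simp)) x)
        (hdc.intervalIntegrable _ _), h5, zero_sub, neg_smul]
  have hae : ∀ᵐ ξ ∂mu01, ξ ∈ Ioo (0 : ℝ) 1 := ae_restrict_mem measurableSet_Ioo
  rw [integral_congr_ae (hae.mono h1), integral_congr_ae (hae.mono h2), integral_neg] at hswap
  exact hswap

theorem memLp_prim {g : ℝ → E2} (hg : Integrable g mu01) : MemLp (prim g) 2 mu01 :=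
  memLp_of_continuousOn (continuousOn_prim hg)

theorem prim_add {g g' : ℝ → E2} (hg : Integrable g mu01) (hg' : Integrable g' mu01) {ξ : ℝ}
    (hξ : ξ ∈ Icc (0 : ℝ) 1) : prim (g + g') ξ = prim g ξ + prim g' ξ := by
  simp only [prim_eq_integral_indicator _ hξ]
  rw [← integral_add (hg.indicator measurableSet_Iio) (hg'.indicator measurableSet_Iio)]
  simp only [indicator_add', Pi.add_apply]

theorem prim_smul (a : ℝ) (g : ℝ → E2) (ξ : ℝ) : prim (a • g) ξ = a • prim g ξ := by
  simp only [prim, Pi.smul_apply, intervalIntegral.integral_smul]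

/-- Integration from `0` as an operator on `L²`. -/
noncomputable def primCLM : L2 →L[ℝ] L2 :=
  LinearMap.mkContinuous
    { toFun := fun g => (memLp_prim g.integrable).toLp _
      map_add' := fun f g => by
        rw [← MemLp.toLp_add]
        refine MemLp.toLp_congr _ _ ((ae_restrict_mem measurableSet_Ioo).mono fun ξ hξ => ?_)
        have hξ' := Ioo_subset_Icc_self hξ
        rw [prim_congr (Lp.coeFn_add f g) hξ', prim_add f.integrable g.integrable hξ']
        rfl
      map_smul' := fun a f => by
        rw [RingHom.id_apply, ← MemLp.toLp_const_smul]
        refine MemLp.toLp_congr _ _ ((ae_restrict_mem measurableSet_Ioo).mono fun ξ hξ => ?_)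
        rw [prim_congr (Lp.coeFn_smul a f) (Ioo_subset_Icc_self hξ), prim_smul]
        rfl } 1
    fun g => by
      have h := Lp.norm_le_of_ae_bound (f := (memLp_prim g.integrable).toLp _) (norm_nonneg g) (by
        filter_upwards [(memLp_prim g.integrable).coeFn_toLp, ae_restrict_mem measurableSet_Ioo]
          with ξ h hξ
        rw [h]
        exact (norm_prim_le g.integrable (Ioo_subset_Icc_self hξ)).trans g.integral_norm_le)
      have h1 : measureUnivNNReal mu01 = 1 := by
        rw [← ENNReal.coe_inj, coe_measureUnivNNReal, measure_univ, ENNReal.coe_one]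
      simpa [h1] using h

theorem coeFn_primCLM (g : L2) : primCLM g =ᵐ[mu01] prim g :=
  (memLp_prim g.integrable).coeFn_toLp

theorem primCLM_injective {g : L2} (h : primCLM g = 0) : g = 0 := by
  have h0 : prim g =ᵐ[mu01] 0 := by
    refine (coeFn_primCLM g).symm.trans ?_
    rw [h]
    exact Lp.coeFn_zero _ _ _
  have h1 := IsOpen.ae_eq_zero_of_integral_contDiff_smul_eq_zero (U := Ioo (0 : ℝ) 1) (μ := volume)
    (f := g) isOpen_Ioo (IntegrableOn.locallyIntegrableOn g.integrable) (fun ϕ hϕ hc hs => by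
      have h2 := (isH1_prim (Lp.memLp g)).weak_deriv ϕ hϕ hc hs
      rw [integral_congr_ae (g := fun _ => (0 : E2)) (h0.mono fun ξ hξ => by simp [hξ]),
        integral_zero, eq_comm, neg_eq_zero] at h2
      rw [← h2]
      refine (setIntegral_eq_integral_of_forall_compl_eq_zero fun x hx => ?_).symm
      have : ϕ x = 0 := by
        by_contra hne
        exact hx (hs (subset_tsupport ϕ hne))
      rw [this, zero_smul])
  have h3 : g =ᵐ[mu01] (0 : ℝ → E2) := (ae_restrict_iff' measurableSet_Ioo).2 h1
  exact Lp.ext (h3.trans (Lp.coeFn_zero _ _ _).symm)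

end SingleTrack

namespace SingleTrack

/-! ### The inverse of the transport operator -/

theorem isUnit_det_lam (S : System) : IsUnit S.Lam.det :=
  (Matrix.isUnit_iff_isUnit_det _).1 S.Lam_posDef.isUnit

theorem act_one (x : E2) : act 1 x = x := by simp [act]

theorem act_lam_inv (S : System) (x : E2) : act S.Lam (act S.Lam⁻¹ x) = x := by
  rw [← act_mul, Matrix.mul_nonsing_inv _ (isUnit_det_lam S), act_one]

/-- A matrix acting pointwise on `L²`. -/
noncomputable def pointwise (A : M2) : L2 →L[ℝ] L2 := (act A).compLpL 2 mu01

theorem coeFn_pointwise (A : M2) (f : L2) : pointwise A f =ᵐ[mu01] fun ξ => act A (f ξ) :=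
  ContinuousLinearMap.coeFn_compLpL _ _

/-- Constant functions in `L²`. -/
noncomputable def constCLM : E2 →L[ℝ] L2 := Lp.constL 2 mu01 ℝ

theorem coeFn_constCLM (c : E2) : constCLM c =ᵐ[mu01] fun _ => c :=
  Lp.coeFn_const _ _ _

theorem pointwise_lam_inv (S : System) (f : L2) : pointwise S.Lam (pointwise S.Lam⁻¹ f) = f := by
  refine Lp.ext ?_
  filter_upwards [coeFn_pointwise S.Lam (pointwise S.Lam⁻¹ f), coeFn_pointwise S.Lam⁻¹ f]
    with ξ h1 h2
  rw [h1, h2, act_lam_inv]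

theorem IsH1.sub {u g u' g' : ℝ → E2} (h : IsH1 u g) (h' : IsH1 u' g') :
    IsH1 (u - u') (g - g') := by
  refine ⟨h.continuousOn.sub h'.continuousOn, h.memLp.sub h'.memLp, fun ϕ hϕ hc hs => ?_⟩
  have hm : ∀ {f : ℝ → ℝ} {v : ℝ → E2}, Continuous f → MemLp v 2 mu01 →
      Integrable (fun ξ => f ξ • v ξ) mu01 := fun {f v} hf hv => by
    obtain ⟨C, hC⟩ := isCompact_Icc.exists_bound_of_continuousOn (hf.continuousOn (s := Icc 0 1))
    refine (hv.integrable one_le_two).bdd_smul C hf.aestronglyMeasurable ?_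
    exact (ae_restrict_mem measurableSet_Ioo).mono fun ξ hξ => hC ξ (Ioo_subset_Icc_self hξ)
  have hd : Continuous (deriv ϕ) := hϕ.continuous_deriv (by simp)
  simp only [Pi.sub_apply, smul_sub]
  rw [integral_sub (hm hd (memLp_of_continuousOn h.continuousOn))
    (hm hd (memLp_of_continuousOn h'.continuousOn)),
    integral_sub (hm hϕ.continuous h.memLp) (hm hϕ.continuous h'.memLp), h.weak_deriv ϕ hϕ hc hs,
    h'.weak_deriv ϕ hϕ hc hs]
  abel

namespace System

variable (S : System)

theorem kernelInt_sub {K : ℝ → M2} (hK : ContinuousOn K (Icc 0 1)) {u v : ℝ → E2}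
    (hu : MemLp u 2 mu01) (hv : MemLp v 2 mu01) :
    kernelInt K (u - v) = kernelInt K u - kernelInt K v := by
  have hi := fun {w : ℝ → E2} (hw : MemLp w 2 mu01) =>
    (memLp_clm_apply (continuousOn_act hK) hw).integrable one_le_two
  rw [kernelInt, kernelInt, kernelInt, ← integral_sub (hi hu) (hi hv)]
  simp only [Pi.sub_apply, map_sub]

theorem calK₄_sub {u v : ℝ → E2} (hu : MemLp u 2 mu01) (hv : MemLp v 2 mu01) :
    S.calK₄ (u - v) = S.calK₄ u - S.calK₄ v := by
  simp only [calK₄, kernelInt_sub S.K₄_cont hu hv, Pi.sub_apply, map_sub]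
  abel

theorem GraphA.sub {S : System} {x y x' y' : L2} (h : S.GraphA x y) (h' : S.GraphA x' y') :
    S.GraphA (x - x') (y - y') := by
  obtain ⟨u, g, hH, h0, hx, hy⟩ := h
  obtain ⟨u', g', hH', h0', hx', hy'⟩ := h'
  refine ⟨u - u', g - g', hH.sub hH', by simp [h0, h0'], ?_, ?_⟩
  · filter_upwards [Lp.coeFn_sub x x', hx, hx'] with ξ h1 h2 h3
    rw [h1, Pi.sub_apply, Pi.sub_apply, h2, h3]
  · rw [S.calK₄_sub (memLp_of_continuousOn hH.continuousOn) (memLp_of_continuousOn hH'.continuousOn)]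
    filter_upwards [Lp.coeFn_sub y y', hy, hy'] with ξ h1 h2 h3
    rw [h1, Pi.sub_apply, Pi.sub_apply, h2, h3, map_sub]
    abel

/-- The operator of multiplication by the weight. -/
noncomputable def weightOp {Q : ℝ → M2} (hA : S.StrictlyDissipative Q) : L2 →L[ℝ] L2 :=
  mulOp (continuousOn_act hA.1)

theorem coeFn_weightOp {Q : ℝ → M2} (hA : S.StrictlyDissipative Q) (f : L2) :
    S.weightOp hA f =ᵐ[mu01] fun ξ => act (Q ξ) (f ξ) :=
  coeFn_mulOp _ f

theorem exists_graph_dissipative {Q : ℝ → M2} (hA : S.StrictlyDissipative Q) :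
    ∃ om : ℝ, 0 < om ∧ ∀ x y, S.GraphA x y → inner ℝ y (S.weightOp hA x) ≤ -om * ‖x‖ ^ 2 := by
  obtain ⟨om, hom, h⟩ := hA.2.2
  refine ⟨om, hom, fun x y ⟨u, g, hH, h0, hx, hy⟩ => ?_⟩
  have h1 := h u g hH h0
  rw [MeasureTheory.L2.inner_def, L2.norm_sq_eq]
  refine le_of_eq_of_le ?_ (h1.trans_eq ?_)
  · refine integral_congr_ae ?_
    filter_upwards [hx, hy, S.coeFn_weightOp hA x] with ξ h1 h2 h3
    rw [h2, h3, h1]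
  · congr 1
    refine integral_congr_ae ?_
    filter_upwards [hx] with ξ h1
    rw [h1]

theorem graph_unique {S : System} {Q : ℝ → M2} (hA : S.StrictlyDissipative Q) {x x' y : L2}
    (h : S.GraphA x y) (h' : S.GraphA x' y) : x = x' := by
  obtain ⟨om, hom, hd⟩ := S.exists_graph_dissipative hA
  have h1 := hd _ _ (h.sub h')
  rw [sub_self, inner_zero_left] at h1
  have h2 : ‖x - x'‖ ^ 2 ≤ 0 := by
    by_contra hc
    push Not at hc
    nlinarith
  have h3 : ‖x - x'‖ = 0 := by nlinarith [norm_nonneg (x - x')]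
  exact sub_eq_zero.1 (norm_eq_zero.1 h3)

/-- `𝒦₄` applied to the primitive of an `L²` function. -/
noncomputable def calK₄Prim : L2 →L[ℝ] E2 :=
  (kernelCLM S.K₄_cont).comp primCLM + (act S.K₅).comp intCLM

theorem calK₄Prim_apply (g : L2) : S.calK₄Prim g = S.calK₄ (prim g) := by
  rw [calK₄, prim_one, ← kernelInt_congr (coeFn_primCLM g), ← kernelCLM_apply S.K₄_cont]
  rfl

theorem graph_prim (g : L2) :
    S.GraphA (primCLM g) (constCLM (S.calK₄Prim g) - pointwise S.Lam g) := by
  refine ⟨prim g, g, isH1_prim (Lp.memLp g), by simp [prim], coeFn_primCLM g, ?_⟩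
  filter_upwards [Lp.coeFn_sub (constCLM (S.calK₄Prim g)) (pointwise S.Lam g),
    coeFn_pointwise S.Lam g, coeFn_constCLM (S.calK₄Prim g)] with ξ h1 h2 h3
  rw [h1, Pi.sub_apply, h2, h3, calK₄Prim_apply]
  abel

theorem graph_zero : S.GraphA 0 0 := by simpa using S.graph_prim 0

/-- Prescribing `Λ u' = f + c` with the unknown constant `c = 𝒦₄ u` leaves a linear equation for
`c` in the plane, uniquely solvable because of dissipativity. -/
theorem exists_boundary_constant {Q : ℝ → M2} (hA : S.StrictlyDissipative Q) :
    ∃ C : L2 →L[ℝ] E2, ∀ f,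
      C f = S.calK₄Prim (pointwise S.Lam⁻¹ (f + constCLM (C f))) := by
  let k : L2 →L[ℝ] E2 := S.calK₄Prim.comp (pointwise S.Lam⁻¹)
  let N : E2 →L[ℝ] E2 := ContinuousLinearMap.id ℝ E2 - k.comp constCLM
  have hinj : Function.Injective N := by
    rw [injective_iff_map_eq_zero]
    intro c hc
    have hc' : c = S.calK₄Prim (pointwise S.Lam⁻¹ (constCLM c)) := sub_eq_zero.1 hc
    have h1 := S.graph_prim (pointwise S.Lam⁻¹ (constCLM c))
    rw [pointwise_lam_inv, ← hc', sub_self] at h1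
    have h2 := primCLM_injective (graph_unique hA h1 S.graph_zero)
    rw [hc', h2, map_zero]
  let e : E2 ≃ₗ[ℝ] E2 := LinearEquiv.ofInjectiveEndo N.toLinearMap hinj
  let Ni : E2 →L[ℝ] E2 := LinearMap.toContinuousLinearMap e.symm.toLinearMap
  have hNi : ∀ x, N (Ni x) = x := fun x => e.apply_symm_apply x
  refine ⟨Ni.comp k, fun f => ?_⟩
  have h1 : Ni (k f) - k (constCLM (Ni (k f))) = k f := hNi (k f)
  have h2 : Ni (k f) = k f + k (constCLM (Ni (k f))) := sub_eq_iff_eq_add.1 h1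
  rw [← map_add] at h2
  exact h2

/-- The graph of `𝒜` is that of `-R⁻¹` for a bounded injective `R`. That every element of the graph
arises from `R` follows from dissipativity, so no regularity theory of weak derivatives enters. -/
theorem exists_inverse {Q : ℝ → M2} (hA : S.StrictlyDissipative Q) :
    ∃ R : L2 →L[ℝ] L2, (∀ x y, S.GraphA x y ↔ x = -(R y)) ∧ ∀ f, R f = 0 → f = 0 := by
  obtain ⟨C, hC⟩ := S.exists_boundary_constant hA
  let R : L2 →L[ℝ] L2 := primCLM.comp ((pointwise S.Lam⁻¹).comp
    (ContinuousLinearMap.id ℝ L2 + constCLM.comp C))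
  have hR : ∀ f, R f = primCLM (pointwise S.Lam⁻¹ (f + constCLM (C f))) := fun f => rfl
  have hG : ∀ f, S.GraphA (R f) (-f) := by
    intro f
    have h1 := S.graph_prim (pointwise S.Lam⁻¹ (f + constCLM (C f)))
    rw [pointwise_lam_inv, ← hC, sub_add_cancel_right, ← hR] at h1
    exact h1
  refine ⟨R, fun x y => ⟨fun h => ?_, ?_⟩, fun f hf => ?_⟩
  · have h1 := hG (-y)
    rw [neg_neg] at h1
    rw [graph_unique hA h h1, map_neg]
  · rintro rfl
    have h1 := hG (-y)
    rwa [neg_neg, map_neg] at h1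
  · rw [hR] at hf
    have h1 := primCLM_injective hf
    have h2 : C f = 0 := by rw [hC, h1, map_zero]
    have h3 := pointwise_lam_inv S (f + constCLM (C f))
    rw [h1, map_zero, h2, map_zero, add_zero] at h3
    exact h3.symm

theorem inner_act_of_isDiag {D : M2} (hD : D.IsDiag) (a b : E2) :
    inner ℝ a (act D b) = D 0 0 * (a 0 * b 0) + D 1 1 * (a 1 * b 1) := by
  have h1 : D 0 1 = 0 := hD (by decide)
  have h2 : D 1 0 = 0 := hD (by decide)
  have e0 : (act D b) 0 = D 0 0 * b 0 + D 0 1 * b 1 := by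
    simp [act, Matrix.ofLp_toEuclideanCLM, Matrix.mulVec, dotProduct, Fin.sum_univ_two]
  have e1 : (act D b) 1 = D 1 0 * b 0 + D 1 1 * b 1 := by
    simp [act, Matrix.ofLp_toEuclideanCLM, Matrix.mulVec, dotProduct, Fin.sum_univ_two]
  simp only [PiLp.inner_apply, Fin.sum_univ_two, e0, e1, h1, h2]
  simp only [RCLike.inner_apply, conj_trivial]
  ring

theorem weightOp_symm {Q : ℝ → M2} (hA : S.StrictlyDissipative Q) (x y : L2) :
    inner ℝ (S.weightOp hA x) y = inner ℝ x (S.weightOp hA y) := by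
  rw [MeasureTheory.L2.inner_def, MeasureTheory.L2.inner_def]
  refine integral_congr_ae ?_
  filter_upwards [S.coeFn_weightOp hA x, S.coeFn_weightOp hA y, ae_restrict_mem measurableSet_Ioo]
    with ξ h1 h2 hξ
  have hD := (hA.2.1 ξ (Ioo_subset_Icc_self hξ)).1
  rw [h1, h2, real_inner_comm, inner_act_of_isDiag hD, inner_act_of_isDiag hD]
  ring

theorem exists_weight_coercive {Q : ℝ → M2} (hA : S.StrictlyDissipative Q) :
    ∃ c : ℝ, 0 < c ∧ ∀ x, c * ‖x‖ ^ 2 ≤ inner ℝ x (S.weightOp hA x) := by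
  have hent : ∀ i : Fin 2, ∃ m : ℝ, 0 < m ∧ ∀ ξ ∈ Icc (0 : ℝ) 1, m ≤ Q ξ i i := by
    intro i
    have hc : ContinuousOn (fun ξ => Q ξ i i) (Icc 0 1) :=
      (continuous_id.matrix_elem i i).comp_continuousOn hA.1
    obtain ⟨ξ₀, h0, hmin⟩ := isCompact_Icc.exists_isMinOn (nonempty_Icc.2 zero_le_one) hc
    exact ⟨Q ξ₀ i i, (hA.2.1 ξ₀ h0).2.diag_pos, fun ξ hξ => hmin hξ⟩
  obtain ⟨m₀, hm₀, h₀⟩ := hent 0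
  obtain ⟨m₁, hm₁, h₁⟩ := hent 1
  refine ⟨min m₀ m₁, lt_min hm₀ hm₁, fun x => ?_⟩
  have hi : Integrable (fun ξ => ‖x ξ‖ ^ 2) mu01 := (Lp.memLp x).integrable_norm_pow (by simp)
  rw [L2.norm_sq_eq, MeasureTheory.L2.inner_def, ← integral_const_mul]
  refine integral_mono_ae (hi.const_mul _) (MeasureTheory.L2.integrable_inner x _) ?_
  filter_upwards [S.coeFn_weightOp hA x, ae_restrict_mem measurableSet_Ioo] with ξ h2 hξ
  have hξ' := Ioo_subset_Icc_self hξ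
  rw [h2, inner_act_of_isDiag (hA.2.1 ξ hξ').1, EuclideanSpace.norm_sq_eq]
  simp only [Fin.sum_univ_two, Real.norm_eq_abs, sq_abs]
  have e0 : min m₀ m₁ * (x ξ 0) ^ 2 ≤ Q ξ 0 0 * (x ξ 0) ^ 2 :=
    mul_le_mul_of_nonneg_right ((min_le_left _ _).trans (h₀ ξ hξ')) (sq_nonneg _)
  have e1 : min m₀ m₁ * (x ξ 1) ^ 2 ≤ Q ξ 1 1 * (x ξ 1) ^ 2 :=
    mul_le_mul_of_nonneg_right ((min_le_right _ _).trans (h₁ ξ hξ')) (sq_nonneg _)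
  linarith

/-- The generator `ε⁻¹ 𝒜` is the negative inverse of `ε R`, and its dissipation rate is `om / ε`. -/
theorem exists_dissipativeInverse {Q : ℝ → M2} (hA : S.StrictlyDissipative Q) :
    ∃ (R : L2 →L[ℝ] L2) (c om : ℝ), (∀ x y, S.GraphA x y ↔ x = -(R y)) ∧
      ∀ ε : ℝ, 0 < ε → DissipativeInverse (S.weightOp hA) (ε • R) c (om / ε) := by
  obtain ⟨R, hR, hinj⟩ := S.exists_inverse hA
  obtain ⟨c, hc, hco⟩ := S.exists_weight_coercive hA
  obtain ⟨om, hom, hd⟩ := S.exists_graph_dissipative hA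
  refine ⟨R, c, om, hR, fun ε hε => ⟨hc, by positivity, S.weightOp_symm hA, hco, fun f => ?_,
    fun f hf => hinj f ?_⟩⟩
  · have h1 := hd (R f) (-f) ((hR _ _).2 (by simp))
    rw [inner_neg_left] at h1
    simp only [smul_apply, map_smul, inner_smul_right, norm_smul,
      Real.norm_of_nonneg hε.le]
    calc om / ε * (ε * ‖R f‖) ^ 2 = ε * (om * ‖R f‖ ^ 2) := by field_simp
      _ ≤ _ := by gcongr; linarith
  · exact (smul_eq_zero.1 hf).resolve_left hε.ne'

end System
end SingleTrack

namespace SingleTrack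

/-! ### Lipschitz continuity on bounded sets -/

namespace LipBdd

variable {E F G : Type*} [NormedAddCommGroup E] [NormedAddCommGroup F] [NormedAddCommGroup G]

theorem exists_bound {f : E → F} (hf : LipBdd f) (ρ : ℝ) :
    ∃ C : ℝ, 0 ≤ C ∧ ∀ x, ‖x‖ ≤ ρ → ‖f x‖ ≤ C := by
  obtain ⟨K, hK, h⟩ := hf |ρ|
  refine ⟨K * |ρ| + ‖f 0‖, by positivity, fun x hx => ?_⟩
  have hx' : ‖x‖ ≤ |ρ| := hx.trans (le_abs_self ρ)
  have h1 := h x 0 hx' (by simp)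
  rw [sub_zero] at h1
  have h2 : ‖f x‖ ≤ ‖f x - f 0‖ + ‖f 0‖ := by simpa using norm_add_le (f x - f 0) (f 0)
  have h3 : K * ‖x‖ ≤ K * |ρ| := by gcongr
  linarith

theorem of_lipschitz {f : E → F} {K : ℝ} (hf : ∀ x y, ‖f x - f y‖ ≤ K * ‖x - y‖) : LipBdd f :=
  fun _ => ⟨|K|, abs_nonneg K, fun x y _ _ => (hf x y).trans (by gcongr; exact le_abs_self K)⟩

theorem const (c : F) : LipBdd fun _ : E => c := of_lipschitz (K := 0) (by simp)

theorem add {f g : E → F} (hf : LipBdd f) (hg : LipBdd g) : LipBdd fun x => f x + g x := by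
  intro ρ
  obtain ⟨K, hK, h⟩ := hf ρ
  obtain ⟨L, hL, h'⟩ := hg ρ
  refine ⟨K + L, by positivity, fun x y hx hy => ?_⟩
  rw [add_sub_add_comm, add_mul]
  exact (norm_add_le _ _).trans (add_le_add (h x y hx hy) (h' x y hx hy))

theorem neg {f : E → F} (hf : LipBdd f) : LipBdd fun x => -f x := by
  intro ρ
  obtain ⟨K, hK, h⟩ := hf ρ
  refine ⟨K, hK, fun x y hx hy => ?_⟩
  rw [← neg_sub', norm_neg]
  exact h x y hx hy

theorem sub {f g : E → F} (hf : LipBdd f) (hg : LipBdd g) : LipBdd fun x => f x - g x := by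
  simpa only [sub_eq_add_neg] using hf.add hg.neg

theorem comp {g : F → G} {f : E → F} (hg : LipBdd g) (hf : LipBdd f) :
    LipBdd fun x => g (f x) := by
  intro ρ
  obtain ⟨K, hK, h⟩ := hf ρ
  obtain ⟨C, _, hC⟩ := hf.exists_bound ρ
  obtain ⟨L, hL, h'⟩ := hg C
  refine ⟨L * K, by positivity, fun x y hx hy => ?_⟩
  refine (h' _ _ (hC x hx) (hC y hy)).trans ?_
  rw [mul_assoc]
  gcongr
  exact h x y hx hy

theorem prodMk {f : E → F} {g : E → G} (hf : LipBdd f) (hg : LipBdd g) :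
    LipBdd fun x => (f x, g x) := by
  intro ρ
  obtain ⟨K, hK, h⟩ := hf ρ
  obtain ⟨L, hL, h'⟩ := hg ρ
  refine ⟨max K L, by positivity, fun x y hx hy => ?_⟩
  rw [Prod.mk_sub_mk, Prod.norm_mk]
  refine max_le ((h x y hx hy).trans ?_) ((h' x y hx hy).trans ?_) <;> gcongr
  · exact le_max_left _ _
  · exact le_max_right _ _

theorem continuous {f : E → F} (hf : LipBdd f) : Continuous f := by
  rw [continuous_iff_continuousAt]
  intro x
  obtain ⟨K, hK, h⟩ := hf (‖x‖ + 1)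
  refine tendsto_iff_norm_sub_tendsto_zero.2 ?_
  have hlim : Tendsto (fun y => K * ‖y - x‖) (𝓝 x) (𝓝 (K * ‖x - x‖)) :=
    (by fun_prop : Continuous fun y => K * ‖y - x‖).tendsto x
  rw [sub_self, norm_zero, mul_zero] at hlim
  refine squeeze_zero' (Eventually.of_forall fun _ => norm_nonneg _) ?_ hlim
  have : ∀ᶠ y in 𝓝 x, ‖y‖ < ‖x‖ + 1 :=
    continuous_norm.continuousAt.eventually_lt_const (by linarith)
  filter_upwards [this] with y hy using h y x hy.le (by linarith)

variable [NormedSpace ℝ F] [NormedSpace ℝ G]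

theorem clm_apply {L : E → F →L[ℝ] G} {f : E → F} (hL : LipBdd L) (hf : LipBdd f) :
    LipBdd fun x => L x (f x) := by
  intro ρ
  obtain ⟨K, hK, h⟩ := hL ρ
  obtain ⟨K', hK', h'⟩ := hf ρ
  obtain ⟨C, hC, hC1⟩ := hL.exists_bound ρ
  obtain ⟨C', hC', hC1'⟩ := hf.exists_bound ρ
  refine ⟨K * C' + C * K', by positivity, fun x y hx hy => ?_⟩
  have h1 : L x (f x) - L y (f y) = (L x - L y) (f x) + L y (f x - f y) := by
    rw [sub_apply, map_sub]; abel
  rw [h1]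
  calc _ ≤ ‖L x - L y‖ * ‖f x‖ + ‖L y‖ * ‖f x - f y‖ :=
        (norm_add_le _ _).trans (add_le_add ((L x - L y).le_opNorm _) ((L y).le_opNorm _))
    _ ≤ K * ‖x - y‖ * C' + C * (K' * ‖x - y‖) := by
        gcongr
        · exact h x y hx hy
        · exact hC1' x hx
        · exact hC1 y hy
        · exact h' x y hx hy
    _ = _ := by ring

variable [NormedSpace ℝ E]

theorem clm (L : E →L[ℝ] F) : LipBdd L :=
  of_lipschitz (K := ‖L‖) fun x y => by rw [← map_sub]; exact L.le_opNorm _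

theorem of_contDiff [FiniteDimensional ℝ E] {f : E → F} (hf : ContDiff ℝ 1 f) : LipBdd f := by
  intro ρ
  have : ProperSpace E := FiniteDimensional.proper_real E
  obtain ⟨C, hC⟩ := (isCompact_closedBall (0 : E) ρ).exists_bound_of_continuousOn
    (hf.continuous_fderiv (by simp)).continuousOn
  refine ⟨|C|, abs_nonneg _, fun x y hx hy => ?_⟩
  refine ((convex_closedBall (0 : E) ρ).norm_image_sub_le_of_norm_fderiv_le
    (fun z _ => (hf.differentiable (by simp)) z) hC (x := y) (y := x) (by simpa using hy)
    (by simpa using hx)).trans ?_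
  gcongr
  exact le_abs_self C

end LipBdd

/-! ### Steady profiles -/

theorem intCLM_constCLM (c : E2) : intCLM (constCLM c) = c := by
  rw [intCLM_apply, integral_congr_ae (coeFn_constCLM c)]
  simp

theorem intCLM_pointwise (A : M2) (f : L2) : intCLM (pointwise A f) = act A (intCLM f) := by
  rw [intCLM_apply, intCLM_apply, integral_congr_ae (coeFn_pointwise A f)]
  exact (act A).integral_comp_comm f.integrable

namespace System

variable (S : System)

/-- The operator `w ↦ Σ(y) [w + 𝒦₃ w]` on `L²`. -/
noncomputable def srcOp (y : E2) : L2 →L[ℝ] L2 :=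
  (pointwise (S.Sig y)).comp (ContinuousLinearMap.id ℝ L2 + constCLM.comp (kernelCLM S.K₃_cont))

theorem coeFn_srcOp (y : E2) (w : L2) :
    S.srcOp y w =ᵐ[mu01] fun ξ => act (S.Sig y) (w ξ + kernelInt S.K₃ w) := by
  filter_upwards [coeFn_pointwise (S.Sig y) (w + constCLM (kernelCLM S.K₃_cont w)),
    Lp.coeFn_add w (constCLM (kernelCLM S.K₃_cont w)), coeFn_constCLM (kernelCLM S.K₃_cont w)]
    with ξ h1 h2 h3
  rw [← kernelCLM_apply S.K₃_cont, ← h3, ← Pi.add_apply, ← h2]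
  exact h1

theorem pdeSource_eq (X U : E2) (z : L2) :
    S.pdeSource X U z = S.srcOp (S.slip X U) z + constCLM (S.h₂ (S.slip X U)) := by
  rw [pdeSource, ← kernelCLM_apply S.K₃_cont]
  rfl

theorem inner_srcOp_le {Q : ℝ → M2} (hA : S.StrictlyDissipative Q) (hS : S.SourceDissipative Q)
    (y : E2) (w : L2) : inner ℝ w (S.weightOp hA (S.srcOp y w)) ≤ 0 := by
  refine le_of_eq_of_le ?_ (hS.1 y w)
  rw [MeasureTheory.L2.inner_def]
  refine integral_congr_ae ?_
  filter_upwards [S.coeFn_weightOp hA (S.srcOp y w), S.coeFn_srcOp y w] with ξ h1 h2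
  rw [h1, h2]

/-- The frozen problem `Λ f' = Σ(y) f + c` with constant `c` is solved by the matrix exponential;
the unknown `c = Σ(y) 𝒦₃ f + 𝒦₄ f + h₂(y)` solves a linear equation in the plane, uniquely so
because of dissipativity. -/
theorem exists_isSteadyProfile {Q : ℝ → M2} (hA : S.StrictlyDissipative Q)
    (hS : S.SourceDissipative Q) (y : E2) : ∃ f, S.IsSteadyProfile y f := by
  let N : E2 →L[ℝ] E2 := act (S.Lam⁻¹ * S.Sig y)
  have hN : ∀ x, act S.Lam (N x) = act (S.Sig y) x := fun x => by
    change act S.Lam (act (S.Lam⁻¹ * S.Sig y) x) = _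
    rw [act_mul, act_lam_inv]
  have hed : ∀ (x : E2) (s : ℝ), HasDerivAt (fun s : ℝ => NormedSpace.exp (s • N) x)
      (N (NormedSpace.exp (s • N) x)) s := fun x s => by
    simpa using (hasDerivAt_exp_smul_const' (𝕂 := ℝ) N s).clm_apply (hasDerivAt_const s x)
  have hec : ∀ x : E2, Continuous fun s : ℝ => NormedSpace.exp (s • N) x := fun x =>
    continuous_iff_continuousAt.2 fun s => (hed x s).continuousAt
  have he0 : ∀ x : E2, NormedSpace.exp ((0 : ℝ) • N) x = x := fun x => by
    have h0 : (0 : ℝ) • N = 0 := zero_smul ℝ N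
    rw [h0, NormedSpace.exp_zero]
    rfl
  have hecl : Continuous fun s : ℝ => NormedSpace.exp (s • N) :=
    continuous_iff_continuousAt.2 fun s => (hasDerivAt_exp_smul_const (𝕂 := ℝ) N s).continuousAt
  let gf : E2 → ℝ → E2 := fun c s => NormedSpace.exp (s • N) (act S.Lam⁻¹ c)
  have hfd : ∀ c ξ, HasDerivAt (prim (gf c)) (gf c ξ) ξ := fun c ξ =>
    ((hec (act S.Lam⁻¹ c)).integral_hasStrictDerivAt 0 ξ).hasDerivAt
  have hfe : ∀ c ξ, act S.Lam (gf c ξ) = act (S.Sig y) (prim (gf c) ξ) + c := by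
    intro c ξ
    have h1 : N (prim (gf c) ξ) = gf c ξ - act S.Lam⁻¹ c := by
      rw [prim, ← ContinuousLinearMap.intervalIntegral_comp_comm _
        ((hec _).intervalIntegrable _ _),
        intervalIntegral.integral_eq_sub_of_hasDerivAt (fun s _ => hed (act S.Lam⁻¹ c) s)
        ((N.continuous.comp (hec _)).intervalIntegrable _ _)]
      rw [he0]
    rw [← hN, h1, map_sub, act_lam_inv, sub_add_cancel]
  let g : E2 →L[ℝ] L2 := (mulOp (k := fun ξ => (NormedSpace.exp (ξ • N)).comp (act S.Lam⁻¹))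
    (hecl.clm_comp continuous_const).continuousOn).comp constCLM
  have hg : ∀ c, g c =ᵐ[mu01] gf c := by
    intro c
    filter_upwards [coeFn_mulOp (k := fun ξ => (NormedSpace.exp (ξ • N)).comp (act S.Lam⁻¹))
      (hecl.clm_comp continuous_const).continuousOn (constCLM c), coeFn_constCLM c] with ξ h1 h2
    rw [h2] at h1
    exact h1
  have hpg : ∀ c, ∀ ξ ∈ Icc (0 : ℝ) 1, prim (g c) ξ = prim (gf c) ξ := fun c ξ hξ =>
    prim_congr (hg c) hξ
  have hpae : ∀ c, primCLM (g c) =ᵐ[mu01] prim (gf c) := fun c =>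
    (coeFn_primCLM (g c)).trans ((ae_restrict_mem measurableSet_Ioo).mono fun ξ hξ =>
      hpg c ξ (Ioo_subset_Icc_self hξ))
  have hLg : ∀ c, pointwise S.Lam (g c) = pointwise (S.Sig y) (primCLM (g c)) + constCLM c := by
    intro c
    refine Lp.ext ?_
    filter_upwards [coeFn_pointwise S.Lam (g c), coeFn_pointwise (S.Sig y) (primCLM (g c)),
      Lp.coeFn_add (pointwise (S.Sig y) (primCLM (g c))) (constCLM c), coeFn_constCLM c, hg c,
      hpae c] with ξ h1 h2 h3 h4 h5 h6
    rw [h1, h3, Pi.add_apply, h2, h4, h5, h6, hfe]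
  let k : E2 →L[ℝ] E2 :=
    ((act (S.Sig y)).comp ((kernelCLM S.K₃_cont).comp primCLM) + S.calK₄Prim).comp g
  have hk : ∀ c, k c = act (S.Sig y) (kernelCLM S.K₃_cont (primCLM (g c))) + S.calK₄Prim (g c) :=
    fun c => rfl
  have hinj : Function.Injective (ContinuousLinearMap.id ℝ E2 - k) := by
    rw [injective_iff_map_eq_zero]
    intro c hc
    have hc' : c = k c := sub_eq_zero.1 hc
    obtain ⟨om, hom, hd⟩ := S.exists_graph_dissipative hA
    have h1 := hd _ _ (S.graph_prim (g c))
    have h2 : constCLM (S.calK₄Prim (g c)) - pointwise S.Lam (g c)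
        = -S.srcOp y (primCLM (g c)) := by
      have h3 : constCLM c = constCLM (act (S.Sig y) (kernelCLM S.K₃_cont (primCLM (g c))))
          + constCLM (S.calK₄Prim (g c)) := by
        rw [← map_add, ← hk, ← hc']
      have h4 : constCLM (act (S.Sig y) (kernelCLM S.K₃_cont (primCLM (g c))))
          = pointwise (S.Sig y) (constCLM (kernelCLM S.K₃_cont (primCLM (g c)))) := by
        refine Lp.ext ?_
        filter_upwards [coeFn_pointwise (S.Sig y) (constCLM (kernelCLM S.K₃_cont (primCLM (g c)))),
          coeFn_constCLM (act (S.Sig y) (kernelCLM S.K₃_cont (primCLM (g c)))),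
          coeFn_constCLM (kernelCLM S.K₃_cont (primCLM (g c)))] with ξ e1 e2 e3
        rw [e1, e2, e3]
      have h5 : S.srcOp y (primCLM (g c)) = pointwise (S.Sig y) (primCLM (g c))
          + pointwise (S.Sig y) (constCLM (kernelCLM S.K₃_cont (primCLM (g c)))) :=
        map_add (pointwise (S.Sig y)) _ _
      rw [hLg, h3, h5, h4]
      abel
    have h6 := S.inner_srcOp_le hA hS y (primCLM (g c))
    rw [h2, inner_neg_left, ← S.weightOp_symm hA, real_inner_comm] at h1
    have h7 : ‖primCLM (g c)‖ ^ 2 ≤ 0 := by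
      by_contra hcon
      push Not at hcon
      nlinarith
    have h8 : primCLM (g c) = 0 := by
      rw [← norm_eq_zero]; nlinarith [norm_nonneg (primCLM (g c))]
    have h9 := hLg c
    rw [primCLM_injective h8, map_zero, map_zero, map_zero, zero_add] at h9
    rw [← intCLM_constCLM c, ← h9, map_zero]
  obtain ⟨c, hc⟩ := (LinearMap.injective_iff_surjective
    (f := (ContinuousLinearMap.id ℝ E2 - k).toLinearMap)).1 hinj (S.h₂ y)
  have hc' : c = k c + S.h₂ y := by
    have : c - k c = S.h₂ y := hc
    rw [← this]; abel
  refine ⟨prim (gf c), ?_, by simp [prim], fun ξ _ => ?_⟩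
  · have h1 : ContDiff ℝ 1 (prim (gf c)) := by
      rw [contDiff_one_iff_deriv]
      refine ⟨fun ξ => (hfd c ξ).differentiableAt, ?_⟩
      rw [funext fun ξ => (hfd c ξ).deriv]
      exact hec _
    exact h1.contDiffOn
  · have h1 : S.calK₄ (prim (gf c)) = S.calK₄Prim (g c) := by
      rw [calK₄Prim_apply, calK₄, calK₄, hpg c 1 (by simp)]
      rw [kernelInt_congr ((hpae c).symm.trans (coeFn_primCLM (g c)))]
    have h2 : kernelInt S.K₃ (prim (gf c)) = kernelCLM S.K₃_cont (primCLM (g c)) := by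
      rw [kernelCLM_apply, kernelInt_congr (hpae c)]
    rw [(hfd c ξ).deriv, hfe, h1, h2]
    nth_rewrite 2 [hc']
    rw [hk, map_add]
    abel

theorem isSteadyProfile_phi {Q : ℝ → M2} (hA : S.StrictlyDissipative Q)
    (hS : S.SourceDissipative Q) (y : E2) : S.IsSteadyProfile y fun ξ => S.phi ξ y := by
  have h := S.exists_isSteadyProfile hA hS y
  have : (fun ξ => S.phi ξ y) = h.choose := by
    ext1 ξ
    simp only [phi, h, dite_true]
  rw [this]
  exact h.choose_spec

theorem exists_deriv_phi {Q : ℝ → M2} (hA : S.StrictlyDissipative Q)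
    (hS : S.SourceDissipative Q) (y : E2) :
    ∃ g : L2, primCLM g = S.phiL2 y ∧ intCLM g = S.phi 1 y ∧
      pointwise S.Lam g = S.srcOp y (S.phiL2 y) + constCLM (S.calK₄Prim g)
        + constCLM (S.h₂ y) := by
  have hp := S.isSteadyProfile_phi hA hS y
  set f : ℝ → E2 := fun ξ => S.phi ξ y with hf
  have hc : ContinuousOn (derivWithin f (Icc 0 1)) (Icc 0 1) :=
    hp.contDiffOn.continuousOn_derivWithin (uniqueDiffOn_Icc zero_lt_one) le_rfl
  have hm := memLp_of_continuousOn hc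
  have hd : ∀ ξ ∈ Ioo (0 : ℝ) 1, HasDerivAt f (derivWithin f (Icc 0 1) ξ) ξ := fun ξ hξ =>
    ((hp.contDiffOn.differentiableOn (by simp)) ξ (Ioo_subset_Icc_self hξ)).hasDerivWithinAt.hasDerivAt
      (Icc_mem_nhds hξ.1 hξ.2)
  have hprim : ∀ ξ ∈ Icc (0 : ℝ) 1, prim (hm.toLp _) ξ = f ξ := by
    intro ξ hξ
    rw [prim_congr hm.coeFn_toLp hξ, prim,
      intervalIntegral.integral_eq_sub_of_hasDerivAt_of_le hξ.1
        (hp.contDiffOn.continuousOn.mono (Icc_subset_Icc_right hξ.2))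
        (fun s hs => hd s ⟨hs.1, hs.2.trans_le hξ.2⟩)
        ((hc.mono (by rw [uIcc_of_le hξ.1]; exact Icc_subset_Icc_right hξ.2)).intervalIntegrable),
      hp.left, sub_zero]
  have hfae : S.phiL2 y =ᵐ[mu01] f := (S.memLp_phi y).coeFn_toLp
  have hprimae : prim (hm.toLp _) =ᵐ[mu01] f :=
    (ae_restrict_mem measurableSet_Ioo).mono fun ξ hξ => hprim ξ (Ioo_subset_Icc_self hξ)
  have h1 : primCLM (hm.toLp _) = S.phiL2 y :=
    Lp.ext ((coeFn_primCLM _).trans (hprimae.trans hfae.symm))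
  refine ⟨hm.toLp _, h1, ?_, ?_⟩
  · rw [intCLM_apply, ← prim_one, hprim 1 (by simp)]
  · have h2 : S.calK₄Prim (hm.toLp _) = S.calK₄ f := by
      rw [calK₄Prim_apply, calK₄, calK₄, kernelInt_congr hprimae, hprim 1 (by simp)]
    rw [h2]
    refine Lp.ext ?_
    filter_upwards [coeFn_pointwise S.Lam (hm.toLp _), hm.coeFn_toLp, S.coeFn_srcOp y (S.phiL2 y),
      Lp.coeFn_add (S.srcOp y (S.phiL2 y) + constCLM (S.calK₄ f)) (constCLM (S.h₂ y)),
      Lp.coeFn_add (S.srcOp y (S.phiL2 y)) (constCLM (S.calK₄ f)), coeFn_constCLM (S.calK₄ f),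
      coeFn_constCLM (S.h₂ y), hfae, ae_restrict_mem measurableSet_Ioo]
      with ξ e1 e2 e3 e4 e5 e6 e7 e8 hξ
    rw [e1, e2, e4, Pi.add_apply, e5, Pi.add_apply, e3, e6, e7, e8, kernelInt_congr hfae,
      ← (hd ξ hξ).deriv, hp.eqn ξ hξ]

theorem graph_phiL2 {Q : ℝ → M2} (hA : S.StrictlyDissipative Q) (hS : S.SourceDissipative Q)
    (y : E2) : S.GraphA (S.phiL2 y) (-(S.srcOp y (S.phiL2 y) + constCLM (S.h₂ y))) := by
  obtain ⟨g, h1, _, h3⟩ := S.exists_deriv_phi hA hS y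
  have h4 := S.graph_prim g
  rw [h1, h3] at h4
  convert h4 using 1
  abel

/-- Integration of the steady-state equation over `(0,1)` expresses `h₂` through the profile; this
is how the regularity of the profile passes to `h₂`. -/
theorem h₂_eq {Q : ℝ → M2} (hA : S.StrictlyDissipative Q) (hS : S.SourceDissipative Q) (y : E2) :
    S.h₂ y = act S.Lam (S.phi 1 y) - intCLM (S.srcOp y (S.phiL2 y))
      - (kernelCLM S.K₄_cont (S.phiL2 y) + act S.K₅ (S.phi 1 y)) := by
  obtain ⟨g, h1, h2, h3⟩ := S.exists_deriv_phi hA hS y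
  have h4 := congrArg intCLM h3
  rw [intCLM_pointwise, map_add, map_add, intCLM_constCLM, intCLM_constCLM, h2] at h4
  have h5 : S.calK₄Prim g = kernelCLM S.K₄_cont (S.phiL2 y) + act S.K₅ (S.phi 1 y) := by
    rw [← h1, ← h2]; rfl
  rw [h4, h5]
  abel

theorem h₁_eq (y : E2) :
    S.h₁ y = S.Phi y - kernelCLM S.K₁_cont (S.phiL2 y)
      - act (S.Sig y) (kernelCLM S.K₂_cont (S.phiL2 y)) := by
  have hfae : S.phiL2 y =ᵐ[mu01] fun ξ => S.phi ξ y := (S.memLp_phi y).coeFn_toLp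
  rw [kernelCLM_apply, kernelCLM_apply, kernelInt_congr hfae, kernelInt_congr hfae, Phi]
  abel

theorem norm_phi_sub_le {S : System} {M : ℝ} (hphi : S.SmoothSteadyState)
    (hM : ∀ y : E2, ∀ ξ ∈ Icc (0 : ℝ) 1, ‖fderiv ℝ (S.phi ξ) y‖ ≤ M) {ξ : ℝ}
    (hξ : ξ ∈ Icc (0 : ℝ) 1) (y y' : E2) : ‖S.phi ξ y - S.phi ξ y'‖ ≤ M * ‖y - y'‖ := by
  have hd : ContDiff ℝ 1 (S.phi ξ) := by
    have h1 : ContDiff ℝ 1 fun y : E2 => (ξ, y) := by fun_prop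
    rw [← contDiffOn_univ]
    exact hphi.1.comp h1.contDiffOn fun y _ => ⟨hξ, mem_univ _⟩
  exact convex_univ.norm_image_sub_le_of_norm_fderiv_le
    (fun z _ => (hd.differentiable (by simp)) z) (fun z _ => hM z ξ hξ) (mem_univ _) (mem_univ _)

theorem norm_phiL2_sub_le {S : System} {M : ℝ} (hM0 : 0 ≤ M) (hphi : S.SmoothSteadyState)
    (hM : ∀ y : E2, ∀ ξ ∈ Icc (0 : ℝ) 1, ‖fderiv ℝ (S.phi ξ) y‖ ≤ M) (y y' : E2) :
    ‖S.phiL2 y - S.phiL2 y'‖ ≤ M * ‖y - y'‖ := by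
  have h := Lp.norm_le_of_ae_bound (f := S.phiL2 y - S.phiL2 y') (C := M * ‖y - y'‖)
    (by positivity) (by
      filter_upwards [Lp.coeFn_sub (S.phiL2 y) (S.phiL2 y'), (S.memLp_phi y).coeFn_toLp,
        (S.memLp_phi y').coeFn_toLp, ae_restrict_mem measurableSet_Ioo] with ξ h1 h2 h3 hξ
      rw [h1, Pi.sub_apply]
      unfold phiL2
      rw [h2, h3]
      exact norm_phi_sub_le hphi hM (Ioo_subset_Icc_self hξ) y y')
  have h1 : measureUnivNNReal mu01 = 1 := by
    rw [← ENNReal.coe_inj, coe_measureUnivNNReal, measure_univ, ENNReal.coe_one]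
  simpa [h1] using h

theorem lipBdd_act_Sig {Q : ℝ → M2} (hS : S.SourceDissipative Q) :
    LipBdd fun y => act (S.Sig y) := by
  obtain ⟨L, _, h⟩ := hS.2
  refine LipBdd.of_lipschitz (K := L) fun x y => ?_
  rw [← map_sub]
  exact h x y

theorem lipBdd_srcOp {Q : ℝ → M2} (hS : S.SourceDissipative Q) : LipBdd S.srcOp := by
  obtain ⟨L, _, h⟩ := hS.2
  refine LipBdd.of_lipschitz
    (K := L * ‖ContinuousLinearMap.id ℝ L2 + constCLM.comp (kernelCLM S.K₃_cont)‖) fun x y => ?_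
  have h1 : pointwise (S.Sig x) - pointwise (S.Sig y) = pointwise (S.Sig x - S.Sig y) := by
    ext1 f
    refine Lp.ext ?_
    rw [sub_apply]
    filter_upwards [Lp.coeFn_sub (pointwise (S.Sig x) f) (pointwise (S.Sig y) f),
      coeFn_pointwise (S.Sig x) f, coeFn_pointwise (S.Sig y) f,
      coeFn_pointwise (S.Sig x - S.Sig y) f] with ξ e1 e2 e3 e4
    rw [e1, Pi.sub_apply, e2, e3, e4]
    unfold act
    rw [map_sub, sub_apply]
  rw [srcOp, srcOp, ← ContinuousLinearMap.sub_comp, h1]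
  refine (ContinuousLinearMap.opNorm_comp_le _ _).trans ?_
  rw [mul_right_comm]
  gcongr
  exact (ContinuousLinearMap.norm_compLpL_le _).trans (h x y)

variable {S}

theorem lipBdd_phiL2 (hphi : S.SmoothSteadyState) : LipBdd S.phiL2 := by
  obtain ⟨M, hM0, hM⟩ := hphi.2.2
  exact LipBdd.of_lipschitz (norm_phiL2_sub_le hM0 hphi hM)

theorem lipBdd_h₁ {Q : ℝ → M2} (hS : S.SourceDissipative Q) (hphi : S.SmoothSteadyState) :
    LipBdd S.h₁ := by
  rw [funext S.h₁_eq]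
  have h := lipBdd_phiL2 hphi
  exact ((LipBdd.of_contDiff hphi.2.1).sub ((LipBdd.clm (kernelCLM S.K₁_cont)).comp h)).sub
    ((S.lipBdd_act_Sig hS).clm_apply ((LipBdd.clm (kernelCLM S.K₂_cont)).comp h))

theorem lipBdd_h₂ {Q : ℝ → M2} (hA : S.StrictlyDissipative Q) (hS : S.SourceDissipative Q)
    (hphi : S.SmoothSteadyState) : LipBdd S.h₂ := by
  rw [funext (S.h₂_eq hA hS)]
  have h := lipBdd_phiL2 hphi
  have h1 : LipBdd (S.phi 1) := by
    obtain ⟨M, hM0, hM⟩ := hphi.2.2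
    exact LipBdd.of_lipschitz (norm_phi_sub_le hphi hM (by simp))
  exact (((LipBdd.clm (act S.Lam)).comp h1).sub
    ((LipBdd.clm intCLM).comp ((S.lipBdd_srcOp hS).clm_apply h))).sub
    (((LipBdd.clm (kernelCLM S.K₄_cont)).comp h).add ((LipBdd.clm (act S.K₅)).comp h1))

/-- The closed-loop vector field, without the unbounded part. -/
noncomputable def closedLoop (S : System) (ε : ℝ) (F : M2) (Xs Us : E2) (p : E2 × L2) : E2 × L2 :=
  (S.odeRhs p.1 (feedback F Xs Us p.1) p.2, ε⁻¹ • S.pdeSource p.1 (feedback F Xs Us p.1) p.2)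

/-- The slip angles along the closed loop. -/
noncomputable def loopSlip (S : System) (F : M2) (Xs Us : E2) (X : E2) : E2 :=
  S.slip X (feedback F Xs Us X)

theorem loopSlip_sub (S : System) (F : M2) (Xs Us X Y : E2) :
    S.loopSlip F Xs Us X - S.loopSlip F Xs Us Y = (act S.A₂ + (act S.G₂).comp (act F)) (X - Y) := by
  simp only [loopSlip, slip, feedback, map_add, map_sub, add_apply, ContinuousLinearMap.comp_apply]
  abel

theorem lipBdd_closedLoop {Q : ℝ → M2} (hA : S.StrictlyDissipative Q)
    (hS : S.SourceDissipative Q) (hphi : S.SmoothSteadyState) (ε : ℝ) (F : M2) (Xs Us : E2) :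
    LipBdd (S.closedLoop ε F Xs Us) := by
  have hX : LipBdd fun p : E2 × L2 => p.1 := LipBdd.clm (ContinuousLinearMap.fst ℝ E2 L2)
  have hz : LipBdd fun p : E2 × L2 => p.2 := LipBdd.clm (ContinuousLinearMap.snd ℝ E2 L2)
  have hα : LipBdd fun p : E2 × L2 => S.slip p.1 (feedback F Xs Us p.1) := by
    have h1 : LipBdd (S.loopSlip F Xs Us) := LipBdd.of_lipschitz fun x y => by
      rw [loopSlip_sub]; exact ContinuousLinearMap.le_opNorm _ _
    exact h1.comp hX
  have hk : ∀ {K : ℝ → M2} (hK : ContinuousOn K (Icc 0 1)),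
      LipBdd fun p : E2 × L2 => kernelInt K p.2 := fun hK => by
    simpa only [← kernelCLM_apply hK] using (LipBdd.clm (kernelCLM hK)).comp hz
  refine LipBdd.prodMk ?_ (LipBdd.comp
    (f := fun p : E2 × L2 => S.pdeSource p.1 (feedback F Xs Us p.1) p.2)
    (LipBdd.clm (ε⁻¹ • ContinuousLinearMap.id ℝ L2)) ?_)
  · have hsig := (S.lipBdd_act_Sig hS).comp hα
    have h1 := (hk S.K₁_cont).add (hsig.clm_apply (hk S.K₂_cont))
    exact ((((LipBdd.clm (act S.A₁)).comp hX).add ((LipBdd.clm (act S.G₁)).comp h1)).add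
      ((LipBdd.clm (act S.G₁)).comp ((lipBdd_h₁ hS hphi).comp hα))).add (LipBdd.const S.b)
  · have h1 := (((S.lipBdd_srcOp hS).comp hα).clm_apply hz).add
      ((LipBdd.clm constCLM).comp ((lipBdd_h₂ hA hS hphi).comp hα))
    simpa only [← pdeSource_eq] using h1

end System
end SingleTrack

namespace SingleTrack

/-! ### The planar Lyapunov equation -/

theorem IsHurwitz.root_re_neg {A : M2} (hA : IsHurwitz A) {c : ℂ}
    (hc : c ^ 2 - (A 0 0 + A 1 1 : ℝ) * c + (A 0 0 * A 1 1 - A 0 1 * A 1 0 : ℝ) = 0) : c.re < 0 := by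
  refine hA c ?_
  rw [spectrum.mem_iff, Matrix.isUnit_iff_isUnit_det, isUnit_iff_ne_zero, not_not,
    Matrix.det_fin_two]
  push_cast at hc
  simp only [Matrix.sub_apply, Matrix.algebraMap_matrix_apply, Matrix.map_apply]
  simp
  linear_combination hc

theorem IsHurwitz.det_pos_trace_neg {A : M2} (hA : IsHurwitz A) :
    0 < A 0 0 * A 1 1 - A 0 1 * A 1 0 ∧ A 0 0 + A 1 1 < 0 := by
  set d := A 0 0 * A 1 1 - A 0 1 * A 1 0 with hd
  set τ := A 0 0 + A 1 1 with hτ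
  have key : ∀ c : ℂ, c ^ 2 - (τ : ℂ) * c + (d : ℂ) = 0 → c.re < 0 := fun c hc =>
    hA.root_re_neg hc
  -- a real characteristic root exists as soon as the discriminant is nonnegative
  have hreal : 0 ≤ τ ^ 2 - 4 * d → (τ + √(τ ^ 2 - 4 * d)) / 2 < 0 := by
    intro h0
    have h1 := Real.sq_sqrt h0
    have h2 : ((τ + √(τ ^ 2 - 4 * d)) / 2) ^ 2 - τ * ((τ + √(τ ^ 2 - 4 * d)) / 2) + d = 0 := by
      nlinarith
    have h3 := key (((τ + √(τ ^ 2 - 4 * d)) / 2 : ℝ) : ℂ) (by exact_mod_cast h2)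
    rwa [Complex.ofReal_re] at h3
  have hd0 : 0 < d := by
    by_contra hcon
    push Not at hcon
    have h1 := hreal (by nlinarith [sq_nonneg τ])
    have h2 : |τ| ≤ √(τ ^ 2 - 4 * d) := Real.abs_le_sqrt (by linarith)
    linarith [neg_abs_le τ]
  refine ⟨hd0, ?_⟩
  rcases le_or_gt 0 (τ ^ 2 - 4 * d) with h0 | h0
  · have h1 := hreal h0
    linarith [Real.sqrt_nonneg (τ ^ 2 - 4 * d)]
  · have h1 := Real.sq_sqrt (by linarith : 0 ≤ 4 * d - τ ^ 2)
    generalize √(4 * d - τ ^ 2) = w at h1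
    have h2 := key (⟨τ / 2, w / 2⟩ : ℂ) (by
      apply Complex.ext
      · simp [sq]; nlinarith
      · simp [sq]; ring)
    have h3 : τ / 2 < 0 := h2
    linarith

theorem act_apply_zero (A : M2) (x : E2) : act A x 0 = A 0 0 * x 0 + A 0 1 * x 1 := by
  simp [act, Matrix.ofLp_toEuclideanCLM, Matrix.mulVec, dotProduct, Fin.sum_univ_two]

theorem act_apply_one (A : M2) (x : E2) : act A x 1 = A 1 0 * x 0 + A 1 1 * x 1 := by
  simp [act, Matrix.ofLp_toEuclideanCLM, Matrix.mulVec, dotProduct, Fin.sum_univ_two]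

theorem inner_eq_two (x y : E2) : inner ℝ x y = x 0 * y 0 + x 1 * y 1 := by
  simp only [PiLp.inner_apply, Fin.sum_univ_two, RCLike.inner_apply, conj_trivial]
  ring

theorem norm_sq_eq_two (x : E2) : ‖x‖ ^ 2 = x 0 ^ 2 + x 1 ^ 2 := by
  rw [EuclideanSpace.norm_sq_eq]
  simp [Fin.sum_univ_two]

/-- The solution of `AᵀP + PA = -1` is `-(det A + adj(A)ᵀ adj(A)) / (2 tr A det A)`, by the theorem
of Cayley and Hamilton. -/
theorem IsHurwitz.exists_lyapunov {A : M2} (hA : IsHurwitz A) :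
    ∃ (P : E2 →L[ℝ] E2) (p : ℝ), 0 < p ∧ (∀ x y, inner ℝ (P x) y = inner ℝ x (P y)) ∧
      (∀ x, p * ‖x‖ ^ 2 ≤ inner ℝ x (P x)) ∧ ∀ x, 2 * inner ℝ (P x) (act A x) = -‖x‖ ^ 2 := by
  obtain ⟨hd, hτ⟩ := hA.det_pos_trace_neg
  set a := A 0 0 with ha
  set b := A 0 1 with hb
  set c := A 1 0 with hc
  set e := A 1 1 with he
  set k : ℝ := (-2 * (a + e) * (a * e - b * c))⁻¹ with hk
  have hpos : 0 < -2 * (a + e) * (a * e - b * c) := by nlinarith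
  have hk0 : 0 < k := inv_pos.2 hpos
  have hkk : k * (-2 * (a + e) * (a * e - b * c)) = 1 := inv_mul_cancel₀ hpos.ne'
  let Pm : M2 := !![k * (a * e - b * c + e ^ 2 + c ^ 2), -k * (b * e + a * c);
    -k * (b * e + a * c), k * (a * e - b * c + a ^ 2 + b ^ 2)]
  refine ⟨act Pm, k * (a * e - b * c), mul_pos hk0 hd, fun x y => ?_, fun x => ?_, fun x => ?_⟩
  · simp only [inner_eq_two, act_apply_zero, act_apply_one, Pm, Matrix.of_apply,
      Matrix.cons_val', Matrix.cons_val_zero, Matrix.cons_val_one, Matrix.cons_val_fin_one]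
    ring
  · simp only [inner_eq_two, norm_sq_eq_two, act_apply_zero, act_apply_one, Pm, Matrix.of_apply,
      Matrix.cons_val', Matrix.cons_val_zero, Matrix.cons_val_one, Matrix.cons_val_fin_one]
    have := mul_nonneg hk0.le (add_nonneg (sq_nonneg (e * x 0 - b * x 1))
      (sq_nonneg (a * x 1 - c * x 0)))
    nlinarith
  · simp only [inner_eq_two, norm_sq_eq_two, act_apply_zero, act_apply_one, Pm, Matrix.of_apply,
      Matrix.cons_val', Matrix.cons_val_zero, Matrix.cons_val_one, Matrix.cons_val_fin_one,
      ← ha, ← hb, ← hc, ← he]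
    linear_combination (-(x 0 ^ 2 + x 1 ^ 2)) * hkk

end SingleTrack

namespace SingleTrack
namespace System

/-! ### The reduced dynamics -/

variable (S : System)

theorem act_Ctilde (y : E2) (v : E2) : act (S.Ctilde y) v = fderiv ℝ S.Phi y v := by
  have hv : v = v 0 • EuclideanSpace.single (0 : Fin 2) (1 : ℝ)
      + v 1 • EuclideanSpace.single (1 : Fin 2) (1 : ℝ) := by
    ext i; fin_cases i <;> simp
  have h1 : fderiv ℝ S.Phi y v = v 0 • fderiv ℝ S.Phi y (EuclideanSpace.single (0 : Fin 2) (1 : ℝ))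
      + v 1 • fderiv ℝ S.Phi y (EuclideanSpace.single (1 : Fin 2) (1 : ℝ)) := by
    conv_lhs => rw [hv]
    rw [map_add, map_smul, map_smul]
  rw [h1]
  ext i
  fin_cases i
  · simp [act_apply_zero, Ctilde, Matrix.of_apply]; ring
  · simp [act_apply_one, Ctilde, Matrix.of_apply]; ring

/-- The right-hand side of the reduced system, in which the distributed state sits at its steady
profile. -/
noncomputable def reduced (F : M2) (Xs Us X : E2) : E2 :=
  act S.A₁ X + act S.G₁ (S.Phi (S.loopSlip F Xs Us X)) + S.b

theorem loopSlip_self (F : M2) (Xs Us : E2) : S.loopSlip F Xs Us Xs = S.slip Xs Us := by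
  simp [loopSlip, feedback]

theorem hasFDerivAt_reduced {S : System} (hphi : S.SmoothSteadyState) (F : M2) (Xs Us : E2) :
    HasFDerivAt (S.reduced F Xs Us)
      (act (S.A₁tilde (S.slip Xs Us) + S.G₁tilde (S.slip Xs Us) * F)) Xs := by
  have h1 : HasFDerivAt (S.loopSlip F Xs Us) (act S.A₂ + (act S.G₂).comp (act F)) Xs := by
    have : S.loopSlip F Xs Us = fun X => (act S.A₂ + (act S.G₂).comp (act F)) X
        + (S.loopSlip F Xs Us Xs - (act S.A₂ + (act S.G₂).comp (act F)) Xs) := by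
      ext1 X
      have := S.loopSlip_sub F Xs Us X Xs
      rw [map_sub] at this
      rw [sub_eq_iff_eq_add] at this
      rw [this]; abel
    rw [this]
    exact (ContinuousLinearMap.hasFDerivAt _).add_const _
  have h2 : HasFDerivAt S.Phi (fderiv ℝ S.Phi (S.slip Xs Us)) (S.loopSlip F Xs Us Xs) := by
    rw [loopSlip_self]
    exact (hphi.2.1.differentiable (by simp) _).hasFDerivAt
  have h3 := (((act S.A₁).hasFDerivAt (x := Xs)).add
    (((act S.G₁).hasFDerivAt).comp Xs (h2.comp Xs h1))).add_const S.b
  refine h3.congr_fderiv ?_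
  ext1 v
  have h4 : ∀ A B : M2, act (A + B) = act A + act B := fun A B => map_add _ A B
  simp only [add_apply, ContinuousLinearMap.comp_apply, ← act_Ctilde, A₁tilde, G₁tilde, act_mul,
    h4, map_add]
  abel

theorem odeRhs_eq (F : M2) (Xs Us X : E2) (z : L2) :
    S.odeRhs X (feedback F Xs Us X) z = S.reduced F Xs Us X
      + act S.G₁ (kernelCLM S.K₁_cont (zeta S X (feedback F Xs Us X) z)
        + act (S.Sig (S.loopSlip F Xs Us X))
          (kernelCLM S.K₂_cont (zeta S X (feedback F Xs Us X) z))) := by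
  rw [odeRhs, reduced, zeta, ← kernelCLM_apply S.K₁_cont, ← kernelCLM_apply S.K₂_cont]
  have h1 := S.h₁_eq (S.loopSlip F Xs Us X)
  change act S.A₁ X + act S.G₁ (kernelCLM S.K₁_cont z
    + act (S.Sig (S.loopSlip F Xs Us X)) (kernelCLM S.K₂_cont z))
    + act S.G₁ (S.h₁ (S.loopSlip F Xs Us X)) + S.b = act S.A₁ X
    + act S.G₁ (S.Phi (S.loopSlip F Xs Us X)) + S.b
    + act S.G₁ (kernelCLM S.K₁_cont (z - S.phiL2 (S.loopSlip F Xs Us X))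
      + act (S.Sig (S.loopSlip F Xs Us X))
        (kernelCLM S.K₂_cont (z - S.phiL2 (S.loopSlip F Xs Us X))))
  rw [h1]
  simp only [map_add, map_sub]
  abel

/-- Linearization of the lumped dynamics near the equilibrium, tested against a Lyapunov matrix of
the linearized reduced system. -/
theorem exists_lumped_bound {S : System} {Q : ℝ → M2} (hS : S.SourceDissipative Q)
    (hphi : S.SmoothSteadyState) {F : M2} {Xs Us : E2} (heq : S.IsEquilibrium Xs Us)
    {P : E2 →L[ℝ] E2}
    (hP : ∀ x, 2 * inner ℝ (P x)
      (act (S.A₁tilde (S.slip Xs Us) + S.G₁tilde (S.slip Xs Us) * F) x) = -‖x‖ ^ 2) :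
    ∃ ρ C₁ C₂ : ℝ, 0 < ρ ∧ 0 ≤ C₁ ∧ 0 ≤ C₂ ∧ ∀ (X : E2) (z : L2), ‖X - Xs‖ ≤ ρ →
      2 * inner ℝ (P (X - Xs)) (S.odeRhs X (feedback F Xs Us X) z)
        ≤ -(1 / 2) * ‖X - Xs‖ ^ 2
          + C₁ * (‖X - Xs‖ * ‖zeta S X (feedback F Xs Us X) z‖) ∧
      ‖S.odeRhs X (feedback F Xs Us X) z‖
        ≤ C₂ * (‖X - Xs‖ + ‖zeta S X (feedback F Xs Us X) z‖) := by
  set A := act (S.A₁tilde (S.slip Xs Us) + S.G₁tilde (S.slip Xs Us) * F) with hA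
  have h0 : S.reduced F Xs Us Xs = 0 := by
    rw [reduced, loopSlip_self]; exact heq
  set η : ℝ := 1 / (4 * (‖P‖ + 1)) with hη
  have hη0 : 0 < η := by positivity
  have hPη : ‖P‖ * η ≤ 1 / 4 := by
    rw [hη, mul_one_div, div_le_iff₀ (by positivity)]
    linarith
  have hlin := (hasFDerivAt_iff_isLittleO.1 (hasFDerivAt_reduced hphi F Xs Us)).def hη0
  obtain ⟨ρ', hρ', hball⟩ := Metric.eventually_nhds_iff.1 hlin
  obtain ⟨Cs, hCs, hCs'⟩ := ((S.lipBdd_act_Sig hS).comp (LipBdd.of_lipschitz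
    (f := S.loopSlip F Xs Us) fun x y => by
      rw [loopSlip_sub]; exact ContinuousLinearMap.le_opNorm _ _)).exists_bound (‖Xs‖ + ρ' / 2)
  set D : ℝ := ‖act S.G₁‖ * (‖kernelCLM S.K₁_cont‖ + Cs * ‖kernelCLM S.K₂_cont‖) with hD
  have hD0 : 0 ≤ D := by positivity
  refine ⟨ρ' / 2, 2 * ‖P‖ * D, ‖A‖ + η + D, by positivity, by positivity, by positivity,
    fun X z hX => ?_⟩
  set x := X - Xs with hx
  set w := zeta S X (feedback F Xs Us X) z with hw
  have h1 : ‖S.reduced F Xs Us X - A x‖ ≤ η * ‖x‖ := by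
    have := @hball X (by rw [dist_eq_norm]; linarith)
    rwa [h0, sub_zero] at this
  have hXn : ‖X‖ ≤ ‖Xs‖ + ρ' / 2 := by
    have : ‖X‖ ≤ ‖Xs‖ + ‖X - Xs‖ := by simpa using norm_add_le Xs (X - Xs)
    linarith
  set v := act S.G₁ (kernelCLM S.K₁_cont w
    + act (S.Sig (S.loopSlip F Xs Us X)) (kernelCLM S.K₂_cont w)) with hv
  have h2 : ‖v‖ ≤ D * ‖w‖ := by
    calc ‖v‖ ≤ ‖act S.G₁‖ * ‖kernelCLM S.K₁_cont w
          + act (S.Sig (S.loopSlip F Xs Us X)) (kernelCLM S.K₂_cont w)‖ :=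
          (act S.G₁).le_opNorm _
      _ ≤ ‖act S.G₁‖ * (‖kernelCLM S.K₁_cont‖ * ‖w‖ + Cs * (‖kernelCLM S.K₂_cont‖ * ‖w‖)) := by
          gcongr
          refine (norm_add_le _ _).trans (add_le_add (ContinuousLinearMap.le_opNorm _ _) ?_)
          refine (ContinuousLinearMap.le_opNorm _ _).trans ?_
          gcongr
          · exact hCs' X hXn
          · exact ContinuousLinearMap.le_opNorm _ _
      _ = D * ‖w‖ := by rw [hD]; ring
  have h3 : S.odeRhs X (feedback F Xs Us X) z = A x + (S.reduced F Xs Us X - A x) + v := by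
    rw [odeRhs_eq]; abel
  have h4 : ∀ y : E2, inner ℝ (P x) y ≤ ‖P‖ * ‖x‖ * ‖y‖ := fun y =>
    (real_inner_le_norm _ _).trans (by gcongr; exact P.le_opNorm x)
  constructor
  · rw [h3, inner_add_right, inner_add_right]
    have e1 := hP x
    have e2 : inner ℝ (P x) (S.reduced F Xs Us X - A x) ≤ 1 / 4 * ‖x‖ ^ 2 := by
      calc _ ≤ ‖P‖ * ‖x‖ * (η * ‖x‖) := (h4 _).trans (by gcongr)
        _ = ‖P‖ * η * ‖x‖ ^ 2 := by ring
        _ ≤ _ := by gcongr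
    have e3 : inner ℝ (P x) v ≤ ‖P‖ * ‖x‖ * (D * ‖w‖) := (h4 _).trans (by gcongr)
    rw [hA] at e2 ⊢
    linarith
  · rw [h3]
    calc _ ≤ ‖A‖ * ‖x‖ + η * ‖x‖ + D * ‖w‖ :=
          (norm_add_le _ _).trans (add_le_add ((norm_add_le _ _).trans
            (add_le_add (A.le_opNorm _) h1)) h2)
      _ ≤ _ := by nlinarith [norm_nonneg x, norm_nonneg w, norm_nonneg A,
            mul_nonneg hD0 (norm_nonneg x), mul_nonneg (norm_nonneg A) (norm_nonneg w),
            mul_nonneg hη0.le (norm_nonneg w)]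

end System
end SingleTrack

namespace SingleTrack

/-! ### Decay of the Lyapunov functional -/

namespace System

variable {S : System} {Q : ℝ → M2}

/-- The Lyapunov functional of the closed loop: a quadratic form in the lumped error plus the
weighted norm of the boundary-layer variable. -/
noncomputable def energy (S : System) (hA : S.StrictlyDissipative Q) (P : E2 →L[ℝ] E2) (F : M2)
    (Xs Us X : E2) (z : L2) : ℝ :=
  inner ℝ (X - Xs) (P (X - Xs)) + inner ℝ (zeta S X (feedback F Xs Us X) z)
    (S.weightOp hA (zeta S X (feedback F Xs Us X) z))

/-- Forward Dini derivative of the Lyapunov functional. Only Lipschitz continuity in time of the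
steady profile along the trajectory is used, and that the profile lies in the domain of `𝒜`. -/
theorem energy_dini (hA : S.StrictlyDissipative Q) (hS : S.SourceDissipative Q)
    {R : L2 →L[ℝ] L2} (hR : ∀ x y, S.GraphA x y ↔ x = -(R y)) {c om ε M κ Mφ : ℝ} (hε : 0 < ε)
    (hD : DissipativeInverse (S.weightOp hA) (ε • R) c (om / ε)) {T : ℝ → L2 →L[ℝ] L2}
    (hT : IsSemigroupOf (ε • R) M T) (hκ : κ * ‖S.weightOp hA‖ ≤ 2 * (om / ε)) (hκ0 : 0 ≤ κ)
    (hM0 : 0 ≤ Mφ) (hphi : ∀ y y' : E2, ‖S.phiL2 y - S.phiL2 y'‖ ≤ Mφ * ‖y - y'‖)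
    {P : E2 →L[ℝ] E2} (hP : ∀ x y, inner ℝ (P x) y = inner ℝ x (P y)) {F : M2} {Xs Us : E2}
    {X g₁ : ℝ → E2} {z g₂ : ℝ → L2} (hg₁ : Continuous g₁) (hg₂ : Continuous g₂) {X₀ : E2} {z₀ : L2}
    (hX : ∀ t, 0 ≤ t → X t = X₀ + ∫ s in (0 : ℝ)..t, g₁ s)
    (hz : ∀ t, 0 ≤ t → z t = T t z₀ + ∫ s in (0 : ℝ)..t, T (t - s) (g₂ s)) {t : ℝ} (ht : 0 ≤ t)
    (h₂ : g₂ t = ε⁻¹ • S.pdeSource (X t) (feedback F Xs Us (X t)) (z t)) {r : ℝ}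
    (hr : 2 * inner ℝ (P (X t - Xs)) (g₁ t)
      - κ * inner ℝ (zeta S (X t) (feedback F Xs Us (X t)) (z t))
        (S.weightOp hA (zeta S (X t) (feedback F Xs Us (X t)) (z t)))
      + 2 * (‖zeta S (X t) (feedback F Xs Us (X t)) (z t)‖ * ‖S.weightOp hA‖
        * (Mφ * (‖act S.A₂ + (act S.G₂).comp (act F)‖ * ‖g₁ t‖))) < r) :
    ∃ᶠ s in 𝓝[>] t, (s - t)⁻¹ * (S.energy hA P F Xs Us (X s) (z s)
      - S.energy hA P F Xs Us (X t) (z t)) < r := by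
  set B := act S.A₂ + (act S.G₂).comp (act F) with hB
  set p : ℝ → L2 := fun s => S.phiL2 (S.loopSlip F Xs Us (X s)) with hp
  set ζ : ℝ → L2 := fun s => zeta S (X s) (feedback F Xs Us (X s)) (z s) with hζ
  have hζp : ∀ s, ζ s = z s - p s := fun s => rfl
  have hXd : HasDerivWithinAt X (g₁ t) (Ici t) t := by
    have h := ((hg₁.integral_hasStrictDerivAt 0 t).hasDerivAt.const_add X₀).hasDerivWithinAt
      (s := Ici t)
    exact h.congr (fun s hs => hX s (ht.trans hs)) (hX t ht)
  have hshift : Tendsto (fun h : ℝ => t + h) (𝓝[>] 0) (𝓝[>] t) := by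
    refine tendsto_nhdsWithin_iff.2 ⟨?_, ?_⟩
    · have : Continuous fun h : ℝ => t + h := by fun_prop
      simpa using (this.tendsto 0).mono_left nhdsWithin_le_nhds
    · filter_upwards [self_mem_nhdsWithin] with h hh using lt_add_of_pos_right t hh
  have hslope : ∀ {G : Type} [NormedAddCommGroup G] [NormedSpace ℝ G] {f : ℝ → G} {f' : G},
      HasDerivWithinAt f f' (Ici t) t →
      Tendsto (fun h : ℝ => h⁻¹ • (f (t + h) - f t)) (𝓝[>] 0) (𝓝 f') := by
    intro G _ _ f f' hf
    have h1 := (hasDerivWithinAt_iff_tendsto_slope' (by simp)).1 hf.Ioi_of_Ici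
    refine (h1.comp hshift).congr fun h => ?_
    simp [slope]
  -- the part of the lumped state
  have hq : Tendsto (fun h : ℝ => h⁻¹ • (inner ℝ (X (t + h) - Xs) (P (X (t + h) - Xs))
      - inner ℝ (X t - Xs) (P (X t - Xs)))) (𝓝[>] 0) (𝓝 (2 * inner ℝ (P (X t - Xs)) (g₁ t))) := by
    have h1 := hXd.sub_const Xs
    have h2 := h1.inner ℝ (P.hasFDerivAt.comp_hasDerivWithinAt t h1)
    have h3 := hslope h2
    have h4 : inner ℝ (X t - Xs) (P (g₁ t)) + inner ℝ (g₁ t) (P (X t - Xs))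
        = 2 * inner ℝ (P (X t - Xs)) (g₁ t) := by
      rw [← hP, real_inner_comm (P (X t - Xs)) (g₁ t)]; ring
    simp only [Function.comp_apply] at h3
    rw [h4] at h3
    exact h3
  -- the part of the boundary layer
  set k : ℝ → L2 := fun h => h⁻¹ • (z (t + h) - T h (z t)) + h⁻¹ • (T h (p t) - p t) with hk
  have hAp : Tendsto (fun h : ℝ => h⁻¹ • (T h (p t) - p t)) (𝓝[>] 0)
      (𝓝 (-(ε⁻¹ • (S.srcOp (S.loopSlip F Xs Us (X t)) (p t)
        + constCLM (S.h₂ (S.loopSlip F Xs Us (X t))))))) := by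
    refine (hT.isGenerator _ _).1 ?_
    have h1 := (hR _ _).1 (S.graph_phiL2 hA hS (S.loopSlip F Xs Us (X t)))
    change p t = -((ε • R) (-(ε⁻¹ • _)))
    rw [map_neg, map_smul, smul_apply, smul_smul, inv_mul_cancel₀ hε.ne', one_smul, ← map_neg]
    exact h1
  have hklim : Tendsto k (𝓝[>] 0) (𝓝 (ε⁻¹ • S.srcOp (S.loopSlip F Xs Us (X t)) (ζ t))) := by
    have h1 := (hT.tendsto_mild_quotient hg₂ hz ht).add hAp
    have h2 : g₂ t + -(ε⁻¹ • (S.srcOp (S.loopSlip F Xs Us (X t)) (p t)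
        + constCLM (S.h₂ (S.loopSlip F Xs Us (X t)))))
        = ε⁻¹ • S.srcOp (S.loopSlip F Xs Us (X t)) (ζ t) := by
      rw [h₂, pdeSource_eq, hζp, map_sub, ← smul_neg, ← smul_add]
      congr 1
      change S.srcOp (S.loopSlip F Xs Us (X t)) (z t)
        + constCLM (S.h₂ (S.loopSlip F Xs Us (X t))) + _ = _
      abel
    rwa [h2] at h1
  have hy : ∀ᶠ h in 𝓝[>] (0 : ℝ), ζ (t + h) = T h (ζ t) + h • k h - (p (t + h) - p t) := by
    filter_upwards [self_mem_nhdsWithin] with h hh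
    have hh' : h ≠ 0 := (ne_of_gt hh)
    rw [hk]
    simp only [smul_add, smul_smul, mul_inv_cancel₀ hh', one_smul, hζp, map_sub]
    abel
  have he : ∀ᶠ h in 𝓝[>] (0 : ℝ), ‖p (t + h) - p t‖
      ≤ h * (Mφ * (‖B‖ * ‖h⁻¹ • (X (t + h) - X t)‖)) := by
    filter_upwards [self_mem_nhdsWithin] with h hh
    have hh' : 0 < h := hh
    refine (hphi _ _).trans ?_
    rw [loopSlip_sub, ← hB, norm_smul, norm_inv, Real.norm_of_nonneg hh'.le]
    have h1 : h * (Mφ * (‖B‖ * (h⁻¹ * ‖X (t + h) - X t‖))) = Mφ * (‖B‖ * ‖X (t + h) - X t‖) := by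
      field_simp
    rw [h1]
    gcongr
    exact B.le_opNorm _
  have hb : Tendsto (fun h : ℝ => Mφ * (‖B‖ * ‖h⁻¹ • (X (t + h) - X t)‖)) (𝓝[>] 0)
      (𝓝 (Mφ * (‖B‖ * ‖g₁ t‖))) := (((hslope hXd).norm).const_mul _).const_mul _
  obtain ⟨U, hU, hUle⟩ := hD.exists_dini_bound hT hκ hκ0 hy hklim he hb
  have hsrc : inner ℝ (ζ t) (S.weightOp hA (ε⁻¹ • S.srcOp (S.loopSlip F Xs Us (X t)) (ζ t))) ≤ 0 := by
    rw [map_smul, inner_smul_right]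
    exact mul_nonpos_of_nonneg_of_nonpos (inv_nonneg.2 hε.le) (S.inner_srcOp_le hA hS _ _)
  have hsum := hq.add hU
  have hev : ∀ᶠ h in 𝓝[>] (0 : ℝ), ((t + h) - t)⁻¹ * (S.energy hA P F Xs Us (X (t + h)) (z (t + h))
      - S.energy hA P F Xs Us (X t) (z t)) < r := by
    filter_upwards [hUle, hsum.eventually_lt_const (lt_of_le_of_lt (by linarith) hr)] with h h1 h2
    refine lt_of_le_of_lt ?_ h2
    rw [add_sub_cancel_left, smul_eq_mul]
    have h3 : S.energy hA P F Xs Us (X (t + h)) (z (t + h)) - S.energy hA P F Xs Us (X t) (z t)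
        = (inner ℝ (X (t + h) - Xs) (P (X (t + h) - Xs)) - inner ℝ (X t - Xs) (P (X t - Xs)))
          + (inner ℝ (ζ (t + h)) (S.weightOp hA (ζ (t + h)))
            - inner ℝ (ζ t) (S.weightOp hA (ζ t))) := by
      simp only [energy, hζ]
      ring
    rw [h3, mul_add]
    linarith
  exact hshift.frequently (p := fun s => (s - t)⁻¹ * (S.energy hA P F Xs Us (X s) (z s)
      - S.energy hA P F Xs Us (X t) (z t)) < r) hev.frequently

theorem stateNorm_sq (Z : E2) (w : L2) : stateNorm Z w ^ 2 = ‖Z‖ ^ 2 + ‖w‖ ^ 2 :=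
  Real.sq_sqrt (by positivity)

theorem stateNorm_nonneg (Z : E2) (w : L2) : 0 ≤ stateNorm Z w := Real.sqrt_nonneg _

theorem norm_fst_le_stateNorm (Z : E2) (w : L2) : ‖Z‖ ≤ stateNorm Z w :=
  Real.le_sqrt_of_sq_le (by nlinarith [sq_nonneg ‖w‖])

theorem norm_snd_le_stateNorm (Z : E2) (w : L2) : ‖w‖ ≤ stateNorm Z w :=
  Real.le_sqrt_of_sq_le (by nlinarith [sq_nonneg ‖Z‖])

/-- Absorption of the cross terms once the fast dissipation rate `a` is large. -/
theorem absorb_cross {x w v C₁ C₂ q₁ q₂ a V N : ℝ} (hw : 0 ≤ w)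
    (hq₁ : q₁ ≤ -(1 / 2) * x ^ 2 + C₁ * (x * w)) (hv : v ≤ C₂ * (x + w)) (hN : 0 ≤ N)
    (hq₂ : q₂ = 2 * (w * N * v)) (hV : a * w ^ 2 ≤ V)
    (ha : (C₁ + 2 * N * C₂) ^ 2 + 2 * N * C₂ + 1 / 4 ≤ a) :
    q₁ - V + q₂ ≤ -(1 / 4) * (x ^ 2 + w ^ 2) := by
  have h1 : q₂ ≤ 2 * (w * N * (C₂ * (x + w))) := by
    rw [hq₂]
    gcongr
  have h2 : ((C₁ + 2 * N * C₂) ^ 2 + 2 * N * C₂ + 1 / 4) * w ^ 2 ≤ V :=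
    (mul_le_mul_of_nonneg_right ha (sq_nonneg w)).trans hV
  nlinarith [sq_nonneg (x / 2 - (C₁ + 2 * N * C₂) * w)]

end System
end SingleTrack

namespace SingleTrack

/-- If `N²` and `W` are comparable and `W` decays exponentially as long as `N ≤ ρ`, then `N` decays
for all times: it cannot reach `ρ`, because `W` decays until the first time at which it does. -/
theorem decay_of_dini {N W : ℝ → ℝ} {ρ m₁ m₂ σ : ℝ} (hN : Continuous N) (hN0 : ∀ t, 0 ≤ N t)
    (hW : Continuous W) (hm₁ : 0 < m₁) (h₁ : ∀ t, m₁ * N t ^ 2 ≤ W t)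
    (h₂ : ∀ t, W t ≤ m₂ * N t ^ 2) (hσ : 0 ≤ σ) (hm₂ : 0 ≤ m₂)
    (hd : ∀ t, 0 ≤ t → N t ≤ ρ → ∀ r, -(2 * σ) * W t < r →
      ∃ᶠ s in 𝓝[>] t, (s - t)⁻¹ * (W s - W t) < r)
    (h0 : √(m₂ / m₁) * N 0 < ρ) {t : ℝ} (ht : 0 ≤ t) :
    N t < ρ ∧ N t ≤ √(m₂ / m₁) * Real.exp (-σ * t) * N 0 := by
  have key : ∀ τ, 0 ≤ τ → (∀ s ∈ Ico 0 τ, N s ≤ ρ) →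
      N τ ≤ √(m₂ / m₁) * Real.exp (-σ * τ) * N 0 := by
    intro τ hτ hs
    have hg := le_gronwallBound_of_liminf_deriv_right_le (f := W) (δ := W 0) (K := -(2 * σ))
      (ε := 0) (a := 0) (b := τ) hW.continuousOn (fun s hs' r hr => hd s hs'.1 (hs s hs') r hr)
      le_rfl (fun s _ => by rw [add_zero]) τ (right_mem_Icc.2 hτ)
    rw [gronwallBound_ε0, sub_zero] at hg
    have hsq : N τ ^ 2 ≤ (√(m₂ / m₁) * Real.exp (-σ * τ) * N 0) ^ 2 := by
      have e1 : Real.exp (-σ * τ) ^ 2 = Real.exp (-(2 * σ) * τ) := by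
        rw [← Real.exp_nat_mul]; congr 1; push_cast; ring
      rw [mul_pow, mul_pow, Real.sq_sqrt (by positivity), e1, div_mul_eq_mul_div,
        div_mul_eq_mul_div, le_div_iff₀ hm₁]
      calc N τ ^ 2 * m₁ ≤ W τ := by rw [mul_comm]; exact h₁ τ
        _ ≤ W 0 * Real.exp (-(2 * σ) * τ) := hg
        _ ≤ m₂ * N 0 ^ 2 * Real.exp (-(2 * σ) * τ) := by gcongr; exact h₂ 0
        _ = _ := by ring
    have hN00 := hN0 0
    exact le_of_sq_le_sq hsq (by positivity)
  have hlt : ∀ τ, 0 ≤ τ → √(m₂ / m₁) * Real.exp (-σ * τ) * N 0 < ρ := by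
    intro τ hτ
    refine lt_of_le_of_lt ?_ h0
    have h1 : Real.exp (-σ * τ) ≤ 1 := Real.exp_le_one_iff.2 (by nlinarith)
    have hN00 := hN0 0
    calc _ ≤ √(m₂ / m₁) * 1 * N 0 := by gcongr
      _ = _ := by ring
  have hreg : ∀ τ, 0 ≤ τ → N τ < ρ := by
    by_contra! hcon
    obtain ⟨τ, hτ, hτρ⟩ := hcon
    set A : Set ℝ := Ici 0 ∩ {s | ρ ≤ N s} with hA
    have hAc : IsClosed A := isClosed_Ici.inter (isClosed_le continuous_const hN)
    have hAb : BddBelow A := ⟨0, fun s hs => hs.1⟩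
    have hmem : sInf A ∈ A := hAc.csInf_mem ⟨τ, hτ, hτρ⟩ hAb
    have hlow : ∀ s ∈ Ico 0 (sInf A), N s ≤ ρ := by
      intro s hs
      by_contra! hcon
      exact absurd (csInf_le hAb ⟨hs.1, hcon.le⟩) (not_le.2 hs.2)
    have h1 := (key _ hmem.1 hlow).trans_lt (hlt _ hmem.1)
    exact absurd hmem.2 (not_le.2 h1)
  exact ⟨hreg t ht, key t ht fun s hs => (hreg s hs.1).le⟩

/-! ### The interconnection as a semilinear equation -/

namespace System

variable {S : System} {Q : ℝ → M2}

/-- The semigroup of the linear part of the interconnection: constant in the lumped component. -/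
noncomputable def pairFamily (T : ℝ → L2 →L[ℝ] L2) (t : ℝ) : E2 × L2 →L[ℝ] E2 × L2 :=
  (ContinuousLinearMap.id ℝ E2).prodMap (T t)

theorem isStrongFamily_pair {T : ℝ → L2 →L[ℝ] L2} {M : ℝ} (hT : IsStrongFamily T M) :
    IsStrongFamily (pairFamily T) (max 1 M) := by
  refine ⟨fun t x => ?_, fun x => ?_⟩
  · change ‖(x.1, T t x.2)‖ ≤ _
    rw [Prod.norm_mk]
    refine max_le ?_ ((hT.bound t x.2).trans ?_)
    · calc ‖x.1‖ ≤ 1 * ‖x‖ := by rw [one_mul]; exact norm_fst_le x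
        _ ≤ _ := by gcongr; exact le_max_left _ _
    · exact mul_le_mul (le_max_right _ _) (norm_snd_le x) (norm_nonneg _)
        (zero_le_one.trans (le_max_left _ _))
  · exact continuous_const.prodMk (hT.cont x.2)

/-- Mild solutions of the pair, read componentwise. -/
theorem mild_pair_iff {T : ℝ → L2 →L[ℝ] L2} {M : ℝ} (hT : IsStrongFamily T M) {g : ℝ → E2 × L2}
    (hg : Continuous g) (x v : E2 × L2) (t : ℝ) :
    v = pairFamily T t x + ∫ s in (0 : ℝ)..t, pairFamily T (t - s) (g s) ↔
      v.1 = x.1 + ∫ s in (0 : ℝ)..t, (g s).1 ∧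
      v.2 = T t x.2 + ∫ s in (0 : ℝ)..t, T (t - s) (g s).2 := by
  have hi : IntervalIntegrable (fun s => pairFamily T (t - s) (g s)) volume 0 t :=
    ((isStrongFamily_pair hT).continuous_comp (by fun_prop) hg).intervalIntegrable _ _
  have h1 := (ContinuousLinearMap.fst ℝ E2 L2).intervalIntegral_comp_comm hi
  have h2 := (ContinuousLinearMap.snd ℝ E2 L2).intervalIntegral_comp_comm hi
  rw [Prod.ext_iff, Prod.fst_add, Prod.snd_add]
  change ∫ s in (0 : ℝ)..t, (g s).1 = (∫ s in (0 : ℝ)..t, pairFamily T (t - s) (g s)).1 at h1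
  change ∫ s in (0 : ℝ)..t, T (t - s) (g s).2
    = (∫ s in (0 : ℝ)..t, pairFamily T (t - s) (g s)).2 at h2
  rw [← h1, ← h2]
  rfl

theorem generator_eq {R : L2 →L[ℝ] L2} (hR : ∀ x y, S.GraphA x y ↔ x = -(R y)) (ε : ℝ) :
    (fun x y => S.GraphA x (ε • y)) = fun x y => x = -((ε • R) y) := by
  ext x y
  rw [hR, map_smul, smul_apply]

/-- A mild solution may come with any semigroup that has the prescribed generator; uniqueness of
that semigroup reduces the claim to Gronwall's inequality. -/
theorem isMildSolution_unique (hA : S.StrictlyDissipative Q) (hS : S.SourceDissipative Q)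
    (hphi : S.SmoothSteadyState) {R : L2 →L[ℝ] L2} (hR : ∀ x y, S.GraphA x y ↔ x = -(R y))
    {c om ε M : ℝ} (hD : DissipativeInverse (S.weightOp hA) (ε • R) c (om / ε))
    {T : ℝ → L2 →L[ℝ] L2} (hT : IsSemigroupOf (ε • R) M T) {F : M2} {Xs Us X₀ : E2} {z₀ : L2}
    {u : ℝ → E2 × L2} (huc : Continuous u)
    (hu : ∀ t, 0 ≤ t → u t = pairFamily T t (X₀, z₀)
      + ∫ s in (0 : ℝ)..t, pairFamily T (t - s) (S.closedLoop ε F Xs Us (u s)))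
    {X' : ℝ → E2} {z' : ℝ → L2}
    (h : IsMildSolution S ε (fun t => feedback F Xs Us (X' t)) X₀ z₀ X' z') {t : ℝ} (ht : 0 ≤ t) :
    (X' t, z' t) = u t := by
  have hLip := lipBdd_closedLoop hA hS hphi ε F Xs Us
  obtain ⟨T', hT', hg', hz'⟩ := h.distributed
  rw [generator_eq hR] at hg'
  have hTT : ∀ s, 0 ≤ s → ∀ f, T' s f = T s f := fun s hs f =>
    hD.semigroup_unique hT hT' hg' hs f
  -- a trajectory on nonnegative times is extended by its initial value
  let v : ℝ → E2 × L2 := fun s => (X' (max s 0), z' (max s 0))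
  have hvc : Continuous v :=
    (h.continuousOn_X.comp_continuous (by fun_prop) fun s => le_max_right s 0).prodMk
      (h.continuousOn_z.comp_continuous (by fun_prop) fun s => le_max_right s 0)
  have hv0 : ∀ s, 0 ≤ s → v s = (X' s, z' s) := fun s hs => by simp only [v, max_eq_left hs]
  have hv : ∀ τ, 0 ≤ τ → v τ = pairFamily T τ (X₀, z₀)
      + ∫ s in (0 : ℝ)..τ, pairFamily T (τ - s) (S.closedLoop ε F Xs Us (v s)) := by
    intro τ hτ
    rw [mild_pair_iff hT.isStrongFamily (g := fun s => S.closedLoop ε F Xs Us (v s))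
      (hLip.continuous.comp hvc), hv0 τ hτ]
    refine ⟨?_, ?_⟩
    · refine (h.lumped τ hτ).trans (congrArg (X₀ + ·) ?_)
      refine intervalIntegral.integral_congr fun s hs => ?_
      rw [uIcc_of_le hτ] at hs
      simp only [hv0 s hs.1, closedLoop]
    · refine (hz' τ hτ).trans (congrArg₂ (· + ·) (hTT τ hτ z₀) ?_)
      refine intervalIntegral.integral_congr fun s hs => ?_
      rw [uIcc_of_le hτ] at hs
      simp only [hv0 s hs.1, closedLoop]
      exact hTT _ (by linarith [hs.2]) _
  rw [← hv0 t ht]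
  exact (isStrongFamily_pair hT.isStrongFamily).mild_unique hLip hLip.continuous hvc huc hv hu ht

end System
end SingleTrack

namespace SingleTrack

/-! ### Exponential stability of the closed loop -/

namespace System

variable {S : System} {Q : ℝ → M2}

theorem energy_bounds {hA : S.StrictlyDissipative Q} {c p : ℝ}
    (hco : ∀ x, c * ‖x‖ ^ 2 ≤ inner ℝ x (S.weightOp hA x)) {P : E2 →L[ℝ] E2}
    (hPc : ∀ x, p * ‖x‖ ^ 2 ≤ inner ℝ x (P x)) (F : M2) (Xs Us X : E2) (z : L2) :
    min p c * stateNorm (X - Xs) (zeta S X (feedback F Xs Us X) z) ^ 2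
      ≤ S.energy hA P F Xs Us X z ∧
    S.energy hA P F Xs Us X z
      ≤ (‖P‖ + ‖S.weightOp hA‖ + 1) * stateNorm (X - Xs) (zeta S X (feedback F Xs Us X) z) ^ 2 := by
  rw [stateNorm_sq, energy]
  generalize X - Xs = x
  generalize zeta S X (feedback F Xs Us X) z = w
  have h1 := mul_le_mul_of_nonneg_right (min_le_left p c) (sq_nonneg ‖x‖)
  have h2 := mul_le_mul_of_nonneg_right (min_le_right p c) (sq_nonneg ‖w‖)
  have h3 := DissipativeInverse.weight_le P x
  have h4 := DissipativeInverse.weight_le (S.weightOp hA) w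
  have h5 := mul_nonneg (norm_nonneg P) (sq_nonneg ‖w‖)
  have h6 := mul_nonneg (norm_nonneg (S.weightOp hA)) (sq_nonneg ‖x‖)
  constructor
  · linarith [hPc x, hco w]
  · nlinarith [sq_nonneg ‖x‖, sq_nonneg ‖w‖]

end System
end SingleTrack

open SingleTrack in
theorem mainTheorem2 (S : SingleTrack.System) (Q : ℝ → SingleTrack.M2)
    (hA : S.StrictlyDissipative Q) (hSig : S.SourceDissipative Q)
    (hphi : S.SmoothSteadyState)
    (Xs Us : SingleTrack.E2) (heq : S.IsEquilibrium Xs Us)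
    (hstab : SingleTrack.IsStabilizable
      (S.A₁tilde (S.slip Xs Us)) (S.G₁tilde (S.slip Xs Us)))
    (F : SingleTrack.M2)
    (hF : SingleTrack.IsHurwitz
      (S.A₁tilde (S.slip Xs Us) + S.G₁tilde (S.slip Xs Us) * F)) :
    ∃ εs r β σ : ℝ, 0 < εs ∧ 0 < r ∧ 0 < β ∧ 0 < σ ∧
      ∀ ε : ℝ, 0 < ε → ε < εs →
      ∀ (X₀ : SingleTrack.E2) (z₀ : SingleTrack.L2),
        SingleTrack.stateNorm (X₀ - Xs)
          (SingleTrack.zeta S X₀ (SingleTrack.feedback F Xs Us X₀) z₀) < r →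
        ∃ (X : ℝ → SingleTrack.E2) (z : ℝ → SingleTrack.L2),
          SingleTrack.IsMildSolution S ε
            (fun t => SingleTrack.feedback F Xs Us (X t)) X₀ z₀ X z ∧
          (∀ (X' : ℝ → SingleTrack.E2) (z' : ℝ → SingleTrack.L2),
            SingleTrack.IsMildSolution S ε
              (fun t => SingleTrack.feedback F Xs Us (X' t)) X₀ z₀ X' z' →
            ∀ t : ℝ, 0 ≤ t → X' t = X t ∧ z' t = z t) ∧
          ∀ t : ℝ, 0 ≤ t →
            SingleTrack.stateNorm (X t - Xs)
              (SingleTrack.zeta S (X t) (SingleTrack.feedback F Xs Us (X t)) (z t))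
            ≤ β * Real.exp (-σ * t) *
              SingleTrack.stateNorm (X₀ - Xs)
                (SingleTrack.zeta S X₀ (SingleTrack.feedback F Xs Us X₀) z₀) := by
  obtain ⟨P, p, hp, hPs, hPc, hPA⟩ := hF.exists_lyapunov
  obtain ⟨R, c, om, hR, hDI⟩ := S.exists_dissipativeInverse hA
  have hc : 0 < c := (hDI 1 one_pos).c_pos
  have hom : 0 < om := by simpa using (hDI 1 one_pos).om_pos
  obtain ⟨ρ, C₁, C₂, hρ, hC₁, hC₂, hlump⟩ := System.exists_lumped_bound hSig hphi heq hPA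
  obtain ⟨Mφ, hM0, hMφ⟩ := hphi.2.2
  have hphiL := System.norm_phiL2_sub_le hM0 hphi hMφ
  set qn : ℝ := ‖S.weightOp hA‖ with hqn
  have hqn0 : 0 ≤ qn := norm_nonneg _
  set B : ℝ := ‖act S.A₂ + (act S.G₂).comp (act F)‖ with hB
  have hB0 : 0 ≤ B := norm_nonneg _
  set N₀ : ℝ := qn * (Mφ * B) with hN₀
  have hN₀0 : 0 ≤ N₀ := by positivity
  set m₁ : ℝ := min p c with hm₁
  set m₂ : ℝ := ‖P‖ + qn + 1 with hm₂
  have hm₁0 : 0 < m₁ := lt_min hp hc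
  have hm₂0 : 0 < m₂ := by positivity
  set β : ℝ := √(m₂ / m₁) with hβ
  have hβ0 : 0 < β := Real.sqrt_pos.2 (by positivity)
  -- the dissipation rate of `‖ζ‖²` that absorbs all cross terms
  set a₀ : ℝ := (C₁ + 2 * N₀ * C₂) ^ 2 + 2 * N₀ * C₂ + 1 / 4 with ha₀
  have ha₀0 : 0 < a₀ := by positivity
  -- the decay rate of the boundary layer in the weighted norm is `κ₀ / ε`
  set κ₀ : ℝ := 2 * om / (qn + 1) with hκ₀
  have hκ₀0 : 0 < κ₀ := by positivity
  refine ⟨κ₀ * c / a₀, ρ / β, β, 1 / (8 * m₂), by positivity, by positivity, hβ0, by positivity,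
    fun ε hε hεs X₀ z₀ hr => ?_⟩
  have hD := hDI ε hε
  obtain ⟨T, hT⟩ := hD.exists_isSemigroupOf
  have hLip := System.lipBdd_closedLoop hA hSig hphi ε F Xs Us
  obtain ⟨Cp, hCp, hCp'⟩ := ((System.lipBdd_phiL2 hphi).comp (LipBdd.of_lipschitz
    (f := S.loopSlip F Xs Us) fun x y => by
      rw [System.loopSlip_sub]; exact ContinuousLinearMap.le_opNorm _ _)).exists_bound (‖Xs‖ + ρ)
  -- the region where the error is at most `ρ` lies in the ball of radius `Rb`
  set Rb : ℝ := ‖Xs‖ + ρ + Cp with hRb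
  have hRb0 : 0 < Rb := by positivity
  obtain ⟨u, huc, hu⟩ :=
    (System.isStrongFamily_pair hT.isStrongFamily).exists_mild_retr hLip hRb0 (X₀, z₀)
  set g : ℝ → E2 × L2 := fun s => S.closedLoop ε F Xs Us (retr Rb (u s)) with hg
  have hgc : Continuous g := hLip.continuous.comp (by
    refine (LipBdd.of_lipschitz (f := retr Rb) (norm_retr_sub_le hRb0)).continuous.comp huc)
  have hu2 := fun t ht =>
    (System.mild_pair_iff hT.isStrongFamily hgc (X₀, z₀) (u t) t).1 (hu t ht)
  set X : ℝ → E2 := fun t => (u t).1 with hX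
  set z : ℝ → L2 := fun t => (u t).2 with hz
  have hXc : Continuous X := huc.fst
  have hzc : Continuous z := huc.snd
  have hu0 : u 0 = (X₀, z₀) := by
    have h := hu2 0 le_rfl
    rw [intervalIntegral.integral_same, intervalIntegral.integral_same, hT.zero, add_zero,
      add_zero] at h
    exact Prod.ext h.1 h.2
  set N : ℝ → ℝ := fun t =>
    stateNorm (X t - Xs) (zeta S (X t) (feedback F Xs Us (X t)) (z t)) with hN
  set W : ℝ → ℝ := fun t => S.energy hA P F Xs Us (X t) (z t) with hW
  have hζc : Continuous fun t => zeta S (X t) (feedback F Xs Us (X t)) (z t) := by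
    have h1 : Continuous (S.loopSlip F Xs Us) := (LipBdd.of_lipschitz fun x y => by
      rw [System.loopSlip_sub]; exact ContinuousLinearMap.le_opNorm _ _).continuous
    exact hzc.sub ((System.lipBdd_phiL2 hphi).continuous.comp (h1.comp hXc))
  have hNc : Continuous N := by
    refine Real.continuous_sqrt.comp ?_
    exact ((hXc.sub continuous_const).norm.pow 2).add (hζc.norm.pow 2)
  have hWc : Continuous W := by
    have h1 : Continuous fun t => X t - Xs := hXc.sub continuous_const
    exact (h1.inner (P.continuous.comp h1)).add
      (hζc.inner ((S.weightOp hA).continuous.comp hζc))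
  have hbounds := fun t => System.energy_bounds hD.coercive hPc F Xs Us (X t) (z t)
  -- within the region the retraction is inactive
  have hret : ∀ t, N t ≤ ρ → retr Rb (u t) = u t := by
    intro t ht
    refine retr_of_le hRb0 ?_
    have h1 := (System.norm_fst_le_stateNorm (X t - Xs) _).trans ht
    have h2 := (System.norm_snd_le_stateNorm (X t - Xs)
      (zeta S (X t) (feedback F Xs Us (X t)) (z t))).trans ht
    have h3 : ‖X t‖ ≤ ‖Xs‖ + ρ := by
      have : ‖X t‖ ≤ ‖Xs‖ + ‖X t - Xs‖ := by simpa using norm_add_le Xs (X t - Xs)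
      linarith
    have h4 : ‖z t‖ ≤ ρ + Cp := by
      have h5 : z t = zeta S (X t) (feedback F Xs Us (X t)) (z t)
          + S.phiL2 (S.loopSlip F Xs Us (X t)) := by
        rw [zeta, System.loopSlip]; abel
      rw [h5]
      exact (norm_add_le _ _).trans (add_le_add h2 (hCp' _ h3))
    rw [← Prod.mk.eta (p := u t), Prod.norm_mk]
    exact max_le (h3.trans (by linarith)) (h4.trans (by linarith [norm_nonneg Xs]))
  have hgN : ∀ t, N t ≤ ρ → g t = S.closedLoop ε F Xs Us (X t, z t) := fun t ht => by
    simp only [hg, hret t ht]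
    rfl
  have hdini : ∀ t, 0 ≤ t → N t ≤ ρ → ∀ r, -(2 * (1 / (8 * m₂))) * W t < r →
      ∃ᶠ s in 𝓝[>] t, (s - t)⁻¹ * (W s - W t) < r := by
    intro t ht hNt r hr
    have hgt := hgN t hNt
    have hg1 : (g t).1 = S.odeRhs (X t) (feedback F Xs Us (X t)) (z t) := by rw [hgt]; rfl
    have hg2 : (g t).2 = ε⁻¹ • S.pdeSource (X t) (feedback F Xs Us (X t)) (z t) := by
      rw [hgt]; rfl
    have hκ : κ₀ / ε * qn ≤ 2 * (om / ε) := by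
      have h1 : κ₀ * qn ≤ 2 * om := by
        rw [hκ₀, div_mul_eq_mul_div, div_le_iff₀ (by positivity)]
        nlinarith
      rw [div_mul_eq_mul_div, ← mul_div_assoc]
      gcongr
    refine System.energy_dini hA hSig hR hε hD hT (κ := κ₀ / ε) hκ (by positivity) hM0 hphiL hPs
      (g₁ := fun s => (g s).1) (g₂ := fun s => (g s).2) hgc.fst hgc.snd
      (fun s hs => (hu2 s hs).1) (fun s hs => (hu2 s hs).2) ht hg2 (lt_of_le_of_lt ?_ hr)
    have hl := hlump (X t) (z t) ((System.norm_fst_le_stateNorm _ _).trans hNt)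
    rw [← hg1] at hl
    have hV := mul_le_mul_of_nonneg_left
      (hD.coercive (zeta S (X t) (feedback F Xs Us (X t)) (z t))) (by positivity : 0 ≤ κ₀ / ε)
    rw [← mul_assoc] at hV
    have ha : a₀ ≤ κ₀ / ε * c := by
      rw [div_mul_eq_mul_div, le_div_iff₀ hε]
      rw [lt_div_iff₀ ha₀0] at hεs
      linarith
    have h1 := System.absorb_cross (norm_nonneg _) hl.1 hl.2 hN₀0
      (q₂ := 2 * (‖zeta S (X t) (feedback F Xs Us (X t)) (z t)‖ * qn * (Mφ * (B * ‖(g t).1‖))))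
      (by rw [hN₀]; ring) hV ha
    refine h1.trans ?_
    have h2 := (hbounds t).2
    rw [← System.stateNorm_sq]
    have h3 : 2 * (1 / (8 * m₂)) * W t
        ≤ 2 * (1 / (8 * m₂)) * (m₂ * stateNorm (X t - Xs)
          (zeta S (X t) (feedback F Xs Us (X t)) (z t)) ^ 2) := by gcongr
    have h4 : 2 * (1 / (8 * m₂)) * (m₂ * stateNorm (X t - Xs)
          (zeta S (X t) (feedback F Xs Us (X t)) (z t)) ^ 2)
        = 1 / 4 * stateNorm (X t - Xs)
          (zeta S (X t) (feedback F Xs Us (X t)) (z t)) ^ 2 := by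
      field_simp; ring
    linarith
  have hN0 : N 0 = stateNorm (X₀ - Xs) (zeta S X₀ (feedback F Xs Us X₀) z₀) := by
    simp only [hN, hX, hz, hu0]
  have hdec := fun t (ht : 0 ≤ t) => decay_of_dini hNc
    (fun s => System.stateNorm_nonneg _ _) hWc hm₁0 (fun s => (hbounds s).1)
    (fun s => (hbounds s).2) (by positivity) hm₂0.le hdini
    (by rw [hN0, mul_comm]; exact (lt_div_iff₀ hβ0).1 hr) ht
  have hgs : ∀ s, 0 ≤ s → g s = S.closedLoop ε F Xs Us (X s, z s) := fun s hs =>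
    hgN s (hdec s hs).1.le
  have huu : ∀ t, 0 ≤ t → u t = System.pairFamily T t (X₀, z₀)
      + ∫ s in (0 : ℝ)..t, System.pairFamily T (t - s) (S.closedLoop ε F Xs Us (u s)) := by
    intro t ht
    refine (hu t ht).trans (congrArg _ (intervalIntegral.integral_congr fun s hs => ?_))
    rw [uIcc_of_le ht] at hs
    exact congrArg _ (hgs s hs.1)
  refine ⟨X, z, ⟨hXc.continuousOn, hzc.continuousOn, fun t ht => ?_, T, hT.isC0Semigroup, ?_,
    fun t ht => ?_⟩, fun X' z' h t ht => ?_, fun t ht => ?_⟩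
  · refine (hu2 t ht).1.trans (congrArg _ (intervalIntegral.integral_congr fun s hs => ?_))
    rw [uIcc_of_le ht] at hs
    exact congrArg Prod.fst (hgs s hs.1)
  · rw [System.generator_eq hR]
    exact hT.isGenerator
  · refine (hu2 t ht).2.trans (congrArg _ (intervalIntegral.integral_congr fun s hs => ?_))
    rw [uIcc_of_le ht] at hs
    exact congrArg (fun q : E2 × L2 => T (t - s) q.2) (hgs s hs.1)
  · exact Prod.ext_iff.1 (System.isMildSolution_unique hA hSig hphi hR hD hT huc huu h ht)
  · have h1 := (hdec t ht).2
    rwa [hN0] at h1
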